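/- Let $k_1,\dots,k_m$ be positive integers, $n=k_1+\dots+k_m$, $\mathbf k=(k_1,\dots,k_m)$, and let $\lambda>-1$. Write $z\in\mathbb C^n$ as $z=(z_{(1)},\dots,z_{(m)})$ with $z_{(j)}=(z_{j,1},\dots,z_{j,k_j})\in\mathbb C^{k_j}$, and write multi-indices accordingly as $\alpha=(\alpha_{(1)},\dots,\alpha_{(m)})\in\mathbb Z_+^n$. Let $\mathcal A_\lambda(\mathbb B^n)$ be the weighted Bergman space of holomorphic functions in $L_2(\mathbb B^n,dv_\lambda)$, where $\mathbb B^n$ is the Euclidean unit ball of $\mathbb C^n$ and $$dv_\lambda(z)=\frac{\Gamma(n+\lambda+1)}{\pi^n\,\Gamma(\lambda+1)}(1-|z|^2)^\lambda\,dV(z)$$ with $dV$ Lebesgue measure, and let $$e_\alpha(z)=\sqrt{\frac{\Gamma(n+|\alpha|+\lambda+1)}{\alpha!\,\Gamma(n+\lambda+1)}}\;z^\alpha,\qquad f_\alpha=\langle f,e_\alpha\rangle .$$ For $\mathbf s\in\mathbb Z_+^m$ put $H_{\mathbf s}=\mathrm{span}\{e_\alpha:\ |\alpha_{(j)}|=s_j,\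 j=1,\dots,m\}$. For $j=1,\dots,m$ let $$V_{(j)}=\sum_{l=1}^{k_j} z_{j,l}\frac{\partial}{\partial z_{j,l}}$$ with maximal domain $\{f\in\mathcal A_\lambda(\mathbb B^n): V_{(j)}f\in\mathcal A_\lambda(\mathbb B^n)\}$. Let the block diagonal group $\mathbf U(\mathbf k)=\mathbf U(k_1)\times\dots\times\mathbf U(k_m)\subset\mathbf U(n)$ act on $\mathcal A_\lambda(\mathbb B^n)$ by $\pi_\lambda(U)f=f\circ U^{-1}$, and let $\mathrm{End}_{\mathbf U(\mathbf k)}(\mathcal A_\lambda(\mathbb B^n))$ be the set of bounded operators $T$ with $T\pi_\lambda(U)=\pi_\lambda(U)T$ for all $U\in\mathbf U(\mathbf k)$. Then $\mathcal A_\lambda(\mathbb B^n)$ is a Hilbert space, and the following hold. (a) The domain of $V_{(j)}$ is $\{f:\ \sum_\alpha|\alpha_{(j)}|^2|f_\alpha|^2<\infty\}$. (b) The tuple $\mathbf V=(V_{(1)},\dots,V_{(m)})$ has a unique joint spectral measure $E$ on the Borel sets of $\mathbb R^m$, i.e. a unique spectral measure with $V_{(j)}=\int_{\mathbb R^m}\eta_j\,dE(\eta)$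 for every $j$, equality of domains included. For every $E$-measurable $E$-essentially bounded $\psi:\mathbb R^m\to\mathbb C$ there is a unique bounded operator $\psi(\mathbf V)=\int_{\mathbb R^m}\psi\,dE$. (c) Let $\mathcal R(\mathbf k)$ be the set of all operators $\psi(\mathbf V)$, where $\psi$ is $E$-measurable and $E$-essentially bounded with $\{\psi(\mathbf s)\}_{\mathbf s\in\mathbb Z_+^m}\in\ell_\infty(\mathbb Z_+^m)$. Then $\mathrm{End}_{\mathbf U(\mathbf k)}(\mathcal A_\lambda(\mathbb B^n))$ is a von Neumann algebra, and $\mathcal R(\mathbf k)=\mathrm{End}_{\mathbf U(\mathbf k)}(\mathcal A_\lambda(\mathbb B^n))$. (d) Every $T\in\mathrm{End}_{\mathbf U(\mathbf k)}(\mathcal A_\lambda(\mathbb B^n))$ maps each $H_{\mathbf s}$ into itself. Every function $\psi:\mathbb R^m\to\mathbb C$ with $$\psi(\mathbf s)=\frac{\mathrm{tr}\,(T|_{H_{\mathbf s}})}{\dim H_{\mathbf s}}\qquad\text{for all }\mathbf s\in\mathbb Z_+^m$$ is $E$-measurable and $E$-essentially bounded with $\{\psi(\mathbf s)\}\in\ell_\infty(\mathbb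 Z_+^m)$, and $T=\psi(V_{(1)},\dots,V_{(m)})$. -/

import Mathlib

open MeasureTheory
open scoped InnerProductSpace

noncomputable section

/-! ### Projection-valued measures and the joint functional calculus -/

section SpectralTheory

variable {X : Type*} [MeasurableSpace X]
variable {H : Type*} [NormedAddCommGroup H] [InnerProductSpace ℂ H]

/-- A spectral (orthogonal-projection-valued) measure on `X` acting on `H`. Countable additivity is
in the strong operator topology. Values at non-measurable sets carry no information and are `0`. -/
structure SpectralMeasure (X : Type*) [MeasurableSpace X]
    (H : Type*) [NormedAddCommGroup H] [InnerProductSpace ℂ H] where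
  /-- the projection attached to a measurable set -/
  proj : Set X → H →L[ℂ] H
  isProjection : ∀ s, MeasurableSet s → (proj s : H →ₗ[ℂ] H).IsSymmetricProjection
  proj_empty : proj ∅ = 0
  proj_univ : proj Set.univ = ContinuousLinearMap.id ℂ H
  proj_inter : ∀ s t, MeasurableSet s → MeasurableSet t → proj (s ∩ t) = proj s ∘L proj t
  hasSum_iUnion : ∀ A : ℕ → Set X, (∀ i, MeasurableSet (A i)) → Pairwise (Function.onFun Disjoint A) →
    ∀ f : H, HasSum (fun i => proj (A i) f) (proj (⋃ i, A i) f)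
  not_measurable : ∀ s, ¬ MeasurableSet s → proj s = 0

namespace SpectralMeasure

variable (E : SpectralMeasure X H)

theorem re_inner_proj_nonneg {s : Set X} (hs : MeasurableSet s) (f : H) :
    0 ≤ (⟪f, E.proj s f⟫_ℂ).re := by
  have h := E.isProjection s hs
  have h1 : E.proj s (E.proj s f) = E.proj s f :=
    congrArg (fun T : H →ₗ[ℂ] H => T f) h.isIdempotentElem
  have h2 : ⟪E.proj s f, E.proj s f⟫_ℂ = ⟪f, E.proj s (E.proj s f)⟫_ℂ := h.isSymmetric _ _
  rw [h1] at h2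
  rw [← h2]
  exact inner_self_nonneg (𝕜 := ℂ) (x := E.proj s f)

/-- The finite positive measure `s ↦ ⟨E(s) f, f⟩`. -/
def scalarMeasure (f : H) : Measure X :=
  Measure.ofMeasurable (fun s _ => ENNReal.ofReal (⟪f, E.proj s f⟫_ℂ).re)
    (by simp [E.proj_empty])
    (by
      intro A hA hd
      have h1 := (E.hasSum_iUnion A hA hd f).mapL (innerSL ℂ f)
      have h2 : HasSum (fun i => (⟪f, E.proj (A i) f⟫_ℂ).re) (⟪f, E.proj (⋃ i, A i) f⟫_ℂ).re :=
        Complex.hasSum_re h1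
      rw [← h2.tsum_eq]
      exact ENNReal.ofReal_tsum_of_nonneg (fun i => E.re_inner_proj_nonneg (hA i) f) h2.summable)

theorem scalarMeasure_apply (f : H) {s : Set X} (hs : MeasurableSet s) :
    E.scalarMeasure f s = ENNReal.ofReal (⟪f, E.proj s f⟫_ℂ).re :=
  Measure.ofMeasurable_apply s hs

/-- A property of points that holds outside a measurable set of spectral measure zero. -/
def AE (p : X → Prop) : Prop :=
  ∃ N : Set X, MeasurableSet N ∧ E.proj N = 0 ∧ ∀ x, x ∉ N → p x

/-- `ψ` is `E`-measurable: it agrees `E`-almost everywhere with a measurable function. -/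
def EMeasurable (ψ : X → ℂ) : Prop :=
  ∃ φ : X → ℂ, Measurable φ ∧ E.AE (fun x => ψ x = φ x)

/-- `ψ` is `E`-essentially bounded. -/
def EssBounded (ψ : X → ℂ) : Prop :=
  ∃ C : ℝ, E.AE (fun x => ‖ψ x‖ ≤ C)

/-- The (possibly unbounded) operator `A` is `∫ ψ dE`: its domain consists of the `f` with
`∫ |ψ|² d⟨E f, f⟩ < ∞`, and `⟨A f, f⟩ = ∫ ψ d⟨E f, f⟩` on this domain (which determines `A`, by
polarization and density of the domain). The inner product of Mathlib is linear in the second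
variable. -/
def IsIntegral (ψ : X → ℂ) (A : H →ₗ.[ℂ] H) : Prop :=
  E.EMeasurable ψ ∧
  (∀ f : H, f ∈ A.domain ↔ ∫⁻ x, ENNReal.ofReal (‖ψ x‖ ^ 2) ∂(E.scalarMeasure f) < ⊤) ∧
  ∀ f : A.domain, ⟪(f : H), A f⟫_ℂ = ∫ x, ψ x ∂(E.scalarMeasure (f : H))

end SpectralMeasure

/-- A bounded operator, regarded as an everywhere defined partial operator. -/
def boundedOp (T : H →L[ℂ] H) : H →ₗ.[ℂ] H := (T : H →ₗ[ℂ] H).toPMap ⊤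

/-- `E` is the joint spectral measure of the tuple `V` of (unbounded, self-adjoint, strongly
commuting) operators: `V j = ∫ η_j dE(η)` for every `j`. -/
def IsJointSpectralMeasure {m : ℕ} (V : Fin m → H →ₗ.[ℂ] H)
    (E : SpectralMeasure (Fin m → ℝ) H) : Prop :=
  ∀ j, E.IsIntegral (fun η => ((η j : ℝ) : ℂ)) (V j)

/-- The point of `ℝᵐ` given by a multi-index in `ℤ₊ᵐ`. -/
def latticePt {m : ℕ} (s : Fin m → ℕ) : Fin m → ℝ := fun j => (s j : ℝ)

/-- The restriction `{ψ(s)}` of a function on `ℝᵐ` to `ℤ₊ᵐ` belongs to `ℓ_∞(ℤ₊ᵐ)`. -/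
def BoundedOnLattice {m : ℕ} (ψ : (Fin m → ℝ) → ℂ) : Prop :=
  Memℓp (fun s : Fin m → ℕ => ψ (latticePt s)) ⊤

/-- The bounded operators `ψ(V) = ∫ ψ dE` with `ψ` an `E`-measurable, `E`-essentially bounded
function for which `{ψ(s)}` lies in `ℓ_∞(ℤ₊ᵐ)`. -/
def functionsOf {m : ℕ} (E : SpectralMeasure (Fin m → ℝ) H) : Set (H →L[ℂ] H) :=
  {T | ∃ ψ : (Fin m → ℝ) → ℂ, E.EMeasurable ψ ∧ E.EssBounded ψ ∧ BoundedOnLattice ψ ∧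
    E.IsIntegral ψ (boundedOp T)}

end SpectralTheory

/-! ### The weighted Bergman space on the unit ball -/

section Bergman

/-- Coordinates `z_{j,l}`, `1 ≤ l ≤ k_j`, grouped according to the tuple `k`. -/
abbrev Coord {m : ℕ} (k : Fin m → ℕ) : Type := Σ j : Fin m, Fin (k j)

variable {ι : Type*} [Fintype ι]

/-- The Euclidean open unit ball of `ℂ^ι`. -/
def unitBall (ι : Type*) [Fintype ι] : Set (ι → ℂ) := {z | ∑ i, ‖z i‖ ^ 2 < 1}

/-- The density `c_λ (1 - |z|²)^λ` with `c_λ = Γ(n+λ+1) / (πⁿ Γ(λ+1))`. -/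
def bergmanDensity (ι : Type*) [Fintype ι] (lam : ℝ) (z : ι → ℂ) : ℝ :=
  Real.Gamma (Fintype.card ι + lam + 1) / (Real.pi ^ Fintype.card ι * Real.Gamma (lam + 1)) *
    (1 - ∑ i, ‖z i‖ ^ 2) ^ lam

/-- The weighted measure `dv_λ` on the unit ball (extended by zero to `ℂ^ι`). -/
def bergmanMeasure (ι : Type*) [Fintype ι] (lam : ℝ) : Measure (ι → ℂ) :=
  (volume.restrict (unitBall ι)).withDensity (fun z => ENNReal.ofReal (bergmanDensity ι lam z))

/-- `F` is a holomorphic function on the ball representing the `L²` class `f`. -/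
def IsHolRep (lam : ℝ) (f : Lp ℂ 2 (bergmanMeasure ι lam)) (F : (ι → ℂ) → ℂ) : Prop :=
  DifferentiableOn ℂ F (unitBall ι) ∧ f =ᵐ[bergmanMeasure ι lam] F

theorem IsHolRep.add {lam : ℝ} {f g : Lp ℂ 2 (bergmanMeasure ι lam)} {F G : (ι → ℂ) → ℂ}
    (hf : IsHolRep lam f F) (hg : IsHolRep lam g G) : IsHolRep lam (f + g) (F + G) :=
  ⟨hf.1.add hg.1, (Lp.coeFn_add f g).trans (hf.2.add hg.2)⟩

theorem IsHolRep.smul {lam : ℝ} {f : Lp ℂ 2 (bergmanMeasure ι lam)} {F : (ι → ℂ) → ℂ}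
    (c : ℂ) (hf : IsHolRep lam f F) : IsHolRep lam (c • f) (c • F) :=
  ⟨hf.1.const_smul c, (Lp.coeFn_smul c f).trans (hf.2.const_smul c)⟩

theorem IsHolRep.zero (lam : ℝ) :
    IsHolRep lam (0 : Lp ℂ 2 (bergmanMeasure ι lam)) (0 : (ι → ℂ) → ℂ) :=
  ⟨differentiableOn_const (0 : ℂ), Lp.coeFn_zero ℂ 2 (bergmanMeasure ι lam)⟩

/-- The weighted Bergman space `𝒜_λ`: the holomorphic elements of `L²(𝔹, dv_λ)`, with the norm and
inner product of `L²`. -/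
def bergman (ι : Type*) [Fintype ι] (lam : ℝ) : Submodule ℂ (Lp ℂ 2 (bergmanMeasure ι lam)) where
  carrier := {f | ∃ F, IsHolRep lam f F}
  add_mem' := by
    rintro f g ⟨F, hF⟩ ⟨G, hG⟩
    exact ⟨F + G, hF.add hG⟩
  zero_mem' := ⟨0, IsHolRep.zero lam⟩
  smul_mem' := by
    rintro c f ⟨F, hF⟩
    exact ⟨c • F, hF.smul c⟩

/-- The basis function `e_α(z) = (Γ(n+|α|+λ+1) / (α! Γ(n+λ+1)))^{1/2} z^α`. -/
def basisFun (lam : ℝ) (α : ι → ℕ) (z : ι → ℂ) : ℂ :=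
  (Real.sqrt (Real.Gamma (Fintype.card ι + ∑ i, (α i : ℝ) + lam + 1) /
    ((∏ i, ((α i).factorial : ℝ)) * Real.Gamma (Fintype.card ι + lam + 1))) : ℂ) *
    ∏ i, z i ^ α i

/-- The Fourier coefficient `f_α = ⟨f, e_α⟩ = ∫ f(z) \overline{e_α(z)} dv_λ(z)`. -/
def fourierCoefficient (lam : ℝ) (f : bergman ι lam) (α : ι → ℕ) : ℂ :=
  ∫ z, (f : Lp ℂ 2 (bergmanMeasure ι lam)) z * (starRingEnd ℂ) (basisFun lam α z)
    ∂(bergmanMeasure ι lam)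

end Bergman

/-! ### Rotation operators and the spaces `H_s` -/

section Partition

variable {m : ℕ} (k : Fin m → ℕ) (lam : ℝ)

/-- `|α_(j)|`, the degree of `α` in the `j`-th group of variables. -/
def groupDegree {k : Fin m → ℕ} (α : Coord k → ℕ) (j : Fin m) : ℕ := ∑ l, α ⟨j, l⟩

/-- `∑_l z_{j,l} ∂F/∂z_{j,l}`. -/
def eulerDeriv (j : Fin m) (F : (Coord k → ℂ) → ℂ) (z : Coord k → ℂ) : ℂ :=
  ∑ l : Fin (k j), z ⟨j, l⟩ * fderiv ℂ F z (Pi.single ⟨j, l⟩ 1)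

theorem measurableSet_unitBall (ι : Type*) [Fintype ι] : MeasurableSet (unitBall ι) :=
  (isOpen_lt (by fun_prop) continuous_const).measurableSet

theorem isOpen_unitBall (ι : Type*) [Fintype ι] : IsOpen (unitBall ι) :=
  isOpen_lt (by fun_prop) continuous_const

theorem ae_mem_unitBall (ι : Type*) [Fintype ι] (lam : ℝ) :
    ∀ᵐ z ∂(bergmanMeasure ι lam), z ∈ unitBall ι :=
  (withDensity_absolutelyContinuous _ _).ae_le (ae_restrict_mem (measurableSet_unitBall ι))

/-- The graph of the rotation operator `V_(j)` on its maximal domain: the pairs `(f, g)` of elements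
of the Bergman space with `g = ∑_l z_{j,l} ∂f/∂z_{j,l}` on the ball. -/
def rotationGraph (j : Fin m) : Submodule ℂ (bergman (Coord k) lam × bergman (Coord k) lam) where
  carrier := {p | ∃ F, IsHolRep lam p.1.1 F ∧ p.2.1 =ᵐ[bergmanMeasure (Coord k) lam] eulerDeriv k j F}
  add_mem' := by
    rintro p q ⟨F, hF, hF'⟩ ⟨G, hG, hG'⟩
    refine ⟨F + G, hF.add hG, ?_⟩
    refine (Lp.coeFn_add p.2.1 q.2.1).trans ?_
    filter_upwards [hF', hG', ae_mem_unitBall (Coord k) lam] with z h1 h2 hz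
    have hn := (isOpen_unitBall (Coord k)).mem_nhds hz
    rw [Pi.add_apply, h1, h2]
    simp only [eulerDeriv]
    rw [fderiv_add (hF.1.differentiableAt hn) (hG.1.differentiableAt hn), ← Finset.sum_add_distrib]
    simp [mul_add]
  zero_mem' := by
    refine ⟨0, IsHolRep.zero lam, ?_⟩
    refine (Lp.coeFn_zero ℂ 2 (bergmanMeasure (Coord k) lam)).trans ?_
    refine Filter.Eventually.of_forall fun z => ?_
    simp [eulerDeriv]
  smul_mem' := by
    rintro c p ⟨F, hF, hF'⟩
    refine ⟨c • F, hF.smul c, ?_⟩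
    refine (Lp.coeFn_smul c p.2.1).trans ?_
    filter_upwards [hF', ae_mem_unitBall (Coord k) lam] with z h1 hz
    have hn := (isOpen_unitBall (Coord k)).mem_nhds hz
    rw [Pi.smul_apply, h1]
    simp only [eulerDeriv]
    rw [fderiv_const_smul (hF.1.differentiableAt hn), Finset.smul_sum]
    refine Finset.sum_congr rfl fun l _ => ?_
    simp only [_root_.smul_apply, smul_eq_mul]
    ring

/-- Functions that are holomorphic on the ball and agree almost everywhere agree on the ball. -/
theorem eqOn_unitBall_of_ae_eq {ι : Type*} [Fintype ι] {lam : ℝ} (hlam : -1 < lam)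
    {F G : (ι → ℂ) → ℂ} (hF : DifferentiableOn ℂ F (unitBall ι))
    (hG : DifferentiableOn ℂ G (unitBall ι)) (h : F =ᵐ[bergmanMeasure ι lam] G) :
    Set.EqOn F G (unitBall ι) := by
  have hd : Measurable (fun z : ι → ℂ => ENNReal.ofReal (bergmanDensity ι lam z)) := by
    unfold bergmanDensity
    fun_prop
  have h1 : F =ᵐ[volume.restrict (unitBall ι)] G := by
    have h2 := (ae_withDensity_iff hd).1 h
    filter_upwards [h2, ae_restrict_mem (measurableSet_unitBall ι)] with z hz hzb
    apply hz
    have hpos : 0 < bergmanDensity ι lam z := by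
      have hz1 : 0 < 1 - ∑ i, ‖z i‖ ^ 2 := sub_pos.2 hzb
      have hg1 : 0 < Real.Gamma (lam + 1) := Real.Gamma_pos_of_pos (by linarith)
      have hc : (0 : ℝ) ≤ Fintype.card ι := Nat.cast_nonneg _
      have hg2 : 0 < Real.Gamma (Fintype.card ι + lam + 1) :=
        Real.Gamma_pos_of_pos (by linarith)
      unfold bergmanDensity
      have := Real.pi_pos
      positivity
    exact (ENNReal.ofReal_pos.2 hpos).ne'
  exact Measure.eqOn_open_of_ae_eq h1 (isOpen_unitBall ι) hF.continuousOn hG.continuousOn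

/-- For `λ > -1` the relation `rotationGraph` is the graph of an operator. -/
theorem rotationGraph_single_valued (hlam : -1 < lam) (j : Fin m) :
    ∀ p ∈ rotationGraph k lam j, p.1 = 0 → p.2 = 0 := by
  rintro ⟨f, g⟩ ⟨F, hF, hF'⟩ (rfl : f = 0)
  have h0 : F =ᵐ[bergmanMeasure (Coord k) lam] (0 : (Coord k → ℂ) → ℂ) :=
    hF.2.symm.trans (Lp.coeFn_zero ℂ 2 (bergmanMeasure (Coord k) lam))
  have hE := eqOn_unitBall_of_ae_eq hlam hF.1 (differentiableOn_const (0 : ℂ)) h0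
  apply Subtype.ext
  refine Lp.ext (hF'.trans ?_)
  refine Filter.EventuallyEq.trans ?_ (Lp.coeFn_zero ℂ 2 (bergmanMeasure (Coord k) lam)).symm
  filter_upwards [ae_mem_unitBall (Coord k) lam] with z hz
  have hn : F =ᶠ[nhds z] fun _ => (0 : ℂ) :=
    Filter.eventually_of_mem ((isOpen_unitBall (Coord k)).mem_nhds hz) hE
  simp [eulerDeriv, hn.fderiv_eq]

/-- The rotation operator `V_(j) = ∑_l z_{j,l} ∂/∂z_{j,l}` along the group of variables `z_(j)`, an
unbounded operator in the Bergman space. -/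
def rotationOp (j : Fin m) : bergman (Coord k) lam →ₗ.[ℂ] bergman (Coord k) lam :=
  (rotationGraph k lam j).toLinearPMap

/-- `H_s = span {e_α : |α_(j)| = s_j for all j}`. -/
def homogeneousPart (s : Fin m → ℕ) : Submodule ℂ (bergman (Coord k) lam) :=
  Submodule.span ℂ {e | ∃ α : Coord k → ℕ, (∀ j, groupDegree α j = s j) ∧
    e.1 =ᵐ[bergmanMeasure (Coord k) lam] basisFun lam α}

end Partition

/-! ### The action of the unitary group -/

section Unitary

variable {ι : Type*} [Fintype ι] [DecidableEq ι]

theorem unitary_norm_sq (U : Matrix.unitaryGroup ι ℂ) (z : ι → ℂ) :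
    ∑ i, ‖Matrix.mulVec (U : Matrix ι ι ℂ) z i‖ ^ 2 = ∑ i, ‖z i‖ ^ 2 := by
  have key : ∀ w : ι → ℂ, ((∑ i, ‖w i‖ ^ 2 : ℝ) : ℂ) = star w ⬝ᵥ w := by
    intro w
    simp only [dotProduct, Complex.ofReal_sum, Pi.star_apply]
    refine Finset.sum_congr rfl fun i _ => ?_
    rw [Complex.star_def, Complex.conj_mul']
    push_cast
    rfl
  have hU : star (U : Matrix ι ι ℂ) * (U : Matrix ι ι ℂ) = 1 := Matrix.mem_unitaryGroup_iff'.1 U.2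
  apply Complex.ofReal_injective
  rw [key, key, Matrix.star_mulVec, Matrix.dotProduct_mulVec, Matrix.vecMul_vecMul,
    ← Matrix.star_eq_conjTranspose, hU, Matrix.vecMul_one]

theorem unitary_mem_unitBall (U : Matrix.unitaryGroup ι ℂ) {z : ι → ℂ} :
    Matrix.mulVec (U : Matrix ι ι ℂ) z ∈ unitBall ι ↔ z ∈ unitBall ι := by
  simp only [unitBall, Set.mem_ofPred_eq, unitary_norm_sq]

theorem unitary_measurePreserving_volume (U : Matrix.unitaryGroup ι ℂ) :
    MeasurePreserving (Matrix.mulVec (U : Matrix ι ι ℂ)) volume volume := by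
  have hdet : ‖(U : Matrix ι ι ℂ).det‖ = 1 := by
    have h := Matrix.det_of_mem_unitary U.2
    exact CStarRing.norm_of_mem_unitary h
  set f : (ι → ℂ) →ₗ[ℝ] (ι → ℂ) := (Matrix.toLin' (U : Matrix ι ι ℂ)).restrictScalars ℝ with hf
  have hd : LinearMap.det f = 1 := by
    rw [hf, LinearMap.det_restrictScalars, LinearMap.det_toLin', Algebra.norm_complex_apply,
      Complex.normSq_eq_norm_sq, hdet, one_pow]
  have hmap := Measure.map_linearMap_addHaar_eq_smul_addHaar (volume : Measure (ι → ℂ))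
    (f := f) (by rw [hd]; exact one_ne_zero)
  rw [hd] at hmap
  refine ⟨?_, ?_⟩
  · exact (Continuous.matrix_mulVec continuous_const continuous_id).measurable
  · have hfun : (⇑f : (ι → ℂ) → ι → ℂ) = Matrix.mulVec (U : Matrix ι ι ℂ) := by
      funext z
      simp [hf]
    rw [hfun] at hmap
    simpa using hmap

theorem unitary_measurePreserving (lam : ℝ) (U : Matrix.unitaryGroup ι ℂ) :
    MeasurePreserving (Matrix.mulVec (U : Matrix ι ι ℂ)) (bergmanMeasure ι lam)
      (bergmanMeasure ι lam) := by
  have hv := unitary_measurePreserving_volume U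
  refine ⟨hv.measurable, ?_⟩
  ext s hs
  have hd : Measurable (fun z : ι → ℂ => ENNReal.ofReal (bergmanDensity ι lam z)) := by
    unfold bergmanDensity
    fun_prop
  have hb : Matrix.mulVec (U : Matrix ι ι ℂ) ⁻¹' (unitBall ι) = unitBall ι := by
    ext z
    exact unitary_mem_unitBall U
  rw [Measure.map_apply hv.measurable hs, bergmanMeasure,
    withDensity_apply _ (hv.measurable hs), withDensity_apply _ hs,
    Measure.restrict_restrict (hv.measurable hs), Measure.restrict_restrict hs,
    ← hv.setLIntegral_comp_preimage (hs.inter (measurableSet_unitBall ι)) hd, Set.preimage_inter, hb]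
  refine lintegral_congr fun z => ?_
  simp only [bergmanDensity, unitary_norm_sq]

/-- The operator `π_λ(U) f = f ∘ U⁻¹` on the Bergman space. -/
def bergmanRep (lam : ℝ) (U : Matrix.unitaryGroup ι ℂ) : bergman ι lam →L[ℂ] bergman ι lam :=
  ((Lp.compMeasurePreservingₗᵢ ℂ (Matrix.mulVec ((U⁻¹ : Matrix.unitaryGroup ι ℂ) : Matrix ι ι ℂ))
      (unitary_measurePreserving lam U⁻¹)).toContinuousLinearMap ∘L (bergman ι lam).subtypeL).codRestrict
    (bergman ι lam) (by
      rintro ⟨f, F, hF⟩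
      refine ⟨F ∘ Matrix.mulVec ((U⁻¹ : Matrix.unitaryGroup ι ℂ) : Matrix ι ι ℂ), ?_, ?_⟩
      · refine hF.1.comp ?_ (fun z hz => (unitary_mem_unitBall U⁻¹).2 hz)
        exact (Matrix.mulVecLin
          ((U⁻¹ : Matrix.unitaryGroup ι ℂ) : Matrix ι ι ℂ)).toContinuousLinearMap.differentiable.differentiableOn
      · exact (Lp.coeFn_compMeasurePreserving f (unitary_measurePreserving lam U⁻¹)).trans
          ((unitary_measurePreserving lam U⁻¹).quasiMeasurePreserving.ae_eq_comp hF.2))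

end Unitary

section Equivariant

variable {m : ℕ} (k : Fin m → ℕ)

/-- `𝐔(k) = 𝐔(k_1) × ⋯ × 𝐔(k_m)`, realized as the block diagonal subgroup of `𝐔(n)`. -/
def blockUnitaryGroup : Set (Matrix.unitaryGroup (Coord k) ℂ) :=
  {U | ∃ u : ∀ j, Matrix.unitaryGroup (Fin (k j)) ℂ,
    (U : Matrix (Coord k) (Coord k) ℂ) =
      Matrix.blockDiagonal' (fun j => (u j : Matrix (Fin (k j)) (Fin (k j)) ℂ))}

/-- `End_{𝐔(k)}(𝒜_λ)`: the bounded operators that commute with `π_λ(U)` for all `U ∈ 𝐔(k)`. -/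
def equivariantOps (lam : ℝ) : Set (bergman (Coord k) lam →L[ℂ] bergman (Coord k) lam) :=
  {T | ∀ U ∈ blockUnitaryGroup k, T ∘L bergmanRep lam U = bergmanRep lam U ∘L T}

end Equivariant

end

noncomputable section

/-! Every operator in play is diagonal in the monomial basis `e_α`. The monomials have norm one by a
Dirichlet integral over the ball, and coordinate rotations make different monomials orthogonal. They
are total because, for holomorphic `F`, the function `θ ↦ F(e^{2πiθ} z)` on the torus has Fourier
coefficients only at `α ≥ 0`, each of the form `C z^α` with `C` proportional to `f_α`
(`exists_torusCoeff_eq`, `eq_zero_of_fourierCoefficient_eq_zero`). The space is complete because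
values and derivatives at a point are bounded by the norm, locally uniformly in the point
(`isClosed_bergman`).

On its maximal domain, `V_(j)` multiplies `f_α` by `|α_(j)|`. In one direction `V_(j) F - aF`,
weighted by `e^{-iaθ}`, integrates to zero along the orbits of the rotations of block `j`
(`fourierCoefficient_of_eulerDeriv`). Conversely, norm convergence of monomial expansions forces
pointwise convergence of derivatives (`mem_rotationGraph_of_coefficients`). So a joint spectral
measure is obtained by placing `e_α` at the lattice point of its group degrees. It is the only one:
the scalar spectral measure of an eigenvector must live on the level set of its eigenvalue
(`scalarMeasure_ne_eq_zero_of_eigenvector`), which determines all projections on the basis.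

An equivariant operator commutes with the diagonal torus inside `𝐔(k)`, whose characters separate
multi-indices, so it is diagonal. Its eigenvalue depends only on the group degrees because a single
element of `𝐔(k)` sends `∏ z_{j,1}^{s_j}` to a combination in which every monomial of degrees `s`
occurs (`exists_blockUnitary_inner_ne_zero`). This explicit element replaces the irreducibility of
`H_s` and Schur's lemma. Conversely, block unitaries preserve group degrees, so every bounded
function of the degrees is equivariant. An equivariant `T` is therefore a scalar `c_s` on each
`H_s`, that scalar is the trace divided by the dimension, and any `ψ` with `ψ(s) = c_s` integrates
to `T` since the spectral measure is carried by the lattice. -/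

/-! ### Moments of the weighted measure on the ball -/

theorem lintegral_Ioo_rpow_mul_one_sub_rpow (a : ℕ) {c : ℝ} (hc : -1 < c) :
    ∫⁻ x in Set.Ioo (0 : ℝ) 1, ENNReal.ofReal (x ^ a * (1 - x) ^ c) =
      ENNReal.ofReal (ProbabilityTheory.beta (a + 1) (c + 1)) := by
  have ha : (0 : ℝ) < a + 1 := by positivity
  have hc1 : 0 < c + 1 := by linarith
  have hb := ProbabilityTheory.beta_pos ha hc1
  have h := ProbabilityTheory.lintegral_betaPDF_eq_one ha hc1
  rw [ProbabilityTheory.lintegral_betaPDF] at h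
  have h2 : ∫⁻ x in Set.Ioo (0 : ℝ) 1, ENNReal.ofReal (x ^ a * (1 - x) ^ c) =
      ENNReal.ofReal (ProbabilityTheory.beta (a + 1) (c + 1)) *
      ∫⁻ x in Set.Ioo (0 : ℝ) 1, ENNReal.ofReal
        (1 / ProbabilityTheory.beta (a + 1) (c + 1) * x ^ ((a + 1 : ℝ) - 1) *
          (1 - x) ^ (c + 1 - 1)) := by
    rw [← lintegral_const_mul' _ _ ENNReal.ofReal_ne_top]
    refine setLIntegral_congr_fun measurableSet_Ioo fun x _ => ?_
    rw [← ENNReal.ofReal_mul hb.le]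
    congr 1
    rw [add_sub_cancel_right, add_sub_cancel_right, Real.rpow_natCast]
    field_simp
  rw [h2, h, mul_one]

/-- The substitution `x = r² / R` turns the radial integral into a Beta integral. -/
theorem lintegral_Ioo_sqrt_rpow (a : ℕ) {c R : ℝ} (hc : -1 < c) (hR : 0 < R) :
    ∫⁻ r in Set.Ioo (0 : ℝ) (Real.sqrt R),
        ENNReal.ofReal (r * ((r ^ 2) ^ a * (R - r ^ 2) ^ c)) =
      ENNReal.ofReal (R ^ (a + c + 1) / 2 * ProbabilityTheory.beta (a + 1) (c + 1)) := by
  have himg : (fun r : ℝ => r ^ 2 / R) '' Set.Ioo 0 (Real.sqrt R) = Set.Ioo 0 1 := by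
    ext x
    constructor
    · rintro ⟨r, ⟨h1, h2⟩, rfl⟩
      refine ⟨by positivity, ?_⟩
      simp only
      rw [div_lt_one hR]
      exact (Real.lt_sqrt h1.le).1 h2
    · rintro ⟨h1, h2⟩
      refine ⟨Real.sqrt (R * x), ⟨by positivity, ?_⟩, ?_⟩
      · apply Real.sqrt_lt_sqrt (by positivity)
        nlinarith
      · simp only
        rw [Real.sq_sqrt (by positivity)]
        field_simp
  have hinj : Set.InjOn (fun r : ℝ => r ^ 2 / R) (Set.Ioo 0 (Real.sqrt R)) := by
    intro r hr s hs h
    have h' : r ^ 2 = s ^ 2 := by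
      simp only at h
      field_simp at h
      exact h
    exact (sq_eq_sq₀ hr.1.le hs.1.le).1 h'
  have hder : ∀ r ∈ Set.Ioo 0 (Real.sqrt R),
      HasDerivWithinAt (fun r : ℝ => r ^ 2 / R) (2 * r / R) (Set.Ioo 0 (Real.sqrt R)) r := by
    intro r _
    have := ((hasDerivAt_pow 2 r).div_const R).hasDerivWithinAt (s := Set.Ioo 0 (Real.sqrt R))
    simpa using this
  have hcv := lintegral_image_eq_lintegral_abs_deriv_mul measurableSet_Ioo hder hinj
    (fun x => ENNReal.ofReal (x ^ a * (1 - x) ^ c))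
  rw [himg, lintegral_Ioo_rpow_mul_one_sub_rpow a hc] at hcv
  rw [ENNReal.ofReal_mul (by positivity), hcv, ← lintegral_const_mul' _ _ ENNReal.ofReal_ne_top]
  refine setLIntegral_congr_fun measurableSet_Ioo fun r hr => ?_
  have hr0 : 0 < r := hr.1
  have hr2 : r ^ 2 < R := (Real.lt_sqrt hr0.le).1 hr.2
  rw [← ENNReal.ofReal_mul (by positivity), ← ENNReal.ofReal_mul (by positivity),
    abs_of_pos (by positivity)]
  congr 1
  have e1 : 1 - r ^ 2 / R = (R - r ^ 2) / R := by field_simp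
  have e2 : R ^ (a + c + 1) = R ^ a * R ^ c * R := by
    rw [Real.rpow_add hR, Real.rpow_add hR, Real.rpow_natCast, Real.rpow_one]
  have := Real.rpow_pos_of_pos hR c
  rw [e1, Real.div_rpow (by linarith) hR.le, e2, div_pow]
  field_simp

theorem lintegral_disc_rpow (a : ℕ) {c R : ℝ} (hc : -1 < c) (hR : 0 < R) :
    ∫⁻ w in {w : ℂ | ‖w‖ ^ 2 < R}, ENNReal.ofReal ((‖w‖ ^ 2) ^ a * (R - ‖w‖ ^ 2) ^ c) =
      ENNReal.ofReal (Real.pi * R ^ (a + c + 1) * ProbabilityTheory.beta (a + 1) (c + 1)) := by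
  have hms : MeasurableSet {w : ℂ | ‖w‖ ^ 2 < R} := measurableSet_lt (by fun_prop) (by fun_prop)
  rw [← lintegral_indicator hms, ← Complex.lintegral_comp_polarCoord_symm]
  have htarget : polarCoord.target = Set.Ioi (0 : ℝ) ×ˢ Set.Ioo (-Real.pi) Real.pi := rfl
  rw [htarget]
  have hcongr : ∀ p ∈ Set.Ioi (0 : ℝ) ×ˢ Set.Ioo (-Real.pi) Real.pi,
      ENNReal.ofReal p.1 • Set.indicator {w : ℂ | ‖w‖ ^ 2 < R}
        (fun w : ℂ => ENNReal.ofReal ((‖w‖ ^ 2) ^ a * (R - ‖w‖ ^ 2) ^ c))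
          (Complex.polarCoord.symm p) =
      (Set.Ioo 0 (Real.sqrt R)).indicator
        (fun r => ENNReal.ofReal (r * ((r ^ 2) ^ a * (R - r ^ 2) ^ c))) p.1 * 1 := by
    rintro ⟨r, t⟩ ⟨hr, -⟩
    have hr : 0 < r := hr
    have hn : ‖Complex.polarCoord.symm (r, t)‖ = r := by
      rw [Complex.norm_polarCoord_symm]; exact abs_of_pos hr
    by_cases h : r ^ 2 < R
    · rw [Set.indicator_of_mem (by simpa [hn] using h),
        Set.indicator_of_mem (show r ∈ Set.Ioo 0 (Real.sqrt R) from ⟨hr, (Real.lt_sqrt hr.le).2 h⟩),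
        hn, smul_eq_mul, ← ENNReal.ofReal_mul hr.le, mul_one]
    · rw [Set.indicator_of_notMem (by simpa [hn] using h),
        Set.indicator_of_notMem (fun h' => h ((Real.lt_sqrt hr.le).1 h'.2))]
      simp
  rw [setLIntegral_congr_fun (measurableSet_Ioi.prod measurableSet_Ioo) hcongr,
    Measure.volume_eq_prod, ← Measure.prod_restrict, lintegral_prod_mul (f := (Set.Ioo 0 (Real.sqrt R)).indicator
      (fun r => ENNReal.ofReal (r * ((r ^ 2) ^ a * (R - r ^ 2) ^ c)))) (g := fun _ : ℝ => 1) (by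
      refine (Measurable.indicator ?_ measurableSet_Ioo).aemeasurable
      fun_prop) (by fun_prop)]
  rw [lintegral_one, Measure.restrict_apply_univ, Real.volume_Ioo,
    setLIntegral_indicator measurableSet_Ioo,
    Set.inter_eq_left.2 (fun x hx => hx.1), lintegral_Ioo_sqrt_rpow a hc hR,
    ← ENNReal.ofReal_mul]
  · congr 1; ring
  · have := ProbabilityTheory.beta_pos (α := a + 1) (β := c + 1) (by positivity) (by linarith)
    positivity

/-- Induction on the dimension by integrating out the first coordinate. Over a fixed `z` the fibre
is a disc with squared radius `R = 1 - |z|²`, and it contributes a constant times `R ^ (a + c + 1)`.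
The weight exponent thus changes from `c` to `a + c + 1`, which is why `c` is quantified inside the
induction. The factor `Γ(a + c + 2)` in the denominator of the Beta function cancels against the
numerator of the induction hypothesis. -/
theorem lintegral_unitBall_fin (n : ℕ) : ∀ (α : Fin n → ℕ) {c : ℝ}, -1 < c →
    ∫⁻ z in unitBall (Fin n),
        ENNReal.ofReal ((∏ i, (‖z i‖ ^ 2) ^ α i) * (1 - ∑ i, ‖z i‖ ^ 2) ^ c) =
      ENNReal.ofReal (Real.pi ^ n * (∏ i, ((α i).factorial : ℝ)) * Real.Gamma (c + 1) /
        Real.Gamma (n + ∑ i, (α i : ℝ) + c + 1)) := by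
  induction n with
  | zero =>
    intro α c hc
    have h1 : unitBall (Fin 0) = Set.univ := by ext z; simp [unitBall]
    have h2 : 0 < Real.Gamma (c + 1) := Real.Gamma_pos_of_pos (by linarith)
    have hv : (volume : Measure (Fin 0 → ℂ)) Set.univ = 1 := by
      rw [volume_pi]; simp
    simp [h1, hv, h2.ne']
  | succ n ih =>
    intro α c hc
    set a := α 0 with ha
    set α' : Fin n → ℕ := fun i => α i.succ with hα'
    have hac : -1 < (a : ℝ) + c + 1 := by
      have : (0 : ℝ) ≤ a := Nat.cast_nonneg _
      linarith
    have hms := measurableSet_unitBall (Fin (n + 1))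
    have hG : Measurable (fun z : Fin (n + 1) → ℂ => (unitBall (Fin (n + 1))).indicator (fun z =>
        ENNReal.ofReal ((∏ i, (‖z i‖ ^ 2) ^ α i) * (1 - ∑ i, ‖z i‖ ^ 2) ^ c)) z) := by
      refine Measurable.indicator ?_ hms
      fun_prop
    have hmp := (volume_preserving_piFinSuccAbove (fun _ : Fin (n + 1) => ℂ) 0).symm
    rw [← lintegral_indicator hms, ← hmp.lintegral_comp hG, Measure.volume_eq_prod]
    refine (lintegral_prod_symm _ (hG.comp hmp.measurable).aemeasurable).trans ?_
    have hinner : ∀ z : Fin n → ℂ,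
        (∫⁻ w : ℂ, (unitBall (Fin (n + 1))).indicator (fun z =>
          ENNReal.ofReal ((∏ i, (‖z i‖ ^ 2) ^ α i) * (1 - ∑ i, ‖z i‖ ^ 2) ^ c))
          ((MeasurableEquiv.piFinSuccAbove (fun _ : Fin (n + 1) => ℂ) 0).symm (w, z))) =
        (unitBall (Fin n)).indicator (fun z => ENNReal.ofReal (Real.pi *
            ProbabilityTheory.beta (a + 1) (c + 1)) * ENNReal.ofReal ((∏ i, (‖z i‖ ^ 2) ^ α' i) *
            (1 - ∑ i, ‖z i‖ ^ 2) ^ ((a : ℝ) + c + 1))) z := by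
      intro z
      have hsym : ∀ w, (MeasurableEquiv.piFinSuccAbove (fun _ : Fin (n + 1) => ℂ) 0).symm (w, z) =
          (Fin.cons w z : Fin (n + 1) → ℂ) := by
        intro w; simp [MeasurableEquiv.piFinSuccAbove, Fin.consEquiv]
      have hmem : ∀ w, (Fin.cons w z : Fin (n + 1) → ℂ) ∈ unitBall (Fin (n + 1)) ↔
          ‖w‖ ^ 2 < 1 - ∑ i, ‖z i‖ ^ 2 := by
        intro w
        simp only [unitBall, Set.mem_ofPred_eq, Fin.sum_univ_succ, Fin.cons_zero, Fin.cons_succ]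
        constructor <;> intro h <;> linarith
      have hmsd : MeasurableSet {w : ℂ | ‖w‖ ^ 2 < 1 - ∑ i, ‖z i‖ ^ 2} :=
        measurableSet_lt (by fun_prop) (by fun_prop)
      have hrew : ∀ w : ℂ, (unitBall (Fin (n + 1))).indicator (fun z =>
          ENNReal.ofReal ((∏ i, (‖z i‖ ^ 2) ^ α i) * (1 - ∑ i, ‖z i‖ ^ 2) ^ c))
          ((MeasurableEquiv.piFinSuccAbove (fun _ : Fin (n + 1) => ℂ) 0).symm (w, z)) =
          Set.indicator {w : ℂ | ‖w‖ ^ 2 < 1 - ∑ i, ‖z i‖ ^ 2} (fun w =>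
            ENNReal.ofReal (∏ i, (‖z i‖ ^ 2) ^ α' i) * ENNReal.ofReal ((‖w‖ ^ 2) ^ a *
              ((1 - ∑ i, ‖z i‖ ^ 2) - ‖w‖ ^ 2) ^ c)) w := by
        intro w
        rw [hsym]
        by_cases h : ‖w‖ ^ 2 < 1 - ∑ i, ‖z i‖ ^ 2
        · rw [Set.indicator_of_mem ((hmem w).2 h), Set.indicator_of_mem (by exact h),
            ← ENNReal.ofReal_mul (by positivity)]
          congr 1
          simp only [Fin.prod_univ_succ, Fin.sum_univ_succ, Fin.cons_zero, Fin.cons_succ, ha, hα']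
          rw [show 1 - (‖w‖ ^ 2 + ∑ i, ‖z i‖ ^ 2) = 1 - ∑ i, ‖z i‖ ^ 2 - ‖w‖ ^ 2 by ring]
          ring
        · rw [Set.indicator_of_notMem (fun h' => h ((hmem w).1 h')),
            Set.indicator_of_notMem (by exact h)]
      rw [lintegral_congr hrew, lintegral_indicator hmsd,
        lintegral_const_mul' _ _ ENNReal.ofReal_ne_top]
      by_cases hz : z ∈ unitBall (Fin n)
      · have hR : 0 < 1 - ∑ i, ‖z i‖ ^ 2 := sub_pos.2 hz
        rw [lintegral_disc_rpow a hc hR, Set.indicator_of_mem hz, ← ENNReal.ofReal_mul (by positivity),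
          ← ENNReal.ofReal_mul]
        · congr 1; ring
        · have := ProbabilityTheory.beta_pos (α := a + 1) (β := c + 1) (by positivity) (by linarith)
          positivity
      · have hR : 1 - ∑ i, ‖z i‖ ^ 2 ≤ 0 := by
          simpa [unitBall] using hz
        have hemp : {w : ℂ | ‖w‖ ^ 2 < 1 - ∑ i, ‖z i‖ ^ 2} = ∅ := by
          ext w
          simp only [Set.mem_ofPred_eq, Set.mem_empty_iff_false, iff_false, not_lt]
          exact hR.trans (by positivity)
        rw [hemp, Set.indicator_of_notMem hz]
        simp
    simp only [Function.comp_apply] at hinner ⊢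
    rw [lintegral_congr hinner, lintegral_indicator (measurableSet_unitBall _),
      lintegral_const_mul' _ _ ENNReal.ofReal_ne_top, ih α' hac, ← ENNReal.ofReal_mul]
    · congr 1
      have h1 : Real.Gamma ((a : ℝ) + 1) = a.factorial := Real.Gamma_nat_eq_factorial a
      have h2 : 0 < Real.Gamma ((a : ℝ) + 1 + (c + 1)) := Real.Gamma_pos_of_pos (by
        have : (0 : ℝ) ≤ a := Nat.cast_nonneg _
        linarith)
      rw [ProbabilityTheory.beta, h1, Fin.prod_univ_succ, Fin.sum_univ_succ,
        show (a : ℝ) + c + 1 + 1 = (a : ℝ) + 1 + (c + 1) by ring,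
        show (n : ℝ) + ∑ i, (α' i : ℝ) + ((a : ℝ) + c + 1) + 1 =
          ((n + 1 : ℕ) : ℝ) + ((α 0 : ℝ) + ∑ i : Fin n, (α i.succ : ℝ)) + c + 1 by
            push_cast [ha, hα']; ring]
      field_simp
      simp only [ha, hα']
      ring
    · have := ProbabilityTheory.beta_pos (α := a + 1) (β := c + 1) (by positivity) (by linarith)
      positivity

theorem lintegral_unitBall {ι : Type*} [Fintype ι] (α : ι → ℕ) {c : ℝ} (hc : -1 < c) :
    ∫⁻ z in unitBall ι,
        ENNReal.ofReal ((∏ i, (‖z i‖ ^ 2) ^ α i) * (1 - ∑ i, ‖z i‖ ^ 2) ^ c) =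
      ENNReal.ofReal (Real.pi ^ Fintype.card ι * (∏ i, ((α i).factorial : ℝ)) *
        Real.Gamma (c + 1) / Real.Gamma (Fintype.card ι + ∑ i, (α i : ℝ) + c + 1)) := by
  let e := Fintype.equivFin ι
  have hmp := volume_measurePreserving_piCongrLeft (fun _ : ι => ℂ) e.symm
  have happ : ∀ (z : Fin (Fintype.card ι) → ℂ) (i : ι),
      MeasurableEquiv.piCongrLeft (fun _ : ι => ℂ) e.symm z i = z (e i) := by
    intro z i
    obtain ⟨j, rfl⟩ := e.symm.surjective i
    rw [MeasurableEquiv.coe_piCongrLeft, Equiv.piCongrLeft_apply_apply, Equiv.apply_symm_apply]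
  have hG : Measurable (fun z : ι → ℂ =>
      ENNReal.ofReal ((∏ i, (‖z i‖ ^ 2) ^ α i) * (1 - ∑ i, ‖z i‖ ^ 2) ^ c)) := by fun_prop
  rw [← hmp.setLIntegral_comp_preimage (measurableSet_unitBall ι) hG]
  have hpre : MeasurableEquiv.piCongrLeft (fun _ : ι => ℂ) e.symm ⁻¹' unitBall ι =
      unitBall (Fin (Fintype.card ι)) := by
    ext z
    simp only [unitBall, Set.mem_preimage, Set.mem_ofPred_eq, happ]
    rw [e.sum_comp (fun j => ‖z j‖ ^ 2)]
  have h := lintegral_unitBall_fin (Fintype.card ι) (fun j => α (e.symm j)) hc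
  rw [e.symm.prod_comp (fun i => ((α i).factorial : ℝ)), e.symm.sum_comp (fun i => (α i : ℝ))] at h
  rw [hpre, ← h]
  refine lintegral_congr fun z => ?_
  simp only [happ]
  rw [e.sum_comp (fun j => ‖z j‖ ^ 2), ← e.prod_comp (fun j => (‖z j‖ ^ 2) ^ α (e.symm j))]
  simp

variable {ι : Type*} [Fintype ι]

theorem measurable_bergmanDensity (lam : ℝ) :
    Measurable (fun z : ι → ℂ => ENNReal.ofReal (bergmanDensity ι lam z)) := by
  unfold bergmanDensity
  fun_prop

theorem lintegral_bergmanMeasure_basisFun {lam : ℝ} (hlam : -1 < lam) (α : ι → ℕ) :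
    ∫⁻ z, ENNReal.ofReal (‖basisFun lam α z‖ ^ 2) ∂(bergmanMeasure ι lam) = 1 := by
  have hN : (0 : ℝ) ≤ Fintype.card ι := Nat.cast_nonneg _
  have hA : (0 : ℝ) ≤ ∑ i, (α i : ℝ) := by positivity
  have hg1 : 0 < Real.Gamma (lam + 1) := Real.Gamma_pos_of_pos (by linarith)
  have hg2 : 0 < Real.Gamma (Fintype.card ι + lam + 1) := Real.Gamma_pos_of_pos (by linarith)
  have hg3 : 0 < Real.Gamma (Fintype.card ι + ∑ i, (α i : ℝ) + lam + 1) :=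
    Real.Gamma_pos_of_pos (by linarith)
  have hfac : 0 < ∏ i, ((α i).factorial : ℝ) :=
    Finset.prod_pos fun i _ => by exact_mod_cast Nat.factorial_pos _
  have hm : Measurable (fun z : ι → ℂ => ENNReal.ofReal (‖basisFun lam α z‖ ^ 2)) := by
    unfold basisFun
    fun_prop
  rw [bergmanMeasure, lintegral_withDensity_eq_lintegral_mul _ (measurable_bergmanDensity lam) hm]
  have hpi := Real.pi_pos
  set C : ℝ := Real.Gamma (Fintype.card ι + ∑ i, (α i : ℝ) + lam + 1) /
    ((∏ i, ((α i).factorial : ℝ)) * Real.Gamma (Fintype.card ι + lam + 1)) with hC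
  set D : ℝ := Real.Gamma (Fintype.card ι + lam + 1) /
    (Real.pi ^ Fintype.card ι * Real.Gamma (lam + 1)) with hD
  have hC0 : 0 < C := by positivity
  have hD0 : 0 < D := by positivity
  have hcongr : ∀ z ∈ unitBall ι, ((fun z : ι → ℂ => ENNReal.ofReal (bergmanDensity ι lam z)) *
      fun z => ENNReal.ofReal (‖basisFun lam α z‖ ^ 2)) z = ENNReal.ofReal (C * D) *
        ENNReal.ofReal ((∏ i, (‖z i‖ ^ 2) ^ α i) * (1 - ∑ i, ‖z i‖ ^ 2) ^ lam) := by
    intro z hz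
    have hz1 : 0 < 1 - ∑ i, ‖z i‖ ^ 2 := sub_pos.2 hz
    rw [Pi.mul_apply, bergmanDensity, ← hD, ← ENNReal.ofReal_mul (by positivity),
      ← ENNReal.ofReal_mul (by positivity)]
    congr 1
    rw [basisFun, norm_mul, mul_pow, ← hC, Complex.norm_real, Real.norm_eq_abs, sq_abs,
      Real.sq_sqrt hC0.le, norm_prod, ← Finset.prod_pow]
    simp only [norm_pow, ← pow_mul, mul_comm 2]
    ring
  rw [setLIntegral_congr_fun (measurableSet_unitBall ι) hcongr,
    lintegral_const_mul' _ _ ENNReal.ofReal_ne_top, lintegral_unitBall α hlam,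
    ← ENNReal.ofReal_mul (by positivity), ← ENNReal.ofReal_one]
  congr 1
  rw [hC, hD]
  field_simp

theorem isProbabilityMeasure_bergmanMeasure {lam : ℝ} (hlam : -1 < lam) :
    IsProbabilityMeasure (bergmanMeasure ι lam) := by
  constructor
  -- For `α = 0` the basis function is the constant `1`, so its norm is the total mass.
  have h := lintegral_bergmanMeasure_basisFun (ι := ι) hlam 0
  have hg2 : 0 < Real.Gamma (Fintype.card ι + lam + 1) := Real.Gamma_pos_of_pos (by
    have : (0 : ℝ) ≤ Fintype.card ι := Nat.cast_nonneg _
    linarith)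
  simpa [basisFun, hg2.ne'] using h

/-! ### Averaging over measure preserving families -/

section Averaging

variable {X Θ : Type*} [MeasurableSpace X] [MeasurableSpace Θ]

/-- The skew product `(θ, x) ↦ (θ, R_θ x)` preserves the product measure, so integrability is
inherited from `(θ, x) ↦ G x`. -/
theorem integrable_comp_family (μ : Measure X) [SFinite μ] (ν : Measure Θ) [IsFiniteMeasure ν]
    {R : Θ → X → X} (hR : Measurable (Function.uncurry R))
    (hmp : ∀ θ, MeasurePreserving (R θ) μ μ) {G : X → ℂ} (hG : Integrable G μ) :
    Integrable (fun p : Θ × X => G (R p.1 p.2)) (ν.prod μ) := by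
  have h1 : Integrable (fun p : Θ × X => G p.2) (ν.prod μ) := hG.comp_snd ν
  have h2 : MeasurePreserving (fun p : Θ × X => (id p.1, R p.1 p.2)) (ν.prod μ) (ν.prod μ) :=
    (MeasurePreserving.id ν).skew_product hR (Filter.Eventually.of_forall fun θ => (hmp θ).map_eq)
  exact h2.integrable_comp_of_integrable h1

/-- Averaging an integrable function over a family of measure preserving maps does not change its
integral. -/
theorem integral_average (μ : Measure X) [SFinite μ] (ν : Measure Θ) [IsFiniteMeasure ν]
    {R : Θ → X → X} (hR : Measurable (Function.uncurry R))
    (hmp : ∀ θ, MeasurePreserving (R θ) μ μ) {G : X → ℂ} (hG : Integrable G μ) :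
    ∫ x, ∫ θ, G (R θ x) ∂ν ∂μ = ν.real Set.univ • ∫ x, G x ∂μ := by
  rw [← integral_integral_swap (integrable_comp_family μ ν hR hmp hG)]
  have h : ∀ θ, ∫ x, G (R θ x) ∂μ = ∫ x, G x ∂μ := by
    intro θ
    have h1 : AEStronglyMeasurable G (μ.map (R θ)) := by
      rw [(hmp θ).map_eq]; exact hG.1
    rw [← integral_map (hmp θ).measurable.aemeasurable h1, (hmp θ).map_eq]
  simp only [h, integral_const]

end Averaging

/-! ### Coordinate rotations and diagonal unitaries -/

section Rotation

variable {ι : Type*} [Fintype ι]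

/-- The coordinatewise rotation of `ℂ^ι` by a family of unimodular numbers. -/
def rot (u : ι → Circle) (z : ι → ℂ) : ι → ℂ := fun i => (u i : ℂ) * z i

/-- The diagonal unitary matrix with given unimodular entries. -/
def diagUnitary [DecidableEq ι] (u : ι → Circle) : Matrix.unitaryGroup ι ℂ :=
  ⟨Matrix.diagonal fun i => (u i : ℂ), by
    rw [Matrix.mem_unitaryGroup_iff, Matrix.star_eq_conjTranspose, Matrix.diagonal_conjTranspose,
      Matrix.diagonal_mul_diagonal, ← Matrix.diagonal_one]
    congr 1
    funext i
    simp [Complex.mul_conj, Complex.normSq_eq_norm_sq, Circle.norm_coe]⟩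

theorem mulVec_diagUnitary [DecidableEq ι] (u : ι → Circle) :
    Matrix.mulVec (diagUnitary u : Matrix ι ι ℂ) = rot u := by
  funext z i
  simp [diagUnitary, rot, Matrix.mulVec_diagonal]

theorem diagUnitary_inv [DecidableEq ι] (u : ι → Circle) :
    (diagUnitary u)⁻¹ = diagUnitary u⁻¹ := by
  rw [inv_eq_iff_mul_eq_one]
  apply Subtype.ext
  rw [Matrix.UnitaryGroup.mul_val]
  simp [diagUnitary, Matrix.diagonal_mul_diagonal]

theorem measurePreserving_rot (lam : ℝ) (u : ι → Circle) :
    MeasurePreserving (rot u) (bergmanMeasure ι lam) (bergmanMeasure ι lam) := by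
  classical
  rw [← mulVec_diagUnitary]
  exact unitary_measurePreserving lam (diagUnitary u)

theorem measurePreserving_rot_volume (u : ι → Circle) :
    MeasurePreserving (rot u) (volume : Measure (ι → ℂ)) volume := by
  classical
  rw [← mulVec_diagUnitary]
  exact unitary_measurePreserving_volume (diagUnitary u)

omit [Fintype ι] in
theorem continuous_uncurry_rot {Θ : Type*} [TopologicalSpace Θ] {c : Θ → ι → Circle}
    (hc : Continuous c) : Continuous (Function.uncurry fun θ => rot (c θ)) := by
  refine continuous_pi fun i => ?_
  have h1 : Continuous fun p : Θ × (ι → ℂ) => (c p.1 i : ℂ) :=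
    Continuous.comp (by fun_prop : Continuous fun w : Circle => (w : ℂ)) (((continuous_apply i).comp hc).comp continuous_fst)
  exact h1.mul ((continuous_apply i).comp continuous_snd)

theorem rot_mem_unitBall (u : ι → Circle) {z : ι → ℂ} : rot u z ∈ unitBall ι ↔ z ∈ unitBall ι := by
  simp [unitBall, rot, Circle.norm_coe]

theorem basisFun_rot (lam : ℝ) (α : ι → ℕ) (u : ι → Circle) (z : ι → ℂ) :
    basisFun lam α (rot u z) = ((∏ i, u i ^ α i : Circle) : ℂ) * basisFun lam α z := by
  simp only [basisFun, rot, mul_pow, Finset.prod_mul_distrib]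
  have : ((∏ i, u i ^ α i : Circle) : ℂ) = ∏ i, (u i : ℂ) ^ α i := by
    change Circle.coeHom _ = _
    rw [map_prod]
    refine Finset.prod_congr rfl fun i _ => ?_
    rw [map_pow]
    rfl
  rw [this]
  ring

theorem exists_circle_pow_ne {a b : ℕ} (h : a ≠ b) : ∃ w : Circle, w ^ a ≠ w ^ b := by
  wlog hab : a < b generalizing a b
  · obtain ⟨w, hw⟩ := this h.symm (lt_of_le_of_ne (not_lt.1 hab) h.symm)
    exact ⟨w, hw.symm⟩
  obtain ⟨d, rfl⟩ := Nat.exists_eq_add_of_lt hab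
  -- Here `b = a + d + 1`, and this `w` satisfies `w ^ (d + 1) = exp(iπ) = -1 ≠ 1`.
  refine ⟨Circle.exp (Real.pi / (d + 1 : ℕ)), fun hw => ?_⟩
  rw [add_assoc, pow_add, left_eq_mul, ← Circle.exp_nsmul, nsmul_eq_mul,
    mul_div_cancel₀ _ (by positivity)] at hw
  have := congrArg (fun c : Circle => (c : ℂ)) hw
  simp [Circle.coe_exp] at this
  norm_num at this

end Rotation

/-! ### Orthonormality of the monomials -/

section Basis

variable {ι : Type*} [Fintype ι]

theorem continuous_basisFun (lam : ℝ) (α : ι → ℕ) : Continuous (basisFun lam α) := by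
  unfold basisFun
  fun_prop

theorem differentiable_basisFun (lam : ℝ) (α : ι → ℕ) : Differentiable ℂ (basisFun lam α) := by
  unfold basisFun
  fun_prop

variable {lam : ℝ}

theorem eLpNorm_basisFun (hlam : -1 < lam) (α : ι → ℕ) :
    eLpNorm (basisFun lam α) 2 (bergmanMeasure ι lam) = 1 := by
  have h := lintegral_bergmanMeasure_basisFun hlam α
  rw [eLpNorm_eq_lintegral_rpow_enorm_toReal (by norm_num) (by norm_num)]
  have h2 : ∀ z, ‖basisFun lam α z‖ₑ ^ (ENNReal.toReal 2) =
      ENNReal.ofReal (‖basisFun lam α z‖ ^ 2) := by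
    intro z
    rw [ENNReal.ofReal_pow (norm_nonneg _), ofReal_norm]
    norm_num
  simp only [h2, h]
  simp

theorem memLp_basisFun (hlam : -1 < lam) (α : ι → ℕ) :
    MemLp (basisFun lam α) 2 (bergmanMeasure ι lam) :=
  ⟨(continuous_basisFun lam α).aestronglyMeasurable, by rw [eLpNorm_basisFun hlam]; simp⟩

/-- The basis function `e_α` as an element of the Bergman space. -/
def basisVec (hlam : -1 < lam) (α : ι → ℕ) : bergman ι lam :=
  ⟨(memLp_basisFun hlam α).toLp, basisFun lam α, (differentiable_basisFun lam α).differentiableOn,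
    (memLp_basisFun hlam α).coeFn_toLp⟩

theorem coeFn_basisVec (hlam : -1 < lam) (α : ι → ℕ) :
    (basisVec hlam α).1 =ᵐ[bergmanMeasure ι lam] basisFun lam α :=
  (memLp_basisFun hlam α).coeFn_toLp

theorem isHolRep_basisVec (hlam : -1 < lam) (α : ι → ℕ) :
    IsHolRep lam (basisVec hlam α).1 (basisFun lam α) :=
  ⟨(differentiable_basisFun lam α).differentiableOn, coeFn_basisVec hlam α⟩

theorem inner_basisVec (hlam : -1 < lam) (α : ι → ℕ) (f : bergman ι lam) :
    ⟪basisVec hlam α, f⟫_ℂ = fourierCoefficient lam f α := by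
  rw [Submodule.coe_inner, L2.inner_def, fourierCoefficient]
  refine integral_congr_ae ?_
  filter_upwards [coeFn_basisVec hlam α] with z hz
  rw [hz, RCLike.inner_apply]

theorem integrable_mul_conj_basisFun (hlam : -1 < lam) (α : ι → ℕ)
    (f : Lp ℂ 2 (bergmanMeasure ι lam)) :
    Integrable (fun z => f z * (starRingEnd ℂ) (basisFun lam α z)) (bergmanMeasure ι lam) := by
  have h := L2.integrable_inner (𝕜 := ℂ) (basisVec hlam α).1 f
  refine h.congr ?_
  filter_upwards [coeFn_basisVec hlam α] with z hz
  rw [hz, RCLike.inner_apply]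

/-- Orthogonality comes from symmetry alone: rotate one coordinate in which the exponents differ.
The integral of `e_β` times the conjugate of `e_α` is unchanged, yet it is multiplied by `w ^ β i *
(w ^ α i)⁻¹ ≠ 1`. -/
theorem orthonormal_basisVec (hlam : -1 < lam) :
    Orthonormal ℂ (basisVec hlam : (ι → ℕ) → bergman ι lam) := by
  classical
  constructor
  · intro α
    rw [Submodule.coe_norm, basisVec, Lp.norm_toLp, eLpNorm_basisFun hlam]
    simp
  · intro α β hαβ
    rw [inner_basisVec, fourierCoefficient]
    have h1 : ∫ z, (basisVec hlam β).1 z * (starRingEnd ℂ) (basisFun lam α z)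
        ∂(bergmanMeasure ι lam) = ∫ z, basisFun lam β z * (starRingEnd ℂ) (basisFun lam α z)
        ∂(bergmanMeasure ι lam) := by
      refine integral_congr_ae ?_
      filter_upwards [coeFn_basisVec hlam β] with z hz
      rw [hz]
    rw [h1]
    obtain ⟨i, hi⟩ := Function.ne_iff.1 hαβ
    obtain ⟨w, hw⟩ := exists_circle_pow_ne hi
    set u : ι → Circle := Pi.mulSingle i w with hu
    have hprod : ∀ γ : ι → ℕ, ∏ j, u j ^ γ j = w ^ γ i := by
      intro γ
      rw [Finset.prod_eq_single i]
      · simp [hu]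
      · intro j _ hj
        simp [hu, Pi.mulSingle_eq_of_ne hj]
      · simp
    set G : (ι → ℂ) → ℂ := fun z => basisFun lam β z * (starRingEnd ℂ) (basisFun lam α z) with hG
    have hcont : Continuous G :=
      (continuous_basisFun lam β).mul (Complex.continuous_conj.comp (continuous_basisFun lam α))
    have hmp := measurePreserving_rot lam u
    have h2 : ∫ z, G (rot u z) ∂(bergmanMeasure ι lam) = ∫ z, G z ∂(bergmanMeasure ι lam) := by
      rw [← integral_map hmp.measurable.aemeasurable hcont.aestronglyMeasurable, hmp.map_eq]
    have h3 : ∀ z, G (rot u z) = ((w ^ β i * (w ^ α i)⁻¹ : Circle) : ℂ) * G z := by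
      intro z
      simp only [hG, basisFun_rot, hprod, map_mul]
      rw [Circle.coe_mul, Circle.coe_inv_eq_conj]
      ring
    simp only [h3] at h2
    rw [integral_const_mul] at h2
    by_contra hne
    have h4 : ((w ^ β i * (w ^ α i)⁻¹ : Circle) : ℂ) = 1 := mul_right_cancel₀ hne (by rw [h2, one_mul])
    have h5 : w ^ β i * (w ^ α i)⁻¹ = 1 := Circle.ext (by rw [h4, Circle.coe_one])
    exact hw (mul_inv_eq_one.1 h5).symm

end Basis

/-! ### Bounded point evaluations and completeness of the Bergman space -/

section Evaluation

variable {ι : Type*} [Fintype ι] {lam : ℝ}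

theorem bergmanDensity_pos (hlam : -1 < lam) {z : ι → ℂ} (hz : z ∈ unitBall ι) :
    0 < bergmanDensity ι lam z := by
  have hz1 : 0 < 1 - ∑ i, ‖z i‖ ^ 2 := sub_pos.2 hz
  have hg1 : 0 < Real.Gamma (lam + 1) := Real.Gamma_pos_of_pos (by linarith)
  have hc : (0 : ℝ) ≤ Fintype.card ι := Nat.cast_nonneg _
  have hg2 : 0 < Real.Gamma (Fintype.card ι + lam + 1) := Real.Gamma_pos_of_pos (by linarith)
  have := Real.pi_pos
  unfold bergmanDensity
  positivity

theorem continuousOn_bergmanDensity : ContinuousOn (bergmanDensity ι lam) (unitBall ι) := by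
  unfold bergmanDensity
  refine continuousOn_const.mul (ContinuousOn.rpow_const (by fun_prop) fun z hz => Or.inl ?_)
  exact (sub_pos.2 hz).ne'

/-- The one-variable mean value property on the slice `ζ ↦ F (w + ζ • v)`. Since `v` lies in the
open ball, the closed unit disc of the slice stays inside the domain of `F`. -/
theorem integral_circleMap_smul {F : (ι → ℂ) → ℂ} {w v : ι → ℂ} {r : ℝ}
    (hF : DifferentiableOn ℂ F (Metric.ball w r)) (hv : v ∈ Metric.ball (0 : ι → ℂ) r) :
    ∫ θ in Set.Ioc 0 (2 * Real.pi), F (w + rot (fun _ => Circle.exp θ) v) =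
      (2 * Real.pi : ℝ) • F w := by
  have hg : DifferentiableOn ℂ (fun ζ : ℂ => F (w + ζ • v)) (Metric.closedBall 0 1) := by
    refine hF.comp (by fun_prop) fun ζ hζ => ?_
    simp only [Metric.mem_ball, dist_eq_norm, sub_zero, Metric.mem_closedBall] at hζ hv ⊢
    rw [add_sub_cancel_left, norm_smul]
    nlinarith [norm_nonneg v]
  have hd : DiffContOnCl ℂ (fun ζ : ℂ => F (w + ζ • v)) (Metric.ball 0 |1|) := by
    refine DifferentiableOn.diffContOnCl ?_
    rwa [abs_one, closure_ball _ one_ne_zero]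
  have h := hd.circleAverage
  rw [Real.circleAverage_def, intervalIntegral.integral_of_le (by positivity), zero_smul,
    add_zero] at h
  have h2 : ∀ θ, F (w + rot (fun _ => Circle.exp θ) v) = F (w + circleMap 0 1 θ • v) := by
    intro θ
    congr 2
    funext i
    simp [rot, circleMap]
  simp only [h2]
  rw [← h, smul_smul, mul_inv_cancel₀ (by positivity), one_smul]

/-- The ball of the sup norm is a polydisc, hence invariant under multiplication by unimodular
scalars about its centre. Averaging over these rotations leaves the integral unchanged and replaces
the integrand by its value at the centre. -/
theorem setIntegral_ball_eq {F : (ι → ℂ) → ℂ} {w : ι → ℂ} {r : ℝ}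
    (hF : DifferentiableOn ℂ F (Metric.ball w r)) (hi : IntegrableOn F (Metric.ball w r)) :
    ∫ v in Metric.ball w r, F v = (volume : Measure (ι → ℂ)).real (Metric.ball w r) • F w := by
  set μ : Measure (ι → ℂ) := volume.restrict (Metric.ball 0 r) with hμ
  have hpre : (fun v => w + v) ⁻¹' Metric.ball w r = Metric.ball 0 r := by
    ext v; simp [dist_eq_norm]
  have hemb : MeasurableEmbedding (fun v : ι → ℂ => w + v) := measurableEmbedding_addLeft w
  have hmpw : MeasurePreserving (fun v : ι → ℂ => w + v) volume volume :=
    measurePreserving_add_left volume w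
  have h1 : ∫ v in Metric.ball w r, F v = ∫ v, F (w + v) ∂μ := by
    rw [← hmpw.setIntegral_preimage_emb hemb, hpre]
  have hi' : Integrable (fun v => F (w + v)) μ := by
    have := (hmpw.integrableOn_comp_preimage hemb (f := F) (s := Metric.ball w r)).2 hi
    rwa [hpre] at this
  have hrot : ∀ θ : ℝ, MeasurePreserving (rot fun _ : ι => Circle.exp θ) μ μ := by
    intro θ
    have hp : (rot fun _ : ι => Circle.exp θ) ⁻¹' Metric.ball 0 r = Metric.ball 0 r := by
      ext v
      have : rot (fun _ : ι => Circle.exp θ) v = (Circle.exp θ : ℂ) • v := rfl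
      simp [this, norm_smul]
    have := (measurePreserving_rot_volume (fun _ : ι => Circle.exp θ)).restrict_preimage
      (s := Metric.ball 0 r) measurableSet_ball
    rwa [hp] at this
  have hmeas : Measurable (Function.uncurry fun (θ : ℝ) => rot fun _ : ι => Circle.exp θ) :=
    (continuous_uncurry_rot (by fun_prop)).measurable
  have h2 := integral_average μ (volume.restrict (Set.Ioc (0 : ℝ) (2 * Real.pi))) hmeas hrot hi'
  have h3 : ∫ v, (∫ θ in Set.Ioc 0 (2 * Real.pi), F (w + rot (fun _ => Circle.exp θ) v)) ∂μ =
      ∫ v, (2 * Real.pi : ℝ) • F w ∂μ :=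
    setIntegral_congr_fun measurableSet_ball fun v hv => integral_circleMap_smul hF hv
  rw [h3, integral_const] at h2
  have h4 : (volume.restrict (Set.Ioc (0 : ℝ) (2 * Real.pi))).real Set.univ = 2 * Real.pi := by
    simp [Measure.real, Real.pi_pos.le]
  have h5 : μ.real Set.univ = (volume : Measure (ι → ℂ)).real (Metric.ball w r) := by
    rw [hμ, Measure.real, Measure.restrict_apply_univ, Measure.real, ← hpre,
      hmpw.measure_preimage_emb hemb]
  rw [h4, h5, smul_comm] at h2
  rw [h1]
  exact (smul_right_injective ℂ (by positivity : (2 * Real.pi : ℝ) ≠ 0) h2).symm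

theorem lintegral_enorm_le_enorm (hlam : -1 < lam) (f : Lp ℂ 2 (bergmanMeasure ι lam)) :
    ∫⁻ z, ‖f z‖ₑ ∂(bergmanMeasure ι lam) ≤ ‖f‖ₑ := by
  have := isProbabilityMeasure_bergmanMeasure (ι := ι) hlam
  rw [← eLpNorm_one_eq_lintegral_enorm, Lp.enorm_def]
  exact eLpNorm_le_eLpNorm_of_exponent_le (by norm_num) (Lp.aestronglyMeasurable f)

/-- Point evaluations are bounded on the Bergman space, locally uniformly in the point. -/
theorem exists_norm_le_of_isHolRep (hlam : -1 < lam) {z : ι → ℂ} (hz : z ∈ unitBall ι) :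
    ∃ r > 0, Metric.ball z r ⊆ unitBall ι ∧ ∃ C : ℝ, ∀ (f : Lp ℂ 2 (bergmanMeasure ι lam))
      (F : (ι → ℂ) → ℂ), IsHolRep lam f F → ∀ w ∈ Metric.ball z r, ‖F w‖ ≤ C * ‖f‖ := by
  obtain ⟨R, hR, hRs⟩ := Metric.nhds_basis_closedBall.mem_iff.1 ((isOpen_unitBall ι).mem_nhds hz)
  -- The minimum of the density over a compact ball is a positive constant `c` that compares
  -- Lebesgue measure with the weighted measure, whatever the sign of `lam`.
  obtain ⟨z₁, hz₁, hmin⟩ := (isCompact_closedBall z R).exists_isMinOn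
    ⟨z, Metric.mem_closedBall_self hR.le⟩ (continuousOn_bergmanDensity (lam := lam) |>.mono hRs)
  set c := bergmanDensity ι lam z₁ with hc
  have hc0 : 0 < c := bergmanDensity_pos hlam (hRs hz₁)
  set v := (volume : Measure (ι → ℂ)).real (Metric.ball 0 (R / 2)) with hv
  have hv0 : 0 < v := by
    rw [hv, Measure.real, ENNReal.toReal_pos_iff]
    exact ⟨Metric.measure_ball_pos _ _ (by positivity), measure_ball_lt_top⟩
  refine ⟨R / 2, by positivity,
    (Metric.ball_subset_ball (by linarith)).trans (Metric.ball_subset_closedBall.trans hRs),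
    (c * v)⁻¹, fun f F hF w hw => ?_⟩
  have hsub : Metric.closedBall w (R / 2) ⊆ Metric.closedBall z R :=
    Metric.closedBall_subset_closedBall' (by linarith [Metric.mem_ball.1 hw])
  have hsub' : Metric.ball w (R / 2) ⊆ unitBall ι :=
    Metric.ball_subset_closedBall.trans (hsub.trans hRs)
  have hint : IntegrableOn F (Metric.ball w (R / 2)) :=
    ((hF.1.continuousOn.mono (hsub.trans hRs)).integrableOn_compact
      (isCompact_closedBall _ _)).mono_set Metric.ball_subset_closedBall
  have h1 := setIntegral_ball_eq (hF.1.mono hsub') hint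
  have hvol : (volume : Measure (ι → ℂ)).real (Metric.ball w (R / 2)) = v := by
    rw [hv, Measure.real, Measure.real, Measure.addHaar_ball_center]
  have h2 : ENNReal.ofReal (c * (v * ‖F w‖)) ≤ ‖f‖ₑ := by
    calc ENNReal.ofReal (c * (v * ‖F w‖))
        = ENNReal.ofReal c * ‖∫ y in Metric.ball w (R / 2), F y‖ₑ := by
          rw [h1, hvol, ← ofReal_norm, norm_smul, Real.norm_of_nonneg hv0.le,
            ENNReal.ofReal_mul hc0.le]
      _ ≤ ENNReal.ofReal c * ∫⁻ y in Metric.ball w (R / 2), ‖F y‖ₑ := by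
          gcongr
          exact enorm_integral_le_lintegral_enorm _
      _ = ∫⁻ y in Metric.ball w (R / 2), ENNReal.ofReal c * ‖F y‖ₑ := by
          rw [lintegral_const_mul' _ _ ENNReal.ofReal_ne_top]
      _ ≤ ∫⁻ y in Metric.ball w (R / 2), ENNReal.ofReal (bergmanDensity ι lam y) * ‖F y‖ₑ := by
          refine setLIntegral_mono' measurableSet_ball fun y hy => ?_
          gcongr
          exact hmin (hsub (Metric.ball_subset_closedBall hy))
      _ ≤ ∫⁻ y in unitBall ι, ENNReal.ofReal (bergmanDensity ι lam y) * ‖F y‖ₑ :=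
          lintegral_mono_set hsub'
      _ = ∫⁻ y, ‖F y‖ₑ ∂(bergmanMeasure ι lam) := by
          rw [bergmanMeasure, lintegral_withDensity_eq_lintegral_mul₀
            (measurable_bergmanDensity lam).aemeasurable]
          · rfl
          · exact (hF.1.continuousOn.aestronglyMeasurable (measurableSet_unitBall ι)).enorm
      _ = ∫⁻ y, ‖f y‖ₑ ∂(bergmanMeasure ι lam) := by
          refine lintegral_congr_ae ?_
          filter_upwards [hF.2] with y hy
          rw [hy]
      _ ≤ ‖f‖ₑ := lintegral_enorm_le_enorm hlam f
  rw [← ofReal_norm, ENNReal.ofReal_le_ofReal_iff (norm_nonneg _)] at h2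
  rw [← div_eq_inv_mul, le_div_iff₀ (by positivity)]
  linarith

/-- Values and derivatives are bounded on the Bergman space, locally uniformly in the point. -/
theorem exists_norm_fderiv_le_of_isHolRep (hlam : -1 < lam) {z : ι → ℂ} (hz : z ∈ unitBall ι) :
    ∃ r > 0, Metric.ball z r ⊆ unitBall ι ∧ ∃ C : ℝ, ∀ (f : Lp ℂ 2 (bergmanMeasure ι lam))
      (F : (ι → ℂ) → ℂ), IsHolRep lam f F → ∀ w ∈ Metric.ball z r,
        ‖F w‖ ≤ C * ‖f‖ ∧ ‖fderiv ℂ F w‖ ≤ C * ‖f‖ := by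
  obtain ⟨r, hr, hrs, C, hC⟩ := exists_norm_le_of_isHolRep hlam hz
  -- The second entry of the maximum is Cauchy's estimate: on a ball of radius `r / 2` about `w` the
  -- function stays within `2 * C * ‖f‖` of `F w`.
  refine ⟨r / 2, by positivity, (Metric.ball_subset_ball (by linarith)).trans hrs,
    max C ((2 * C) / (r / 2)), fun f F hF w hw => ⟨?_, ?_⟩⟩
  · refine (hC f F hF w (Metric.ball_subset_ball (by linarith) hw)).trans ?_
    exact mul_le_mul_of_nonneg_right (le_max_left _ _) (norm_nonneg _)
  · have hsub : Metric.ball w (r / 2) ⊆ Metric.ball z r :=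
      Metric.ball_subset_ball' (by linarith [Metric.mem_ball.1 hw])
    have hmaps : Set.MapsTo F (Metric.ball w (r / 2)) (Metric.closedBall (F w) (2 * C * ‖f‖)) := by
      intro y hy
      have h1 := hC f F hF y (hsub hy)
      have h2 := hC f F hF w (hsub (Metric.mem_ball_self (by positivity)))
      rw [Metric.mem_closedBall, dist_eq_norm]
      linarith [norm_sub_le (F y) (F w)]
    have := Complex.norm_fderiv_le_div_of_mapsTo_ball (hF.1.mono (hsub.trans hrs)) hmaps
      (by positivity)
    refine this.trans ?_
    rw [mul_div_right_comm]
    exact mul_le_mul_of_nonneg_right (le_max_right _ _) (norm_nonneg _)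

theorem IsHolRep.sub {f g : Lp ℂ 2 (bergmanMeasure ι lam)} {F G : (ι → ℂ) → ℂ}
    (hf : IsHolRep lam f F) (hg : IsHolRep lam g G) : IsHolRep lam (f - g) (F - G) :=
  ⟨hf.1.sub hg.1, (Lp.coeFn_sub f g).trans (hf.2.sub hg.2)⟩

open Filter Topology in
/-- Convergence in the Bergman space implies pointwise convergence of derivatives. -/
theorem tendsto_fderiv_of_isHolRep (hlam : -1 < lam) {κ : Type*} {l : Filter κ}
    {f : κ → Lp ℂ 2 (bergmanMeasure ι lam)} {F : κ → (ι → ℂ) → ℂ} (hF : ∀ n, IsHolRep lam (f n) (F n))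
    {g : Lp ℂ 2 (bergmanMeasure ι lam)} {G : (ι → ℂ) → ℂ} (hG : IsHolRep lam g G)
    (h : Tendsto f l (𝓝 g)) {z : ι → ℂ} (hz : z ∈ unitBall ι) :
    Tendsto (fun n => F n z) l (𝓝 (G z)) ∧
      Tendsto (fun n => fderiv ℂ (F n) z) l (𝓝 (fderiv ℂ G z)) := by
  obtain ⟨r, hr, -, C, hC⟩ := exists_norm_fderiv_le_of_isHolRep hlam hz
  have h0 : Tendsto (fun n => C * ‖f n - g‖) l (𝓝 0) := by
    have := (tendsto_iff_norm_sub_tendsto_zero.1 h).const_mul C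
    rwa [mul_zero] at this
  have hn := (isOpen_unitBall ι).mem_nhds hz
  constructor
  · rw [tendsto_iff_norm_sub_tendsto_zero]
    refine squeeze_zero (fun _ => norm_nonneg _) (fun n => ?_) h0
    exact (hC _ _ ((hF n).sub hG) z (Metric.mem_ball_self hr)).1
  · rw [tendsto_iff_norm_sub_tendsto_zero]
    refine squeeze_zero (fun _ => norm_nonneg _) (fun n => ?_) h0
    have := (hC _ _ ((hF n).sub hG) z (Metric.mem_ball_self hr)).2
    rwa [fderiv_sub ((hF n).1.differentiableAt hn) (hG.1.differentiableAt hn)] at this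

open Filter Topology in
-- Along an `L²`-convergent sequence, values converge pointwise and derivatives converge locally
-- uniformly on the ball, so the pointwise limit is holomorphic. A subsequence that converges almost
-- everywhere identifies it with the `L²` limit.
theorem isClosed_bergman (hlam : -1 < lam) :
    IsClosed (bergman ι lam : Set (Lp ℂ 2 (bergmanMeasure ι lam))) := by
  have := isProbabilityMeasure_bergmanMeasure (ι := ι) hlam
  refine isClosed_of_closure_subset fun f hf => ?_
  obtain ⟨f', hf', hlim⟩ := mem_closure_iff_seq_limit.1 hf
  choose F hF using hf'
  have hcs : CauchySeq f' := hlim.cauchySeq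
  have hpt : ∀ z ∈ unitBall ι, CauchySeq (fun n => F n z) := by
    intro z hz
    obtain ⟨r, hr, -, C, hC⟩ := exists_norm_fderiv_le_of_isHolRep (lam := lam) hlam hz
    rw [Metric.cauchySeq_iff] at hcs ⊢
    intro ε hε
    obtain ⟨N, hN⟩ := hcs (ε / (|C| + 1)) (by positivity)
    refine ⟨N, fun m hm n hn => ?_⟩
    have h1 := (hC _ _ ((hF m).sub (hF n)) z (Metric.mem_ball_self hr)).1
    have h2 := hN m hm n hn
    rw [dist_eq_norm] at h2 ⊢
    rw [lt_div_iff₀ (by positivity)] at h2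
    refine h1.trans_lt ?_
    nlinarith [le_abs_self C, norm_nonneg (f' m - f' n)]
  have hG : ∀ z, ∃ y, z ∈ unitBall ι → Tendsto (fun n => F n z) atTop (𝓝 y) := by
    intro z
    by_cases hz : z ∈ unitBall ι
    · obtain ⟨y, hy⟩ := cauchySeq_tendsto_of_complete (hpt z hz)
      exact ⟨y, fun _ => hy⟩
    · exact ⟨0, fun h => absurd h hz⟩
  choose G hG using hG
  have hG' : ∀ z, ∃ y, z ∈ unitBall ι → Tendsto (fun n => fderiv ℂ (F n) z) atTop (𝓝 y) := by
    intro z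
    by_cases hz : z ∈ unitBall ι
    · have hc : CauchySeq (fun n => fderiv ℂ (F n) z) := by
        obtain ⟨r, hr, -, C, hC⟩ := exists_norm_fderiv_le_of_isHolRep (lam := lam) hlam hz
        have hn := (isOpen_unitBall ι).mem_nhds hz
        rw [Metric.cauchySeq_iff] at hcs ⊢
        intro ε hε
        obtain ⟨N, hN⟩ := hcs (ε / (|C| + 1)) (by positivity)
        refine ⟨N, fun m hm n hn' => ?_⟩
        have h1 := (hC _ _ ((hF m).sub (hF n)) z (Metric.mem_ball_self hr)).2
        rw [fderiv_sub ((hF m).1.differentiableAt hn) ((hF n).1.differentiableAt hn)] at h1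
        have h2 := hN m hm n hn'
        rw [dist_eq_norm] at h2 ⊢
        rw [lt_div_iff₀ (by positivity)] at h2
        refine h1.trans_lt ?_
        nlinarith [le_abs_self C, norm_nonneg (f' m - f' n)]
      obtain ⟨y, hy⟩ := cauchySeq_tendsto_of_complete hc
      exact ⟨y, fun _ => hy⟩
    · exact ⟨0, fun h => absurd h hz⟩
  choose G' hG' using hG'
  have hunif : TendstoLocallyUniformlyOn (fun n => fderiv ℂ (F n)) G' atTop (unitBall ι) := by
    rw [Metric.tendstoLocallyUniformlyOn_iff]
    intro ε hε z hz
    obtain ⟨r, hr, hrs, C, hC⟩ := exists_norm_fderiv_le_of_isHolRep (lam := lam) hlam hz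
    refine ⟨Metric.ball z r, mem_nhdsWithin_of_mem_nhds (Metric.ball_mem_nhds z hr), ?_⟩
    rw [Metric.cauchySeq_iff] at hcs
    obtain ⟨N, hN⟩ := hcs (ε / 2 / (|C| + 1)) (by positivity)
    filter_upwards [eventually_ge_atTop N] with n hn w hw
    have hnw := (isOpen_unitBall ι).mem_nhds (hrs hw)
    -- Letting `m → ∞` in the Cauchy estimate only preserves a weak inequality, hence the margin `ε
    -- / 2`.
    have hle : ‖G' w - fderiv ℂ (F n) w‖ ≤ ε / 2 := by
      refine le_of_tendsto (((hG' w (hrs hw)).sub_const (fderiv ℂ (F n) w)).norm) ?_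
      filter_upwards [eventually_ge_atTop N] with m hm
      have h1 := (hC _ _ ((hF m).sub (hF n)) w hw).2
      rw [fderiv_sub ((hF m).1.differentiableAt hnw) ((hF n).1.differentiableAt hnw)] at h1
      have h2 := hN m hm n hn
      rw [dist_eq_norm, lt_div_iff₀ (by positivity)] at h2
      refine h1.trans ?_
      nlinarith [le_abs_self C, norm_nonneg (f' m - f' n)]
    rw [dist_eq_norm]
    linarith
  refine ⟨G, fun z hz => ?_, ?_⟩
  · have := hasFDerivAt_of_tendstoLocallyUniformlyOn (isOpen_unitBall ι) hunif
      (fun n x hx => ((hF n).1.differentiableAt ((isOpen_unitBall ι).mem_nhds hx)).hasFDerivAt)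
      (fun x hx => hG x hx) hz
    exact this.differentiableAt.differentiableWithinAt
  · have hm : TendstoInMeasure (bergmanMeasure ι lam) (fun n => (f' n : (ι → ℂ) → ℂ)) atTop f :=
      tendstoInMeasure_of_tendsto_Lp hlim
    obtain ⟨ns, hns, hae⟩ := hm.exists_seq_tendsto_ae
    have hall : ∀ᵐ z ∂(bergmanMeasure ι lam), ∀ n, f' n z = F n z :=
      ae_all_iff.2 fun n => (hF n).2
    filter_upwards [hae, hall, ae_mem_unitBall ι lam] with z h1 h2 hz
    refine tendsto_nhds_unique h1 ?_
    simp only [h2]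
    exact (hG z hz).comp hns.tendsto_atTop

theorem completeSpace_bergman (hlam : -1 < lam) : CompleteSpace (bergman ι lam) :=
  (isClosed_bergman hlam).completeSpace_coe

end Evaluation

/-! ### Fourier coefficients of a holomorphic function on a circle -/

section CircleAction

/-- Expand `h` in its Taylor series and integrate term by term; orthogonality of characters leaves
only the term `k = a`. Because `R > 1`, the Taylor coefficients are absolutely summable, which
justifies the exchange for every `‖ζ‖ ≤ 1`. -/
theorem hasSum_fourier_mul_comp (a : ℤ) {h : ℂ → ℂ} {R : ℝ} (hR : 1 < R)
    (hh : DifferentiableOn ℂ h (Metric.ball 0 R)) {ζ : ℂ} (hζ : ‖ζ‖ ≤ 1) :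
    HasSum (fun k : ℕ => ((k.factorial : ℂ)⁻¹ * iteratedDeriv k h 0) * ζ ^ k *
        (if (k : ℤ) = a then 1 else 0))
      (∫ t : UnitAddCircle, fourier (-a) t * h (ζ * (AddCircle.toCircle t : ℂ))
        ∂AddCircle.haarAddCircle) := by
  set c : ℕ → ℂ := fun k => (k.factorial : ℂ)⁻¹ * iteratedDeriv k h 0 with hc
  have hser : ∀ w : ℂ, ‖w‖ ≤ 1 → HasSum (fun k => c k * w ^ k) (h w) := by
    intro w hw
    have hw' : w ∈ Metric.ball (0 : ℂ) R := by
      rw [Metric.mem_ball, dist_zero_right]; linarith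
    have := Complex.hasSum_taylorSeries_on_ball hh hw'
    refine this.congr_fun ?_
    intro k
    simp only [hc, smul_eq_mul, sub_zero]
    ring
  have hsum : Summable fun k => ‖c k‖ := by
    have := (hser 1 (by simp)).summable
    simpa using this.norm
  have hterm : ∀ (k : ℕ) (t : UnitAddCircle),
      fourier (-a) t * (c k * (ζ * (AddCircle.toCircle t : ℂ)) ^ k) =
        (c k * ζ ^ k) * (fourier (-a) t • fourier (k : ℤ) t) := by
    intro k t
    rw [mul_pow, smul_eq_mul, fourier_apply (n := (k : ℤ)), AddCircle.toCircle_zsmul]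
    push_cast
    rw [zpow_natCast]
    ring
  have hint : ∀ k : ℕ, ∫ t : UnitAddCircle, fourier (-a) t *
      (c k * (ζ * (AddCircle.toCircle t : ℂ)) ^ k) ∂AddCircle.haarAddCircle =
        c k * ζ ^ k * (if (k : ℤ) = a then 1 else 0) := by
    intro k
    simp only [hterm]
    rw [integral_const_mul]
    congr 1
    have h1 := congrFun (fourierCoeff_fourier (T := 1) (k : ℤ)) a
    rw [fourierCoeff] at h1
    rw [h1, Pi.single_apply]
    simp only [eq_comm]
  have hnorm : ∀ (k : ℕ) (t : UnitAddCircle),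
      ‖fourier (-a) t * (c k * (ζ * (AddCircle.toCircle t : ℂ)) ^ k)‖ ≤ ‖c k‖ := by
    intro k t
    have h1 : ‖ζ * (AddCircle.toCircle t : ℂ)‖ = ‖ζ‖ := by
      rw [norm_mul, show ‖(AddCircle.toCircle t : ℂ)‖ = 1 from Circle.norm_coe _, mul_one]
    have h2 : ‖fourier (-a) t‖ = 1 := Circle.norm_coe _
    rw [norm_mul, norm_mul, norm_pow, h1, h2, one_mul]
    exact mul_le_of_le_one_right (norm_nonneg _) (pow_le_one₀ (norm_nonneg _) hζ)
  have hcont : ∀ k : ℕ, Continuous fun t : UnitAddCircle =>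
      fourier (-a) t * (c k * (ζ * (AddCircle.toCircle t : ℂ)) ^ k) := by
    intro k
    have : Continuous fun t : UnitAddCircle => (AddCircle.toCircle t : ℂ) :=
      Continuous.comp (by fun_prop : Continuous fun w : Circle => (w : ℂ))
        AddCircle.continuous_toCircle
    fun_prop
  have hi : ∀ k : ℕ, Integrable (fun t : UnitAddCircle =>
      fourier (-a) t * (c k * (ζ * (AddCircle.toCircle t : ℂ)) ^ k)) AddCircle.haarAddCircle :=
    fun k => Integrable.of_bound (hcont k).aestronglyMeasurable ‖c k‖
      (Filter.Eventually.of_forall (hnorm k))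
  have := hasSum_integral_of_summable_integral_norm hi (by
    refine Summable.of_nonneg_of_le (fun k => integral_nonneg fun _ => norm_nonneg _)
      (fun k => ?_) hsum
    calc ∫ t : UnitAddCircle, ‖fourier (-a) t * (c k * (ζ * (AddCircle.toCircle t : ℂ)) ^ k)‖
          ∂AddCircle.haarAddCircle
        ≤ ∫ t : UnitAddCircle, ‖c k‖ ∂AddCircle.haarAddCircle :=
          integral_mono (hi k).norm (integrable_const _) (hnorm k)
      _ = ‖c k‖ := by simp)
  have hval : ∫ t : UnitAddCircle, ∑' k, fourier (-a) t *
      (c k * (ζ * (AddCircle.toCircle t : ℂ)) ^ k) ∂AddCircle.haarAddCircle =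
      ∫ t : UnitAddCircle, fourier (-a) t * h (ζ * (AddCircle.toCircle t : ℂ))
        ∂AddCircle.haarAddCircle := by
    refine integral_congr_ae (Filter.Eventually.of_forall fun t => ?_)
    have hw : ‖ζ * (AddCircle.toCircle t : ℂ)‖ ≤ 1 := by
      rwa [norm_mul, show ‖(AddCircle.toCircle t : ℂ)‖ = 1 from Circle.norm_coe _, mul_one]
    exact ((hser _ hw).mul_left _).tsum_eq
  rw [hval] at this
  exact this.congr_fun fun k => (hint k).symm

/-- Comparing the expansions at `ζ` and at `1` gives the homogeneity in `ζ` with no Taylor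
coefficient in the statement. For `a < 0` both series vanish. -/
theorem integral_fourier_mul_comp (a : ℤ) {h : ℂ → ℂ} {R : ℝ} (hR : 1 < R)
    (hh : DifferentiableOn ℂ h (Metric.ball 0 R)) {ζ : ℂ} (hζ : ‖ζ‖ ≤ 1) :
    ∫ t : UnitAddCircle, fourier (-a) t * h (ζ * (AddCircle.toCircle t : ℂ))
        ∂AddCircle.haarAddCircle =
      (if 0 ≤ a then ζ ^ a.toNat else 0) *
        ∫ t : UnitAddCircle, fourier (-a) t * h (AddCircle.toCircle t : ℂ)
          ∂AddCircle.haarAddCircle := by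
  have h1 := hasSum_fourier_mul_comp a hR hh hζ
  have h2 := hasSum_fourier_mul_comp a hR hh (ζ := 1) (by simp)
  simp only [one_mul] at h2
  refine h1.unique ((h2.mul_left _).congr_fun fun k => ?_)
  by_cases hk : (k : ℤ) = a
  · subst hk
    simp
    ring
  · simp [hk]

end CircleAction

/-! ### Torus Fourier coefficients are monomials -/

section TorusCoefficients

variable {ι : Type*} [Fintype ι]

/-- The normalized Haar measure on the torus. -/
def torusMeasure (ι : Type*) [Fintype ι] : Measure (UnitAddTorus ι) :=
  Measure.pi fun _ => AddCircle.haarAddCircle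

instance : IsProbabilityMeasure (torusMeasure ι) := by
  unfold torusMeasure; infer_instance

instance : (torusMeasure ι).IsAddLeftInvariant := by
  unfold torusMeasure; infer_instance

/-- The unimodular numbers attached to a point of the torus. -/
def torusCircle (θ : UnitAddTorus ι) : ι → Circle := fun i => AddCircle.toCircle (θ i)

omit [Fintype ι] in
theorem continuous_torusCircle : Continuous (torusCircle : UnitAddTorus ι → ι → Circle) :=
  continuous_pi fun i => AddCircle.continuous_toCircle.comp (continuous_apply i)

/-- The torus Fourier coefficients of `θ ↦ F(e^{2πiθ} z)`. -/
def torusCoeff (F : (ι → ℂ) → ℂ) (n : ι → ℤ) (z : ι → ℂ) : ℂ :=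
  ∫ θ, UnitAddTorus.mFourier (-n) θ * F (rot (torusCircle θ) z) ∂(torusMeasure ι)

theorem continuous_torus_orbit {F : (ι → ℂ) → ℂ} (hF : DifferentiableOn ℂ F (unitBall ι))
    {z : ι → ℂ} (hz : z ∈ unitBall ι) : Continuous fun θ => F (rot (torusCircle θ) z) := by
  refine hF.continuousOn.comp_continuous ?_ fun θ => (rot_mem_unitBall _).2 hz
  exact (continuous_uncurry_rot continuous_torusCircle).comp (continuous_id.prodMk continuous_const)

/-- A continuous function on the torus whose Fourier coefficients vanish has a trivially summable
Fourier series, which therefore represents it everywhere; evaluate at `θ = 0`. -/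
theorem eq_zero_of_torusCoeff_eq_zero {F : (ι → ℂ) → ℂ} (hF : DifferentiableOn ℂ F (unitBall ι))
    {z : ι → ℂ} (hz : z ∈ unitBall ι) (h : ∀ n, torusCoeff F n z = 0) : F z = 0 := by
  let f : C(UnitAddTorus ι, ℂ) := ⟨fun θ => F (rot (torusCircle θ) z), continuous_torus_orbit hF hz⟩
  have h0 : UnitAddTorus.mFourierCoeff f = 0 := by
    funext n
    exact h n
  have h1 := UnitAddTorus.hasSum_mFourier_series_apply_of_summable (f := f)
    (by rw [h0]; exact summable_zero) 0
  simp only [h0, Pi.zero_apply, zero_smul] at h1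
  have h2 : f 0 = 0 := (hasSum_zero.unique h1).symm
  have h3 : rot (torusCircle (0 : UnitAddTorus ι)) z = z := by
    funext i
    simp [rot, torusCircle]
  simpa [f, h3] using h2

theorem update_mem_unitBall [DecidableEq ι] {z : ι → ℂ} (hz : z ∈ unitBall ι) (i : ι) :
    ∃ R : ℝ, 1 < R ∧ ∀ x : ℂ, ‖x‖ < R → Function.update z i (x * z i) ∈ unitBall ι := by
  set s := ∑ j, ‖z j‖ ^ 2 with hs
  have hs1 : s < 1 := hz
  have hs0 : 0 ≤ s := by positivity
  -- Stretching by at most this factor keeps the squared norm at most `(2 - s) * s = 1 - (1 - s)² <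
  -- 1`.
  refine ⟨Real.sqrt (2 - s), ?_, fun x hx => ?_⟩
  · rw [Real.lt_sqrt zero_le_one]; linarith
  · rw [Real.lt_sqrt (norm_nonneg _)] at hx
    have hle : ∑ j, ‖Function.update z i (x * z i) j‖ ^ 2 ≤ ∑ j, (2 - s) * ‖z j‖ ^ 2 := by
      refine Finset.sum_le_sum fun j _ => ?_
      by_cases hj : j = i
      · subst hj
        rw [Function.update_self, norm_mul, mul_pow]
        gcongr
      · rw [Function.update_of_ne hj]
        nlinarith [sq_nonneg ‖z j‖]
    rw [← Finset.mul_sum, ← hs] at hle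
    change ∑ j, ‖Function.update z i (x * z i) j‖ ^ 2 < 1
    nlinarith [sq_nonneg (1 - s), sq_pos_of_pos (sub_pos.2 hs1)]

theorem mFourier_add_single [DecidableEq ι] (n : ι → ℤ) (θ : UnitAddTorus ι) (i : ι)
    (t : UnitAddCircle) : UnitAddTorus.mFourier n (θ + Pi.single i t) =
      UnitAddTorus.mFourier n θ * fourier (n i) t := by
  simp only [UnitAddTorus.mFourier, ContinuousMap.coe_mk]
  rw [Fintype.prod_eq_mul_prod_compl i, Fintype.prod_eq_mul_prod_compl i]
  have h1 : ∏ j ∈ ({i} : Finset ι)ᶜ, fourier (n j) ((θ + Pi.single i t : UnitAddTorus ι) j) =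
      ∏ j ∈ ({i} : Finset ι)ᶜ, (fourier (n j) (θ j) : ℂ) := by
    refine Finset.prod_congr rfl fun j hj => ?_
    have hj : j ≠ i := by simpa using hj
    simp [Pi.single_eq_of_ne hj]
  rw [h1, Pi.add_apply, Pi.single_eq_same]
  simp only [fourier_apply, smul_add, AddCircle.toCircle_add, Circle.coe_mul]
  ring

/-- Translating the torus in direction `i` and averaging over the translation turns the coefficient
into an outer torus integral of one-variable Fourier coefficients, whose dependence on `ζ` is known
from the circle case. -/
theorem torusCoeff_update [DecidableEq ι] {F : (ι → ℂ) → ℂ}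
    (hF : DifferentiableOn ℂ F (unitBall ι)) (n : ι → ℤ) {z : ι → ℂ} (hz : z ∈ unitBall ι) (i : ι)
    {ζ : ℂ} (hζ : ‖ζ‖ ≤ 1) :
    torusCoeff F n (Function.update z i (ζ * z i)) =
      (if 0 ≤ n i then ζ ^ (n i).toNat else 0) * torusCoeff F n z := by
  have hmeas : Measurable (Function.uncurry fun (t : UnitAddCircle) (θ : UnitAddTorus ι) =>
      θ + Pi.single i t) := by
    have : Continuous (Function.uncurry fun (t : UnitAddCircle) (θ : UnitAddTorus ι) =>
        θ + Pi.single i t) := by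
      refine continuous_snd.add ?_
      exact (continuous_single i).comp continuous_fst
    exact this.measurable
  have hmp : ∀ t : UnitAddCircle, MeasurePreserving (fun θ : UnitAddTorus ι => θ + Pi.single i t)
      (torusMeasure ι) (torusMeasure ι) := by
    intro t
    have h : (fun θ : UnitAddTorus ι => θ + Pi.single i t) =
        fun θ => (Pi.single i t : UnitAddTorus ι) + θ := funext fun θ => add_comm _ _
    rw [h]
    exact measurePreserving_add_left _ _
  have hslice : ∀ ζ : ℂ, ‖ζ‖ ≤ 1 → torusCoeff F n (Function.update z i (ζ * z i)) =
      (if 0 ≤ n i then ζ ^ (n i).toNat else 0) * ∫ θ, UnitAddTorus.mFourier (-n) θ *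
        ∫ t : UnitAddCircle, fourier (-n i) t *
          F (Function.update (rot (torusCircle θ) z) i
            ((AddCircle.toCircle t : ℂ) * rot (torusCircle θ) z i)) ∂AddCircle.haarAddCircle
              ∂(torusMeasure ι) := by
    intro ζ hζ
    obtain ⟨R, hR, hRz⟩ := update_mem_unitBall hz i
    have hz' : Function.update z i (ζ * z i) ∈ unitBall ι := hRz ζ (hζ.trans_lt hR)
    have hcont : Continuous fun θ : UnitAddTorus ι => UnitAddTorus.mFourier (-n) θ *
        F (rot (torusCircle θ) (Function.update z i (ζ * z i))) :=
      (UnitAddTorus.mFourier (-n)).continuous.mul (continuous_torus_orbit hF hz')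
    have hint : Integrable (fun θ : UnitAddTorus ι => UnitAddTorus.mFourier (-n) θ *
        F (rot (torusCircle θ) (Function.update z i (ζ * z i)))) (torusMeasure ι) := by
      rw [← integrableOn_univ]
      exact hcont.continuousOn.integrableOn_compact isCompact_univ
    have h1 := integral_average (torusMeasure ι) (AddCircle.haarAddCircle (T := 1)) hmeas hmp hint
    rw [probReal_univ, one_smul] at h1
    rw [torusCoeff, ← h1, ← integral_const_mul]
    refine integral_congr_ae (Filter.Eventually.of_forall fun θ => ?_)
    set w := rot (torusCircle θ) z with hw
    have hwb : w ∈ unitBall ι := (rot_mem_unitBall _).2 hz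
    obtain ⟨R', hR', hRw⟩ := update_mem_unitBall hwb i
    have hh : DifferentiableOn ℂ (fun x : ℂ => F (Function.update w i (x * w i)))
        (Metric.ball 0 R') := by
      refine hF.comp ?_ fun x hx => hRw x (by simpa using hx)
      refine (differentiable_pi.2 fun j => ?_).differentiableOn
      by_cases hj : j = i
      · subst hj
        simp only [Function.update_self]
        fun_prop
      · simp only [Function.update_of_ne hj]
        fun_prop
    have hrot : ∀ t : UnitAddCircle, rot (torusCircle (θ + Pi.single i t))
        (Function.update z i (ζ * z i)) =
        Function.update w i ((ζ * (AddCircle.toCircle t : ℂ)) * w i) := by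
      intro t
      funext j
      by_cases hj : j = i
      · subst hj
        simp [rot, torusCircle, hw, AddCircle.toCircle_add]
        ring
      · simp [rot, torusCircle, hw, hj]
    have h2 := integral_fourier_mul_comp (n i) hR' hh hζ
    simp only [hrot, mFourier_add_single, Pi.neg_apply, mul_assoc]
    rw [integral_const_mul]
    simp only [mul_assoc] at h2
    rw [h2]
    ring
  -- The value at `ζ = 1` identifies the remaining integral with the coefficient at `z`, except for
  -- negative frequency, where both sides are zero.
  have h1 := hslice 1 (by simp)
  rw [one_mul, Function.update_eq_self] at h1
  rw [hslice ζ hζ, h1]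
  split_ifs <;> simp

/-- With `ζ = 1`, the scaling rule says that the coefficient equals zero times itself. -/
theorem torusCoeff_eq_zero {F : (ι → ℂ) → ℂ} (hF : DifferentiableOn ℂ F (unitBall ι))
    {n : ι → ℤ} {i : ι} (hi : n i < 0) {z : ι → ℂ} (hz : z ∈ unitBall ι) :
    torusCoeff F n z = 0 := by
  classical
  have h := torusCoeff_update hF n hz i (ζ := 1) (by simp)
  rwa [one_mul, Function.update_eq_self, if_neg (not_le.2 hi), zero_mul] at h

theorem mul_mem_unitBall {z ζ : ι → ℂ} (hz : z ∈ unitBall ι) (hζ : ∀ i, ‖ζ i‖ ≤ 1) :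
    ζ * z ∈ unitBall ι := by
  have hz : ∑ i, ‖z i‖ ^ 2 < 1 := hz
  refine lt_of_le_of_lt (Finset.sum_le_sum fun i _ => ?_) hz
  rw [Pi.mul_apply, norm_mul]
  gcongr
  exact mul_le_of_le_one_left (norm_nonneg _) (hζ i)

/-- The one-coordinate scaling rule is applied to the coordinates in turn, by induction over the set
of those already scaled. -/
theorem torusCoeff_mul {F : (ι → ℂ) → ℂ} (hF : DifferentiableOn ℂ F (unitBall ι)) (α : ι → ℕ)
    {z ζ : ι → ℂ} (hz : z ∈ unitBall ι) (hζ : ∀ i, ‖ζ i‖ ≤ 1) :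
    torusCoeff F (fun i => (α i : ℤ)) (ζ * z) =
      (∏ i, ζ i ^ α i) * torusCoeff F (fun i => (α i : ℤ)) z := by
  classical
  have key : ∀ s : Finset ι, torusCoeff F (fun i => (α i : ℤ)) ((fun i => if i ∈ s then ζ i else 1) * z)
      = (∏ i ∈ s, ζ i ^ α i) * torusCoeff F (fun i => (α i : ℤ)) z := by
    intro s
    induction s using Finset.induction_on with
    | empty =>
      have h1 : ((fun i => if i ∈ (∅ : Finset ι) then ζ i else 1) * z : ι → ℂ) = z := by
        funext i
        simp
      rw [h1, Finset.prod_empty, one_mul]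
    | insert i s his ih =>
      have h1 : ((fun j => if j ∈ insert i s then ζ j else 1) * z : ι → ℂ) =
          Function.update ((fun j => if j ∈ s then ζ j else 1) * z) i
            (ζ i * ((fun j => if j ∈ s then ζ j else 1) * z) i) := by
        funext j
        by_cases hj : j = i
        · subst hj
          simp [his]
        · simp [hj]
      have hb : ((fun j => if j ∈ s then ζ j else 1) * z : ι → ℂ) ∈ unitBall ι := by
        refine mul_mem_unitBall hz fun j => ?_
        split_ifs
        · exact hζ j
        · simp
      rw [h1, torusCoeff_update hF _ hb i (hζ i), ih, Finset.prod_insert his]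
      simp
      ring
  have := key Finset.univ
  simpa using this

/-- The coefficient at `δ z` is computed twice: scaling `z` by the constant `δ`, and scaling the
constant vector `δ` by `z`. Comparison gives the monomial with no division by the coordinates of
`z`, which may vanish. -/
theorem exists_torusCoeff_eq {F : (ι → ℂ) → ℂ} (hF : DifferentiableOn ℂ F (unitBall ι))
    (α : ι → ℕ) : ∃ C : ℂ, ∀ z ∈ unitBall ι,
      torusCoeff F (fun i => (α i : ℤ)) z = C * ∏ i, z i ^ α i := by
  -- With `n` coordinates the constant vector has squared norm `n / (n + 1)² < 1`. Adding one keeps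
  -- `δ` nonzero also for `n = 0`.
  set δ : ℂ := ((Fintype.card ι + 1 : ℕ) : ℂ)⁻¹ with hδ
  have hδn : ‖δ‖ = ((Fintype.card ι + 1 : ℕ) : ℝ)⁻¹ := by
    rw [hδ, norm_inv, Complex.norm_natCast]
  have hδ1 : ‖δ‖ ≤ 1 := by
    rw [hδn]
    refine inv_le_one_of_one_le₀ ?_
    push_cast
    linarith [(Nat.cast_nonneg (Fintype.card ι) : (0 : ℝ) ≤ _)]
  have hδ0 : δ ≠ 0 := by
    rw [hδ]
    exact inv_ne_zero (Nat.cast_ne_zero.2 (Nat.succ_ne_zero _))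
  have hw : (fun _ => δ : ι → ℂ) ∈ unitBall ι := by
    change ∑ _i : ι, ‖δ‖ ^ 2 < 1
    rw [Finset.sum_const, Finset.card_univ, nsmul_eq_mul, hδn]
    have : (0 : ℝ) ≤ Fintype.card ι := Nat.cast_nonneg _
    push_cast
    rw [inv_pow, ← div_eq_mul_inv, div_lt_one (by positivity)]
    nlinarith
  have hp : ∏ i, δ ^ α i ≠ 0 := Finset.prod_ne_zero_iff.2 fun i _ => pow_ne_zero _ hδ0
  refine ⟨(∏ i, δ ^ α i)⁻¹ * torusCoeff F (fun i => (α i : ℤ)) fun _ => δ, fun z hz => ?_⟩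
  have hz1 : ∀ i, ‖z i‖ ≤ 1 := by
    intro i
    have h1 : ‖z i‖ ^ 2 ≤ ∑ j, ‖z j‖ ^ 2 :=
      Finset.single_le_sum (f := fun j => ‖z j‖ ^ 2) (fun j _ => by positivity) (Finset.mem_univ i)
    have h2 : ‖z i‖ ^ 2 ≤ 1 := h1.trans (le_of_lt hz)
    exact (sq_le_one_iff₀ (norm_nonneg _)).1 h2
  have h1 := torusCoeff_mul hF α hw hz1
  have h2 := torusCoeff_mul hF α hz (ζ := fun _ => δ) (fun _ => hδ1)
  rw [mul_comm z, h2] at h1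
  field_simp
  rw [mul_comm (torusCoeff F _ z)]
  rw [h1]
  ring

end TorusCoefficients

/-! ### Totality of the monomials -/

section Totality

variable {ι : Type*} [Fintype ι] {lam : ℝ}

/-- The normalizing constant of `e_α`. -/
def basisConst (lam : ℝ) (α : ι → ℕ) : ℝ :=
  Real.sqrt (Real.Gamma (Fintype.card ι + ∑ i, (α i : ℝ) + lam + 1) /
    ((∏ i, ((α i).factorial : ℝ)) * Real.Gamma (Fintype.card ι + lam + 1)))

theorem basisConst_pos (hlam : -1 < lam) (α : ι → ℕ) : 0 < basisConst lam α := by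
  have hN : (0 : ℝ) ≤ Fintype.card ι := Nat.cast_nonneg _
  have hA : (0 : ℝ) ≤ ∑ i, (α i : ℝ) := by positivity
  have hg2 : 0 < Real.Gamma (Fintype.card ι + lam + 1) := Real.Gamma_pos_of_pos (by linarith)
  have hg3 : 0 < Real.Gamma (Fintype.card ι + ∑ i, (α i : ℝ) + lam + 1) :=
    Real.Gamma_pos_of_pos (by linarith)
  have hfac : 0 < ∏ i, ((α i).factorial : ℝ) :=
    Finset.prod_pos fun i _ => by exact_mod_cast Nat.factorial_pos _
  unfold basisConst
  positivity

theorem basisFun_eq (lam : ℝ) (α : ι → ℕ) (z : ι → ℂ) :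
    basisFun lam α z = (basisConst lam α : ℂ) * ∏ i, z i ^ α i := rfl

theorem conj_torus_prod (α : ι → ℕ) (θ : UnitAddTorus ι) :
    (starRingEnd ℂ) ((∏ i, torusCircle θ i ^ α i : Circle) : ℂ) =
      UnitAddTorus.mFourier (-fun i => (α i : ℤ)) θ := by
  rw [UnitAddTorus.mFourier_neg]
  congr 1
  have : ((∏ i, torusCircle θ i ^ α i : Circle) : ℂ) = ∏ i, (torusCircle θ i : ℂ) ^ α i := by
    change Circle.coeHom _ = _
    rw [map_prod]
    refine Finset.prod_congr rfl fun i _ => ?_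
    rw [map_pow]
    rfl
  rw [this]
  simp only [UnitAddTorus.mFourier, ContinuousMap.coe_mk]
  refine Finset.prod_congr rfl fun i _ => ?_
  rw [fourier_apply, AddCircle.toCircle_zsmul, torusCircle, zpow_natCast, Circle.coe_pow]

theorem integral_basisFun_mul_conj (hlam : -1 < lam) (α : ι → ℕ) :
    ∫ z, basisFun lam α z * (starRingEnd ℂ) (basisFun lam α z) ∂(bergmanMeasure ι lam) = 1 := by
  have h1 := inner_basisVec hlam α (basisVec hlam α)
  rw [inner_self_eq_one_of_norm_eq_one ((orthonormal_basisVec hlam).1 α), fourierCoefficient] at h1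
  rw [h1]
  refine integral_congr_ae ?_
  filter_upwards [coeFn_basisVec hlam α] with z hz
  rw [hz]

/-- The basis functions form a total system in the Bergman space. -/
theorem eq_zero_of_fourierCoefficient_eq_zero (hlam : -1 < lam) (f : bergman ι lam)
    (h : ∀ α, fourierCoefficient lam f α = 0) : f = 0 := by
  have := isProbabilityMeasure_bergmanMeasure (ι := ι) hlam
  obtain ⟨F, hF⟩ := f.2
  have hC : ∀ α : ι → ℕ, ∀ z ∈ unitBall ι, torusCoeff F (fun i => (α i : ℤ)) z = 0 := by
    intro α
    obtain ⟨C, hC⟩ := exists_torusCoeff_eq hF.1 α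
    set G : (ι → ℂ) → ℂ := fun z => F z * (starRingEnd ℂ) (basisFun lam α z) with hG
    have hGe : (fun z => f.1 z * (starRingEnd ℂ) (basisFun lam α z)) =ᵐ[bergmanMeasure ι lam] G := by
      filter_upwards [hF.2] with z hz
      rw [hz]
    have hGi : Integrable G (bergmanMeasure ι lam) :=
      (integrable_mul_conj_basisFun hlam α f.1).congr hGe
    have hG0 : ∫ z, G z ∂(bergmanMeasure ι lam) = 0 := by
      rw [← integral_congr_ae hGe]
      exact h α
    -- Averaging over the torus replaces `F` by its component `C z^α`. Since `e_α` has norm one, the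
    -- vanishing coefficient becomes `C / basisConst lam α = 0`.
    have h1 := integral_average (bergmanMeasure ι lam) (torusMeasure ι)
      (continuous_uncurry_rot continuous_torusCircle).measurable
      (fun θ => measurePreserving_rot lam (torusCircle θ)) hGi
    rw [hG0, smul_zero] at h1
    have hκ := basisConst_pos hlam α
    have h2 : ∀ᵐ z ∂(bergmanMeasure ι lam), ∫ θ, G (rot (torusCircle θ) z) ∂(torusMeasure ι) =
        (C / basisConst lam α) * (basisFun lam α z * (starRingEnd ℂ) (basisFun lam α z)) := by
      filter_upwards [ae_mem_unitBall ι lam] with z hz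
      have h3 : ∀ θ, G (rot (torusCircle θ) z) = (starRingEnd ℂ) (basisFun lam α z) *
          (UnitAddTorus.mFourier (-fun i => (α i : ℤ)) θ * F (rot (torusCircle θ) z)) := by
        intro θ
        simp only [hG, basisFun_rot, map_mul, conj_torus_prod]
        ring
      simp only [h3]
      rw [integral_const_mul]
      have h4 := hC z hz
      rw [torusCoeff] at h4
      rw [h4, basisFun_eq lam α z]
      have : (basisConst lam α : ℂ) ≠ 0 := Complex.ofReal_ne_zero.2 hκ.ne'
      field_simp
    rw [integral_congr_ae h2, integral_const_mul, integral_basisFun_mul_conj hlam, mul_one] at h1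
    have hC0 : C = 0 := by
      have : (basisConst lam α : ℂ) ≠ 0 := Complex.ofReal_ne_zero.2 hκ.ne'
      rcases div_eq_zero_iff.1 h1 with h | h
      · exact h
      · exact absurd h this
    intro z hz
    rw [hC z hz, hC0, zero_mul]
  have hF0 : ∀ z ∈ unitBall ι, F z = 0 := by
    intro z hz
    refine eq_zero_of_torusCoeff_eq_zero hF.1 hz fun n => ?_
    -- Frequencies with a negative entry vanish for every holomorphic function; the others are
    -- multi-indices, covered by `hC`.
    by_cases hn : ∃ i, n i < 0
    · obtain ⟨i, hi⟩ := hn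
      exact torusCoeff_eq_zero hF.1 hi hz
    · push Not at hn
      have : n = fun i => ((n i).toNat : ℤ) := funext fun i => (Int.toNat_of_nonneg (hn i)).symm
      rw [this]
      exact hC _ z hz
  apply Subtype.ext
  refine Lp.ext (hF.2.trans ?_)
  refine Filter.EventuallyEq.trans ?_ (Lp.coeFn_zero ℂ 2 (bergmanMeasure ι lam)).symm
  filter_upwards [ae_mem_unitBall ι lam] with z hz
  exact hF0 z hz

/-- The orthonormal basis `(e_α)` of the Bergman space. -/
def bergmanBasis [CompleteSpace (bergman ι lam)] (hlam : -1 < lam) :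
    HilbertBasis (ι → ℕ) ℂ (bergman ι lam) :=
  HilbertBasis.mkOfOrthogonalEqBot (orthonormal_basisVec hlam) (by
    rw [Submodule.eq_bot_iff]
    intro f hf
    refine eq_zero_of_fourierCoefficient_eq_zero hlam f fun α => ?_
    rw [← inner_basisVec hlam]
    exact (Submodule.mem_orthogonal _ f).1 hf _ (Submodule.subset_span ⟨α, rfl⟩))

theorem coe_bergmanBasis [CompleteSpace (bergman ι lam)] (hlam : -1 < lam) :
    ⇑(bergmanBasis (ι := ι) hlam) = basisVec hlam :=
  HilbertBasis.coe_mkOfOrthogonalEqBot _ _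

theorem bergmanBasis_repr [CompleteSpace (bergman ι lam)] (hlam : -1 < lam) (f : bergman ι lam)
    (α : ι → ℕ) : (bergmanBasis hlam).repr f α = fourierCoefficient lam f α := by
  rw [HilbertBasis.repr_apply_apply, coe_bergmanBasis, inner_basisVec]

end Totality

/-! ### Bounded diagonal operators in an orthonormal basis -/

section Diagonal

variable {H : Type*} [NormedAddCommGroup H] [InnerProductSpace ℂ H] {I : Type*}
  (b : HilbertBasis I ℂ H)

theorem HilbertBasis.ext_inner {f g : H} (h : ∀ i, ⟪b i, f⟫_ℂ = ⟪b i, g⟫_ℂ) : f = g := by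
  apply b.repr.injective
  ext i
  rw [b.repr_apply_apply, b.repr_apply_apply, h]

theorem HilbertBasis.hasSum_norm_sq (f : H) : HasSum (fun i => ‖⟪b i, f⟫_ℂ‖ ^ 2) (‖f‖ ^ 2) := by
  have h := Complex.hasSum_re (b.hasSum_inner_mul_inner f f)
  rw [inner_self_eq_norm_sq_to_K] at h
  refine (h.congr_fun fun i => ?_).trans_eq ?_
  · rw [← inner_conj_symm f (b i), Complex.conj_mul', ← Complex.ofReal_pow, Complex.ofReal_re]
  · norm_cast

theorem HilbertBasis.exists_of_summable {c : I → ℂ} (hc : Summable fun i => ‖c i‖ ^ 2) :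
    ∃ g : H, ∀ i, ⟪b i, g⟫_ℂ = c i := by
  have hm : Memℓp c 2 := (memℓp_gen_iff (by norm_num)).2 (by simpa using hc)
  refine ⟨b.repr.symm ⟨c, hm⟩, fun i => ?_⟩
  rw [← b.repr_apply_apply, LinearIsometryEquiv.apply_symm_apply]

/-- The bounded operator that multiplies the coefficients in an orthonormal basis by the terms of a
bounded family. -/
def diagOp (c : I → ℂ) (hc : ∃ C, ∀ i, ‖c i‖ ≤ C) : H →L[ℂ] H :=
  have key : ∀ f : H, Summable fun i => ‖c i * ⟪b i, f⟫_ℂ‖ ^ 2 := fun f => by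
    obtain ⟨C, hC⟩ := hc
    refine Summable.of_nonneg_of_le (fun _ => by positivity) (fun i => ?_)
      ((b.hasSum_norm_sq f).summable.mul_left (C ^ 2))
    rw [norm_mul, mul_pow]
    gcongr
    exact hC i
  LinearMap.mkContinuousOfExistsBound
    { toFun := fun f => (b.exists_of_summable (key f)).choose
      map_add' := fun f g => by
        refine b.ext_inner fun i => ?_
        rw [inner_add_right, (b.exists_of_summable (key _)).choose_spec,
          (b.exists_of_summable (key _)).choose_spec, (b.exists_of_summable (key _)).choose_spec,
          inner_add_right, mul_add]
      map_smul' := fun a f => by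
        refine b.ext_inner fun i => ?_
        rw [RingHom.id_apply, inner_smul_right, (b.exists_of_summable (key _)).choose_spec,
          (b.exists_of_summable (key _)).choose_spec, inner_smul_right]
        ring }
    (by
      obtain ⟨C, hC⟩ := hc
      refine ⟨|C|, fun f => ?_⟩
      refine abs_le_of_sq_le_sq' ?_ (by positivity) |>.2
      rw [mul_pow, sq_abs]
      refine hasSum_le (fun i => ?_) (b.hasSum_norm_sq _) ((b.hasSum_norm_sq f).mul_left (C ^ 2))
      simp only [LinearMap.coe_mk, AddHom.coe_mk]
      rw [(b.exists_of_summable (key _)).choose_spec, norm_mul, mul_pow]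
      gcongr
      exact hC i)

variable {b}

theorem inner_diagOp {c : I → ℂ} (hc : ∃ C, ∀ i, ‖c i‖ ≤ C) (f : H) (i : I) :
    ⟪b i, diagOp b c hc f⟫_ℂ = c i * ⟪b i, f⟫_ℂ := by
  have key : Summable fun i => ‖c i * ⟪b i, f⟫_ℂ‖ ^ 2 := by
    obtain ⟨C, hC⟩ := hc
    refine Summable.of_nonneg_of_le (fun _ => by positivity) (fun i => ?_)
      ((b.hasSum_norm_sq f).summable.mul_left (C ^ 2))
    rw [norm_mul, mul_pow]
    gcongr
    exact hC i
  exact (b.exists_of_summable key).choose_spec i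

theorem eq_diagOp_iff {c : I → ℂ} (hc : ∃ C, ∀ i, ‖c i‖ ≤ C) {T : H →L[ℂ] H} :
    T = diagOp b c hc ↔ ∀ i, T (b i) = c i • b i := by
  classical
  have hb : ∀ i, diagOp b c hc (b i) = c i • b i := by
    intro i
    refine b.ext_inner fun j => ?_
    rw [inner_diagOp, inner_smul_right]
    by_cases hij : j = i
    · rw [hij]
    · rw [b.orthonormal.2 hij, mul_zero, mul_zero]
  constructor
  · rintro rfl
    exact hb
  · intro h
    refine ContinuousLinearMap.ext_on (s := Set.range b) ?_ ?_
    · exact Submodule.dense_iff_topologicalClosure_eq_top.2 b.dense_span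
    · rintro _ ⟨i, rfl⟩
      rw [h, hb]

theorem diagOp_basis {c : I → ℂ} (hc : ∃ C, ∀ i, ‖c i‖ ≤ C) (i : I) :
    diagOp b c hc (b i) = c i • b i :=
  (eq_diagOp_iff hc).1 rfl i

theorem hasSum_inner_diagOp {c : I → ℂ} (hc : ∃ C, ∀ i, ‖c i‖ ≤ C) (f : H) :
    HasSum (fun i => ((‖⟪b i, f⟫_ℂ‖ ^ 2 : ℝ) : ℂ) * c i) ⟪f, diagOp b c hc f⟫_ℂ := by
  refine (b.hasSum_inner_mul_inner f (diagOp b c hc f)).congr_fun fun i => ?_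
  rw [inner_diagOp, ← inner_conj_symm f (b i), mul_left_comm, Complex.conj_mul']
  push_cast
  ring

open Filter Topology in
-- Dominated convergence for the series of squared coefficients of the difference. The bound `C`,
-- uniform in `k` and `i`, gives the dominating series. This is the source of strong countable
-- additivity for the diagonal spectral measure.
theorem tendsto_diagOp {κ : Type*} {l : Filter κ} {c : κ → I → ℂ} (hc : ∀ k, ∃ C, ∀ i, ‖c k i‖ ≤ C)
    {c' : I → ℂ} (hc' : ∃ C, ∀ i, ‖c' i‖ ≤ C) {C : ℝ} (hC : ∀ k i, ‖c k i‖ ≤ C)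
    (h : ∀ i, Tendsto (fun k => c k i) l (𝓝 (c' i))) (f : H) :
    Tendsto (fun k => diagOp b (c k) (hc k) f) l (𝓝 (diagOp b c' hc' f)) := by
  obtain ⟨C', hC'⟩ := hc'
  have hnorm : ∀ k, ‖diagOp b (c k) (hc k) f - diagOp b c' ⟨C', hC'⟩ f‖ ^ 2 =
      ∑' i, (‖c k i - c' i‖ * ‖⟪b i, f⟫_ℂ‖) ^ 2 := by
    intro k
    rw [← (b.hasSum_norm_sq _).tsum_eq]
    refine tsum_congr fun i => ?_
    rw [inner_sub_right, inner_diagOp, inner_diagOp, ← sub_mul, norm_mul]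
  rw [tendsto_iff_norm_sub_tendsto_zero]
  have hsq : Tendsto (fun k => ‖diagOp b (c k) (hc k) f - diagOp b c' ⟨C', hC'⟩ f‖ ^ 2) l
      (𝓝 0) := by
    simp only [hnorm]
    have h0 : (0 : ℝ) = ∑' i : I, (‖c' i - c' i‖ * ‖⟪b i, f⟫_ℂ‖) ^ 2 := by simp
    rw [h0]
    refine tendsto_tsum_of_dominated_convergence
      (bound := fun i => (C + C') ^ 2 * ‖⟪b i, f⟫_ℂ‖ ^ 2)
      ((b.hasSum_norm_sq f).summable.mul_left _) (fun i => ?_) (Eventually.of_forall fun k i => ?_)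
    · exact ((((h i).sub_const (c' i)).norm).mul_const _).pow 2
    · rw [Real.norm_of_nonneg (by positivity), mul_pow]
      gcongr
      exact (norm_sub_le _ _).trans (add_le_add (hC k i) (hC' i))
  have := hsq.sqrt
  simpa [Real.sqrt_sq (norm_nonneg _)] using this

end Diagonal

/-! ### Spectral measure of a labelled orthonormal basis -/

section DiagonalSpectralMeasure

variable {H : Type*} [NormedAddCommGroup H] [InnerProductSpace ℂ H] {I : Type*}
  (b : HilbertBasis I ℂ H) {X : Type*} [MeasurableSpace X] (d : I → X)

open Classical in
/-- The family of `0`s and `1`s that selects the indices whose label lies in `s`. -/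
def selector (s : Set X) (i : I) : ℂ := if d i ∈ s then 1 else 0

omit [MeasurableSpace X] in
theorem selector_bounded (s : Set X) : ∀ i, ‖selector d s i‖ ≤ 1 := by
  intro i
  unfold selector
  split_ifs <;> simp

open Classical in
/-- The spectral measure attached to an orthonormal basis labelled by points of `X`. -/
def diagSpectralMeasure : SpectralMeasure X H where
  proj s := if MeasurableSet s then diagOp b (selector d s) ⟨1, selector_bounded d s⟩ else 0
  isProjection s hs := by
    simp only [if_pos hs]
    constructor
    · refine LinearMap.ext fun f => b.ext_inner fun i => ?_
      refine (inner_diagOp ⟨1, selector_bounded d s⟩ _ i).trans ?_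
      refine Eq.trans ?_ (inner_diagOp ⟨1, selector_bounded d s⟩ _ i).symm
      rw [ContinuousLinearMap.coe_coe, inner_diagOp]
      unfold selector
      split_ifs <;> simp
    · intro f g
      simp only [ContinuousLinearMap.coe_coe]
      refine (b.hasSum_inner_mul_inner _ g).unique
        ((b.hasSum_inner_mul_inner f _).congr_fun fun i => ?_)
      rw [inner_diagOp, ← inner_conj_symm _ (b i), inner_diagOp, map_mul, inner_conj_symm]
      unfold selector
      split_ifs <;> simp
  proj_empty := by
    rw [if_pos MeasurableSet.empty]
    refine ContinuousLinearMap.ext fun f => b.ext_inner fun i => ?_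
    rw [inner_diagOp]
    simp [selector]
  proj_univ := by
    rw [if_pos MeasurableSet.univ]
    refine ContinuousLinearMap.ext fun f => b.ext_inner fun i => ?_
    rw [inner_diagOp]
    simp [selector]
  proj_inter s t hs ht := by
    rw [if_pos hs, if_pos ht, if_pos (hs.inter ht)]
    refine ContinuousLinearMap.ext fun f => b.ext_inner fun i => ?_
    rw [ContinuousLinearMap.comp_apply, inner_diagOp, inner_diagOp, inner_diagOp]
    simp only [selector, Set.mem_inter_iff]
    split_ifs <;> simp_all
  hasSum_iUnion A hA hd f := by
    simp only [if_pos (hA _), if_pos (MeasurableSet.iUnion hA)]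
    -- By disjointness, finite sums of selectors are again selectors, hence bounded by `1`
    -- uniformly; the partial sums are then diagonal operators that converge strongly.
    have hsum : ∀ (F : Finset ℕ) (i : I), ∑ n ∈ F, selector d (A n) i =
        selector d (⋃ n ∈ F, A n) i := by
      intro F i
      by_cases h : ∃ n ∈ F, d i ∈ A n
      · obtain ⟨n, hn, hi⟩ := h
        rw [Finset.sum_eq_single_of_mem n hn]
        · rw [selector, selector, if_pos hi, if_pos (Set.mem_iUnion₂.2 ⟨n, hn, hi⟩)]
        · intro p _ hpn
          exact if_neg fun hp => Set.disjoint_left.1 (hd hpn) hp hi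
      · push Not at h
        rw [selector, if_neg (by simpa using h)]
        exact Finset.sum_eq_zero fun n hn => if_neg (h n hn)
    have heq : ∀ F : Finset ℕ, ∑ n ∈ F, diagOp b (selector d (A n)) ⟨1, selector_bounded d _⟩ f =
        diagOp b (selector d (⋃ n ∈ F, A n)) ⟨1, selector_bounded d _⟩ f := by
      intro F
      refine b.ext_inner fun i => ?_
      rw [inner_sum, inner_diagOp, ← hsum, Finset.sum_mul]
      exact Finset.sum_congr rfl fun n _ => inner_diagOp _ _ _
    rw [HasSum]
    simp only [heq]
    refine tendsto_diagOp _ _ (fun F => selector_bounded d _) (fun i => ?_) f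
    by_cases h : ∃ n, d i ∈ A n
    · obtain ⟨n, hi⟩ := h
      refine tendsto_const_nhds.congr' ?_
      filter_upwards [Filter.eventually_ge_atTop {n}] with F hF
      rw [selector, selector, if_pos (Set.mem_iUnion.2 ⟨n, hi⟩),
        if_pos (Set.mem_iUnion₂.2 ⟨n, hF (Finset.mem_singleton_self n), hi⟩)]
    · push Not at h
      refine tendsto_const_nhds.congr fun F => ?_
      rw [selector, selector, if_neg (by simpa using h), if_neg (by simp [h])]
  not_measurable s hs := if_neg hs

variable {b d}

theorem diagSpectralMeasure_proj {s : Set X} (hs : MeasurableSet s) :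
    (diagSpectralMeasure b d).proj s = diagOp b (selector d s) ⟨1, selector_bounded d s⟩ :=
  if_pos hs

theorem diagSpectralMeasure_proj_basis {s : Set X} (hs : MeasurableSet s) (i : I) :
    (diagSpectralMeasure b d).proj s (b i) = selector d s i • b i := by
  rw [diagSpectralMeasure_proj hs, diagOp_basis]

/-- Scalar spectral measures are sums of point masses at the labels, so integrals against them
become series over the basis. -/
theorem scalarMeasure_diagSpectralMeasure (f : H) : (diagSpectralMeasure b d).scalarMeasure f =
    Measure.sum fun i => ENNReal.ofReal (‖⟪b i, f⟫_ℂ‖ ^ 2) • Measure.dirac (d i) := by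
  ext s hs
  rw [SpectralMeasure.scalarMeasure_apply _ _ hs, Measure.sum_apply _ hs,
    diagSpectralMeasure_proj hs]
  have h := Complex.hasSum_re (hasSum_inner_diagOp (b := b) ⟨1, selector_bounded d s⟩ f)
  have hre : ∀ i, (((‖⟪b i, f⟫_ℂ‖ ^ 2 : ℝ) : ℂ) * selector d s i).re =
      ‖⟪b i, f⟫_ℂ‖ ^ 2 * s.indicator 1 (d i) := by
    intro i
    by_cases hi : d i ∈ s
    · rw [selector, if_pos hi, mul_one, Complex.ofReal_re, Set.indicator_of_mem hi, Pi.one_apply,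
        mul_one]
    · simp [selector, hi]
  simp only [hre] at h
  have hnn : ∀ i, 0 ≤ ‖⟪b i, f⟫_ℂ‖ ^ 2 * s.indicator (1 : X → ℝ) (d i) := fun i =>
    mul_nonneg (by positivity) (Set.indicator_nonneg (fun _ _ => zero_le_one) _)
  rw [← h.tsum_eq, ENNReal.ofReal_tsum_of_nonneg hnn h.summable]
  refine tsum_congr fun i => ?_
  rw [Measure.smul_apply, Measure.dirac_apply' _ hs, smul_eq_mul,
    ENNReal.ofReal_mul (by positivity)]
  by_cases hi : d i ∈ s <;> simp [hi]

variable [MeasurableSingletonClass X]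

theorem lintegral_scalarMeasure_diagSpectralMeasure (f : H) (g : X → ENNReal) :
    ∫⁻ x, g x ∂((diagSpectralMeasure b d).scalarMeasure f) =
      ∑' i, ENNReal.ofReal (‖⟪b i, f⟫_ℂ‖ ^ 2) * g (d i) := by
  rw [scalarMeasure_diagSpectralMeasure, lintegral_sum_measure]
  simp only [lintegral_smul_measure, lintegral_dirac, smul_eq_mul]

theorem tsum_ofReal_lt_top_iff {a : I → ℝ} (ha : ∀ i, 0 ≤ a i) :
    ∑' i, ENNReal.ofReal (a i) < ⊤ ↔ Summable a := by
  refine ⟨fun h => ?_, fun h => h.tsum_ofReal_lt_top⟩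
  have := ENNReal.summable_toReal h.ne
  simpa [ENNReal.toReal_ofReal, ha] using this

theorem lintegral_sq_lt_top_iff (f : H) (ψ : X → ℂ) :
    ∫⁻ x, ENNReal.ofReal (‖ψ x‖ ^ 2) ∂((diagSpectralMeasure b d).scalarMeasure f) < ⊤ ↔
      Summable fun i => ‖ψ (d i)‖ ^ 2 * ‖⟪b i, f⟫_ℂ‖ ^ 2 := by
  rw [lintegral_scalarMeasure_diagSpectralMeasure, ← tsum_ofReal_lt_top_iff fun i => by positivity]
  simp only [← ENNReal.ofReal_mul (sq_nonneg _), mul_comm]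

variable [Countable I]

theorem integral_scalarMeasure_diagSpectralMeasure (f : H) {ψ : X → ℂ}
    (h : Summable fun i => ‖⟪b i, f⟫_ℂ‖ ^ 2 * ‖ψ (d i)‖) :
    HasSum (fun i => ((‖⟪b i, f⟫_ℂ‖ ^ 2 : ℝ) : ℂ) * ψ (d i))
      (∫ x, ψ x ∂((diagSpectralMeasure b d).scalarMeasure f)) := by
  rw [scalarMeasure_diagSpectralMeasure]
  have hi : Integrable ψ (Measure.sum fun i =>
      ENNReal.ofReal (‖⟪b i, f⟫_ℂ‖ ^ 2) • Measure.dirac (d i)) := by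
    constructor
    · rw [aestronglyMeasurable_sum_measure_iff]
      intro i
      exact AEStronglyMeasurable.smul_measure aestronglyMeasurable_dirac _
    · rw [hasFiniteIntegral_iff_enorm, ← scalarMeasure_diagSpectralMeasure,
        lintegral_scalarMeasure_diagSpectralMeasure]
      simp only [← ofReal_norm, ← ENNReal.ofReal_mul (sq_nonneg _)]
      exact h.tsum_ofReal_lt_top
  refine (hasSum_integral_measure hi).congr_fun fun i => ?_
  rw [integral_smul_measure, integral_dirac, ENNReal.toReal_ofReal (by positivity),
    Complex.real_smul]

/-- A measurable set is null exactly when it contains no label. Countability of `I` makes the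
complement of the set of labels measurable, so it is the largest null set. -/
theorem diagSpectralMeasure_ae_iff {p : X → Prop} :
    (diagSpectralMeasure b d).AE p ↔ ∀ i, p (d i) := by
  constructor
  · rintro ⟨N, hN, h0, hp⟩ i
    refine hp _ fun hi => ?_
    have h1 := diagSpectralMeasure_proj_basis (b := b) (d := d) hN i
    rw [h0, selector, if_pos hi, one_smul] at h1
    exact b.orthonormal.ne_zero i h1.symm
  · intro h
    have hm : MeasurableSet (Set.range d)ᶜ := (Set.countable_range d).measurableSet.compl
    refine ⟨(Set.range d)ᶜ, hm, ?_, fun x hx => ?_⟩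
    · rw [diagSpectralMeasure_proj hm]
      refine ContinuousLinearMap.ext fun f => b.ext_inner fun i => ?_
      rw [inner_diagOp]
      simp [selector]
    · obtain ⟨i, rfl⟩ := not_not.1 hx
      exact h i

/-- The measure is carried by a countable set, and cutting a function off to a countable set makes
it measurable. -/
theorem diagSpectralMeasure_eMeasurable (ψ : X → ℂ) : (diagSpectralMeasure b d).EMeasurable ψ := by
  classical
  refine ⟨(Set.range d).indicator ψ, ?_, diagSpectralMeasure_ae_iff.2 fun i => ?_⟩
  · refine measurable_of_measurable_on_compl_countable (Set.range d) (Set.countable_range d) ?_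
    have : (Set.range d)ᶜ.domRestrict ((Set.range d).indicator ψ) = fun _ => 0 := by
      funext x
      exact Set.indicator_of_notMem x.2 ψ
    rw [this]
    exact measurable_const
  · rw [Set.indicator_of_mem (Set.mem_range_self i)]

theorem diagSpectralMeasure_essBounded_iff {ψ : X → ℂ} :
    (diagSpectralMeasure b d).EssBounded ψ ↔ ∃ C, ∀ i, ‖ψ (d i)‖ ≤ C := by
  simp only [SpectralMeasure.EssBounded, diagSpectralMeasure_ae_iff]

/-- On a complex space the quadratic form determines a bounded operator, and the form of the
diagonal operator is the integral of `ψ`. -/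
theorem diagSpectralMeasure_isIntegral_iff {ψ : X → ℂ} (hψ : ∃ C, ∀ i, ‖ψ (d i)‖ ≤ C)
    {T : H →L[ℂ] H} : (diagSpectralMeasure b d).IsIntegral ψ (boundedOp T) ↔
      T = diagOp b (fun i => ψ (d i)) hψ := by
  have hint : ∀ f : H, ⟪f, diagOp b (fun i => ψ (d i)) hψ f⟫_ℂ =
      ∫ x, ψ x ∂((diagSpectralMeasure b d).scalarMeasure f) := by
    intro f
    refine (hasSum_inner_diagOp hψ f).unique (integral_scalarMeasure_diagSpectralMeasure f ?_)
    obtain ⟨C, hC⟩ := hψ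
    refine Summable.of_nonneg_of_le (fun _ => by positivity) (fun i => ?_)
      ((b.hasSum_norm_sq f).summable.mul_right C)
    gcongr
    exact hC i
  constructor
  · rintro ⟨-, -, h⟩
    have hTm : (T : H →ₗ[ℂ] H) = (diagOp b (fun i => ψ (d i)) hψ : H →L[ℂ] H) := by
      rw [← ext_inner_map]
      intro f
      have h1 : ⟪f, T f⟫_ℂ = ∫ x, ψ x ∂((diagSpectralMeasure b d).scalarMeasure f) :=
        h ⟨f, trivial⟩
      rw [← hint] at h1
      have h2 := congrArg (starRingEnd ℂ) h1
      rwa [inner_conj_symm, inner_conj_symm] at h2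
    exact ContinuousLinearMap.coe_injective hTm
  · rintro rfl
    refine ⟨diagSpectralMeasure_eMeasurable ψ, fun f => ?_, fun f => hint f⟩
    rw [lintegral_sq_lt_top_iff]
    refine ⟨fun _ => ?_, fun _ => trivial⟩
    obtain ⟨C, hC⟩ := hψ
    refine Summable.of_nonneg_of_le (fun _ => by positivity) (fun i => ?_)
      ((b.hasSum_norm_sq f).summable.mul_left (C ^ 2))
    gcongr
    exact hC i

theorem diagSpectralMeasure_isIntegral {ψ : X → ℂ} {A : H →ₗ.[ℂ] H}
    (hdom : ∀ f, f ∈ A.domain ↔ Summable fun i => ‖ψ (d i)‖ ^ 2 * ‖⟪b i, f⟫_ℂ‖ ^ 2)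
    (hA : ∀ (f : A.domain) i, ⟪b i, A f⟫_ℂ = ψ (d i) * ⟪b i, (f : H)⟫_ℂ) :
    (diagSpectralMeasure b d).IsIntegral ψ A := by
  refine ⟨diagSpectralMeasure_eMeasurable ψ, fun f => by rw [hdom, lintegral_sq_lt_top_iff],
    fun f => ?_⟩
  have hs := (hdom f).1 f.2
  refine (b.hasSum_inner_mul_inner (f : H) (A f)).unique
    ((integral_scalarMeasure_diagSpectralMeasure (f : H) ?_).congr_fun fun i => ?_)
  · refine Summable.of_nonneg_of_le (fun _ => by positivity) (fun i => ?_)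
      ((b.hasSum_norm_sq (f : H)).summable.add hs)
    -- The estimate is `t ≤ 1 + t²` with `t = ‖ψ (d i)‖`: square integrability against a finite
    -- measure gives integrability.
    nlinarith [sq_nonneg (‖ψ (d i)‖ - 1), sq_nonneg ‖⟪b i, (f : H)⟫_ℂ‖, norm_nonneg (ψ (d i)),
      mul_nonneg (sq_nonneg (‖ψ (d i)‖ - 1)) (sq_nonneg ‖⟪b i, (f : H)⟫_ℂ‖),
      mul_nonneg (norm_nonneg (ψ (d i))) (sq_nonneg ‖⟪b i, (f : H)⟫_ℂ‖)]
  · rw [hA, ← inner_conj_symm (f : H) (b i), mul_left_comm, Complex.conj_mul']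
    push_cast
    ring

end DiagonalSpectralMeasure

/-! ### Uniqueness of the joint spectral measure -/

namespace SpectralMeasure

variable {H : Type*} [NormedAddCommGroup H] [InnerProductSpace ℂ H]
  {X : Type*} [MeasurableSpace X] (E : SpectralMeasure X H)

theorem proj_proj {s t : Set X} (hs : MeasurableSet s) (ht : MeasurableSet t) (f : H) :
    E.proj s (E.proj t f) = E.proj (s ∩ t) f := by
  rw [E.proj_inter s t hs ht, ContinuousLinearMap.comp_apply]

theorem inner_proj_left {s : Set X} (hs : MeasurableSet s) (f g : H) :
    ⟪E.proj s f, g⟫_ℂ = ⟪f, E.proj s g⟫_ℂ :=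
  (E.isProjection s hs).isSymmetric f g

theorem inner_proj_self {s : Set X} (hs : MeasurableSet s) (f : H) :
    ⟪f, E.proj s f⟫_ℂ = ((‖E.proj s f‖ ^ 2 : ℝ) : ℂ) := by
  have h := inner_self_eq_norm_sq_to_K (𝕜 := ℂ) (E.proj s f)
  rw [E.inner_proj_left hs, E.proj_proj hs hs, Set.inter_self] at h
  rw [h]
  norm_cast

theorem scalarMeasure_apply_eq {s : Set X} (hs : MeasurableSet s) (f : H) :
    E.scalarMeasure f s = ENNReal.ofReal (‖E.proj s f‖ ^ 2) := by
  rw [E.scalarMeasure_apply f hs, E.inner_proj_self hs, Complex.ofReal_re]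

instance (f : H) : IsFiniteMeasure (E.scalarMeasure f) :=
  ⟨by rw [E.scalarMeasure_apply_eq MeasurableSet.univ]; exact ENNReal.ofReal_lt_top⟩

theorem real_scalarMeasure {s : Set X} (hs : MeasurableSet s) (f : H) :
    (((E.scalarMeasure f).real s : ℝ) : ℂ) = ⟪f, E.proj s f⟫_ℂ := by
  rw [E.inner_proj_self hs, Measure.real, E.scalarMeasure_apply_eq hs,
    ENNReal.toReal_ofReal (by positivity)]

theorem scalarMeasure_proj {s : Set X} (hs : MeasurableSet s) (f : H) :
    E.scalarMeasure (E.proj s f) = (E.scalarMeasure f).restrict s := by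
  ext t ht
  rw [Measure.restrict_apply ht, E.scalarMeasure_apply_eq ht, E.scalarMeasure_apply_eq (ht.inter hs),
    E.proj_proj ht hs]

/-- Rotating the part of a vector outside a spectral subspace does not change its scalar spectral
measure. -/
theorem scalarMeasure_rotate {s : Set X} (hs : MeasurableSet s) (f : H) {c : ℂ}
    (hc : (starRingEnd ℂ) c * c = 1) :
    E.scalarMeasure (E.proj s f + c • (f - E.proj s f)) = E.scalarMeasure f := by
  ext t ht
  rw [E.scalarMeasure_apply _ ht, E.scalarMeasure_apply _ ht]
  congr 2
  have h1 : E.proj t (E.proj s f) = E.proj (t ∩ s) f := E.proj_proj ht hs f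
  have h2 : E.proj s (E.proj t f) = E.proj (t ∩ s) f := by
    rw [E.proj_proj hs ht, Set.inter_comm]
  have h3 : E.proj s (E.proj (t ∩ s) f) = E.proj (t ∩ s) f := by
    rw [E.proj_proj hs (ht.inter hs)]
    congr 2
    ext x
    simp only [Set.mem_inter_iff]
    tauto
  rw [map_add, map_smul, map_sub, h1]
  simp only [inner_add_left, inner_add_right, inner_smul_left, inner_smul_right, inner_sub_left,
    inner_sub_right, E.inner_proj_left hs, h2, h3]
  linear_combination (⟪f, E.proj t f⟫_ℂ - ⟪f, E.proj (t ∩ s) f⟫_ℂ) * hc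

variable {E}

/-- `IsIntegral` gives only the domain and the quadratic form of `A`, both in terms of scalar
measures. Split `f = u + w` along the projection of `s`. All `u + c • w` with `c` unimodular have
the scalar measure of `f`, so they lie in the domain and share one value of the form. This kills the
cross term `⟪u, A w⟫`, so that `⟪u, A f⟫ = ⟪u, A u⟫` is the integral over `s`; the eigenvalue
equation evaluates the left side. -/
theorem setIntegral_eq_of_eigenvector {φ : X → ℝ} {A : H →ₗ.[ℂ] H}
    (hA : E.IsIntegral (fun x => (φ x : ℂ)) A) (f : A.domain) {a : ℝ}
    (hf : A f = (a : ℂ) • (f : H)) {s : Set X} (hs : MeasurableSet s) :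
    ∫ x in s, φ x ∂(E.scalarMeasure (f : H)) = a * (E.scalarMeasure (f : H)).real s := by
  obtain ⟨-, hdom, hint⟩ := hA
  set u := E.proj s (f : H) with hu
  set w := (f : H) - u with hw
  have hmem : ∀ c : ℂ, (starRingEnd ℂ) c * c = 1 → u + c • w ∈ A.domain := by
    intro c hc
    rw [hdom, hu, hw, hu, E.scalarMeasure_rotate hs _ hc, ← hdom]
    exact f.2
  -- Half the sum of `f = u + w` and `u - w`.
  have hud : u ∈ A.domain := by
    have h1 := A.domain.smul_mem (1 / 2 : ℂ) (A.domain.add_mem f.2 (hmem (-1) (by simp)))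
    convert h1 using 1
    rw [hw]
    module
  have hwd : w ∈ A.domain := A.domain.sub_mem f.2 hud
  set U : A.domain := ⟨u, hud⟩ with hU
  set W : A.domain := ⟨w, hwd⟩ with hW
  have hq : ∀ c : ℂ, (starRingEnd ℂ) c * c = 1 →
      ⟪u, A U⟫_ℂ + c * ⟪u, A W⟫_ℂ + (starRingEnd ℂ) c * (⟪w, A U⟫_ℂ + c * ⟪w, A W⟫_ℂ) =
        ∫ x, (φ x : ℂ) ∂(E.scalarMeasure (f : H)) := by
    intro c hc
    have h1 := hint (U + c • W)
    have h2 : ((U + c • W : A.domain) : H) = u + c • w := rfl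
    rw [h2, hu, hw, hu, E.scalarMeasure_rotate hs _ hc, LinearPMap.map_add,
      LinearPMap.map_smul] at h1
    rw [← h1]
    simp only [inner_add_left, inner_add_right, inner_smul_left, inner_smul_right]
    rw [hw, hu]
    ring
  have e1 := hq 1 (by simp)
  have e2 := hq (-1) (by simp)
  have e3 := hq Complex.I (by simp)
  have e4 := hq (-Complex.I) (by simp)
  simp only [map_one, map_neg, Complex.conj_I] at e1 e2 e3 e4
  -- The form varies with `c` by `c ⟪u, A w⟫ + conj c ⟪w, A u⟫`; the values `±1` and `±i` isolate
  -- the first term.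
  have hy : ⟪u, A W⟫_ℂ = 0 := by
    linear_combination (1 / 4) * (e1 - e2) - (Complex.I / 4) * (e3 - e4) +
      (⟪u, A W⟫_ℂ - ⟪w, A U⟫_ℂ) / 2 * Complex.I_sq
  have hUW : U + W = f := by
    apply Subtype.ext
    change u + w = f
    rw [hw]
    abel
  have h1 : ⟪u, A f⟫_ℂ = ∫ x in s, (φ x : ℂ) ∂(E.scalarMeasure (f : H)) := by
    rw [← E.scalarMeasure_proj hs, ← hu]
    have h2 := hint U
    change ⟪u, A U⟫_ℂ = ∫ x, (φ x : ℂ) ∂(E.scalarMeasure u) at h2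
    rw [← h2, ← hUW, LinearPMap.map_add, inner_add_right, hy, add_zero]
  rw [hf, inner_smul_right, hu, E.inner_proj_left hs, ← E.real_scalarMeasure hs,
    integral_complex_ofReal] at h1
  exact_mod_cast h1.symm

/-- The scalar spectral measure of an eigenvector lives on the corresponding level set. -/
theorem scalarMeasure_ne_eq_zero_of_eigenvector {φ : X → ℝ} (hφ : Measurable φ) {A : H →ₗ.[ℂ] H}
    (hA : E.IsIntegral (fun x => (φ x : ℂ)) A) (f : A.domain) {a : ℝ}
    (hf : A f = (a : ℂ) • (f : H)) : E.scalarMeasure (f : H) {x | φ x ≠ a} = 0 := by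
  set μ := E.scalarMeasure (f : H) with hμ
  have hi : Integrable φ μ := by
    have hsq : ∫⁻ x, ENNReal.ofReal (φ x ^ 2) ∂μ < ⊤ := by
      have := (hA.2.1 f).1 f.2
      simpa [Complex.norm_real] using this
    have h2 : Integrable (fun x => φ x ^ 2) μ := by
      refine ⟨(hφ.pow_const 2).aestronglyMeasurable, ?_⟩
      rw [hasFiniteIntegral_iff_ofReal (Filter.Eventually.of_forall fun x => sq_nonneg _)]
      exact hsq
    refine ((integrable_const (1 : ℝ)).add h2).mono' hφ.aestronglyMeasurable
      (Filter.Eventually.of_forall fun x => ?_)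
    rw [Real.norm_eq_abs, Pi.add_apply]
    nlinarith [sq_nonneg (|φ x| - 1), sq_abs (φ x), abs_nonneg (φ x)]
  have hia : Integrable (fun x => φ x - a) μ := hi.sub (integrable_const a)
  -- An integrable function whose integral vanishes over every measurable set is zero almost
  -- everywhere.
  have h0 : ∀ s, MeasurableSet s → ∫ x in s, (φ x - a) ∂μ = 0 := by
    intro s hs
    rw [integral_sub hi.integrableOn (integrable_const a).integrableOn,
      setIntegral_eq_of_eigenvector hA f hf hs, setIntegral_const, smul_eq_mul]
    ring
  have hae := hia.ae_eq_zero_of_forall_setIntegral_eq_zero fun s hs _ => h0 s hs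
  have : {x | φ x ≠ a} = {x | ¬ (φ x - a = (0 : X → ℝ) x)} := by
    ext x
    simp [sub_eq_zero]
  rw [this]
  exact hae

variable (E) in
-- If the scalar measure is concentrated at `x`, a projection either kills `f`, when `x ∉ s`, or
-- preserves its norm, when `x ∈ s`; an orthogonal projection that preserves the norm of a vector
-- fixes it.
theorem proj_apply_of_scalarMeasure_compl_eq_zero {f : H} {x : X}
    (h : E.scalarMeasure f {x}ᶜ = 0) {s : Set X} (hs : MeasurableSet s) :
    E.proj s f = s.indicator (fun _ => f) x := by
  have hzero : ∀ t, MeasurableSet t → x ∉ t → E.proj t f = 0 := by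
    intro t ht hxt
    have h1 : E.scalarMeasure f t = 0 :=
      measure_mono_null (Set.subset_compl_singleton_iff.2 hxt) h
    rw [E.scalarMeasure_apply_eq ht, ENNReal.ofReal_eq_zero] at h1
    have h2 : ‖E.proj t f‖ = 0 := by nlinarith [norm_nonneg (E.proj t f)]
    exact norm_eq_zero.1 h2
  by_cases hxs : x ∈ s
  · rw [Set.indicator_of_mem hxs]
    have h1 : E.scalarMeasure f s = E.scalarMeasure f Set.univ := by
      rw [← measure_add_measure_compl hs,
        measure_mono_null (Set.compl_subset_compl.2 (Set.singleton_subset_iff.2 hxs)) h, add_zero]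
    rw [E.scalarMeasure_apply_eq hs, E.scalarMeasure_apply_eq MeasurableSet.univ, E.proj_univ,
      ENNReal.ofReal_eq_ofReal_iff (by positivity) (by positivity)] at h1
    have h2 : ⟪f, E.proj s f⟫_ℂ = ((‖f‖ ^ 2 : ℝ) : ℂ) := by
      rw [E.inner_proj_self hs, h1]
      rfl
    have h3 : ‖E.proj s f - f‖ ^ 2 = 0 := by
      rw [← Complex.ofReal_inj]
      have h4 := inner_self_eq_norm_sq_to_K (𝕜 := ℂ) (E.proj s f - f)
      rw [inner_sub_left, inner_sub_right, inner_sub_right, E.inner_proj_left hs,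
        E.inner_proj_left hs, E.proj_proj hs hs, Set.inter_self, h2,
        inner_self_eq_norm_sq_to_K] at h4
      push_cast
      refine Eq.trans h4.symm ?_
      push_cast
      simp
    exact sub_eq_zero.1 (norm_eq_zero.1 (pow_eq_zero_iff two_ne_zero |>.1 h3))
  · rw [Set.indicator_of_notMem hxs, hzero s hs hxs]

theorem ext_proj {E E' : SpectralMeasure X H} (h : ∀ s, MeasurableSet s → E.proj s = E'.proj s) :
    E = E' := by
  have hp : E.proj = E'.proj := by
    funext s
    by_cases hs : MeasurableSet s
    · exact h s hs
    · rw [E.not_measurable s hs, E'.not_measurable s hs]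
  cases E
  cases E'
  cases hp
  rfl

end SpectralMeasure

/-- A tuple of operators diagonalized by an orthonormal basis has at most one joint spectral
measure. -/
theorem IsJointSpectralMeasure.eq_diagSpectralMeasure {H : Type*} [NormedAddCommGroup H]
    [InnerProductSpace ℂ H] {I : Type*} {b : HilbertBasis I ℂ H} {m : ℕ} {d : I → Fin m → ℝ}
    {V : Fin m → H →ₗ.[ℂ] H} (hdom : ∀ j i, b i ∈ (V j).domain)
    (hV : ∀ j i, V j ⟨b i, hdom j i⟩ = (d i j : ℂ) • b i)
    {E : SpectralMeasure (Fin m → ℝ) H} (hE : IsJointSpectralMeasure V E) :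
    E = diagSpectralMeasure b d := by
  refine SpectralMeasure.ext_proj fun s hs => ?_
  rw [diagSpectralMeasure_proj hs, eq_diagOp_iff]
  intro i
  have h0 : E.scalarMeasure (b i) {d i}ᶜ = 0 := by
    -- A point different from the label differs in some coordinate, and each coordinate is fixed
    -- almost everywhere by the eigenvalue of the corresponding operator.
    have hsub : ({d i}ᶜ : Set (Fin m → ℝ)) ⊆ ⋃ j, {η | η j ≠ d i j} := by
      intro η hη
      obtain ⟨j, hj⟩ := Function.ne_iff.1 hη
      exact Set.mem_iUnion.2 ⟨j, hj⟩
    refine measure_mono_null hsub (measure_iUnion_null fun j => ?_)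
    exact SpectralMeasure.scalarMeasure_ne_eq_zero_of_eigenvector (measurable_pi_apply j) (hE j)
      ⟨b i, hdom j i⟩ (hV j i)
  rw [E.proj_apply_of_scalarMeasure_compl_eq_zero h0 hs]
  by_cases hi : d i ∈ s <;> simp [selector, hi]

/-! ### The Euler field as the generator of block scaling -/

section Euler

variable {m : ℕ} {k : Fin m → ℕ}

/-- Multiplication of the coordinates of the `j`-th group by `ζ`. -/
def blockScale (j : Fin m) (ζ : ℂ) (z : Coord k → ℂ) : Coord k → ℂ :=
  fun i => if i.1 = j then ζ * z i else z i

/-- The part of `z` that lies in the `j`-th group of coordinates. -/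
def blockPart (j : Fin m) (z : Coord k → ℂ) : Coord k → ℂ := fun i => if i.1 = j then z i else 0

theorem eulerDeriv_eq (j : Fin m) (F : (Coord k → ℂ) → ℂ) (z : Coord k → ℂ) :
    eulerDeriv k j F z = fderiv ℂ F z (blockPart j z) := by
  have h : blockPart j z = ∑ l : Fin (k j), z ⟨j, l⟩ • (Pi.single (⟨j, l⟩ : Coord k) (1 : ℂ)) := by
    funext i
    obtain ⟨j', l'⟩ := i
    rw [Finset.sum_apply]
    by_cases hj : j' = j
    · subst hj
      rw [Finset.sum_eq_single l']
      · simp [blockPart]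
      · intro l _ hl
        have : (⟨j', l'⟩ : Coord k) ≠ ⟨j', l⟩ := fun h => hl (by simpa using h.symm)
        simp [Pi.single_eq_of_ne this]
      · simp
    · rw [blockPart, if_neg hj]
      refine (Finset.sum_eq_zero fun l _ => ?_).symm
      have : (⟨j', l'⟩ : Coord k) ≠ ⟨j, l⟩ := fun h => hj (congrArg Sigma.fst h)
      simp [Pi.single_eq_of_ne this]
  rw [h, map_sum, eulerDeriv]
  simp only [map_smul, smul_eq_mul]

theorem hasDerivAt_blockScale (j : Fin m) (z : Coord k → ℂ) (ζ : ℂ) :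
    HasDerivAt (fun ζ => blockScale j ζ z) (blockPart j z) ζ := by
  refine hasDerivAt_pi.2 fun i => ?_
  by_cases hi : i.1 = j
  · simp only [blockScale, blockPart, if_pos hi]
    simpa using (hasDerivAt_id ζ).mul_const (z i)
  · simp only [blockScale, blockPart, if_neg hi]
    exact hasDerivAt_const ζ (z i)

theorem blockPart_blockScale (j : Fin m) (ζ : ℂ) (z : Coord k → ℂ) :
    blockPart j (blockScale j ζ z) = ζ • blockPart j z := by
  funext i
  by_cases hi : i.1 = j <;> simp [blockPart, blockScale, hi]

theorem blockScale_one (j : Fin m) (z : Coord k → ℂ) : blockScale j 1 z = z := by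
  funext i
  simp [blockScale]

theorem hasDerivAt_comp_blockScale {j : Fin m} {F : (Coord k → ℂ) → ℂ} {z : Coord k → ℂ} {ζ : ℂ}
    (hF : DifferentiableAt ℂ F (blockScale j ζ z)) :
    HasDerivAt (fun ζ => F (blockScale j ζ z)) (fderiv ℂ F (blockScale j ζ z) (blockPart j z)) ζ :=
  hF.hasFDerivAt.comp_hasDerivAt ζ (hasDerivAt_blockScale j z ζ)

theorem basisFun_blockScale (lam : ℝ) (α : Coord k → ℕ) (j : Fin m) (ζ : ℂ) (z : Coord k → ℂ) :
    basisFun lam α (blockScale j ζ z) = ζ ^ groupDegree α j * basisFun lam α z := by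
  have h : ∏ i, blockScale j ζ z i ^ α i = ζ ^ groupDegree α j * ∏ i, z i ^ α i := by
    have h1 : ∀ i, blockScale j ζ z i ^ α i = (if i.1 = j then ζ ^ α i else 1) * z i ^ α i := by
      intro i
      by_cases hi : i.1 = j <;> simp [blockScale, hi, mul_pow]
    simp only [h1, Finset.prod_mul_distrib]
    congr 1
    rw [Fintype.prod_sigma, Finset.prod_eq_single j]
    · simp [groupDegree, Finset.prod_pow_eq_pow_sum]
    · intro j' _ hj'
      simp [hj']
    · simp
  rw [basisFun_eq, basisFun_eq, h]
  ring

/-- Euler's identity: differentiate the homogeneity under block scaling at `ζ = 1`. -/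
theorem eulerDeriv_basisFun (lam : ℝ) (α : Coord k → ℕ) (j : Fin m) (z : Coord k → ℂ) :
    eulerDeriv k j (basisFun lam α) z = (groupDegree α j : ℂ) * basisFun lam α z := by
  have h1 := hasDerivAt_comp_blockScale (j := j) (z := z) (ζ := 1)
    (differentiable_basisFun lam α _)
  simp only [basisFun_blockScale] at h1
  have h2 := (hasDerivAt_pow (groupDegree α j) (1 : ℂ)).mul_const (basisFun lam α z)
  rw [eulerDeriv_eq]
  have h3 := h1.unique h2
  rw [blockScale_one] at h3
  rw [h3]
  simp

/-- The unimodular numbers that rotate the `j`-th group of coordinates by the angle `θ`. -/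
def blockCircle (j : Fin m) (θ : ℝ) : Coord k → Circle :=
  fun i => if i.1 = j then Circle.exp θ else 1

theorem continuous_blockCircle (j : Fin m) :
    Continuous (blockCircle j : ℝ → Coord k → Circle) := by
  refine continuous_pi fun i => ?_
  unfold blockCircle
  by_cases hi : i.1 = j
  · simp only [if_pos hi]
    fun_prop
  · simp only [if_neg hi]
    fun_prop

theorem rot_blockCircle (j : Fin m) (θ : ℝ) (z : Coord k → ℂ) :
    rot (blockCircle j θ) z = blockScale j (Complex.exp (θ * Complex.I)) z := by
  funext i
  by_cases hi : i.1 = j <;> simp [rot, blockCircle, blockScale, hi, Circle.coe_exp]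

/-- Up to the factor `i`, the integrand is the `θ`-derivative of the `2π`-periodic function `F(rot_θ
z) e^{-iaθ}`. -/
theorem integral_eulerDeriv_sub {j : Fin m} {F : (Coord k → ℂ) → ℂ}
    (hF : DifferentiableOn ℂ F (unitBall (Coord k))) {z : Coord k → ℂ}
    (hz : z ∈ unitBall (Coord k)) (a : ℕ) :
    ∫ θ in Set.Ioc 0 (2 * Real.pi), (eulerDeriv k j F (rot (blockCircle j θ) z) -
      a * F (rot (blockCircle j θ) z)) * Complex.exp (-(a * (θ * Complex.I))) = 0 := by
  set Ω : Set ℂ := {ζ | blockScale j ζ z ∈ unitBall (Coord k)} with hΩ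
  have hcs : Continuous fun ζ : ℂ => blockScale j ζ z :=
    continuous_iff_continuousAt.2 fun ζ => (hasDerivAt_blockScale j z ζ).continuousAt
  have hΩo : IsOpen Ω := (isOpen_unitBall _).preimage hcs
  set S : ℂ → ℂ := fun ζ => F (blockScale j ζ z) with hS
  have hSd : ∀ ζ ∈ Ω, HasDerivAt S (fderiv ℂ F (blockScale j ζ z) (blockPart j z)) ζ :=
    fun ζ hζ => hasDerivAt_comp_blockScale (hF.differentiableAt ((isOpen_unitBall _).mem_nhds hζ))
  have hSdiff : DifferentiableOn ℂ S Ω := fun ζ hζ =>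
    (hSd ζ hζ).differentiableAt.differentiableWithinAt
  have hS'c : ContinuousOn (deriv S) Ω := (hSdiff.deriv hΩo).continuousOn
  have hmem : ∀ θ : ℝ, Complex.exp (θ * Complex.I) ∈ Ω := by
    intro θ
    change blockScale j _ z ∈ unitBall (Coord k)
    rw [← rot_blockCircle]
    exact (rot_mem_unitBall _).2 hz
  have hexp : Continuous fun θ : ℝ => Complex.exp (θ * Complex.I) := by fun_prop
  have hc1 : Continuous fun θ : ℝ => deriv S (Complex.exp (θ * Complex.I)) :=
    hS'c.comp_continuous hexp hmem
  have hc2 : Continuous fun θ : ℝ => S (Complex.exp (θ * Complex.I)) :=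
    hSdiff.continuousOn.comp_continuous hexp hmem
  have heul : ∀ θ : ℝ, eulerDeriv k j F (rot (blockCircle j θ) z) =
      Complex.exp (θ * Complex.I) * deriv S (Complex.exp (θ * Complex.I)) := by
    intro θ
    rw [rot_blockCircle, eulerDeriv_eq, blockPart_blockScale, map_smul, smul_eq_mul,
      (hSd _ (hmem θ)).deriv]
  have hval : ∀ θ : ℝ, F (rot (blockCircle j θ) z) = S (Complex.exp (θ * Complex.I)) := by
    intro θ
    rw [rot_blockCircle]
  simp only [heul, hval]
  have hder : ∀ θ : ℝ, HasDerivAt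
      (fun θ : ℝ => S (Complex.exp (θ * Complex.I)) * Complex.exp (-(a * (θ * Complex.I))))
      (Complex.I * ((Complex.exp (θ * Complex.I) * deriv S (Complex.exp (θ * Complex.I)) -
        a * S (Complex.exp (θ * Complex.I))) * Complex.exp (-(a * (θ * Complex.I))))) θ := by
    intro θ
    have h0 : HasDerivAt (fun θ : ℝ => (θ : ℂ) * Complex.I) Complex.I θ := by
      simpa using (Complex.ofRealCLM.hasDerivAt (x := θ)).mul_const Complex.I
    have h1 := h0.cexp
    have h2 : HasDerivAt (fun θ : ℝ => S (Complex.exp (θ * Complex.I)))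
        (deriv S (Complex.exp (θ * Complex.I)) * (Complex.exp (θ * Complex.I) * Complex.I)) θ := by
      have h4 := (hSd _ (hmem θ)).differentiableAt.hasDerivAt
      exact h4.comp θ h1
    have h3 : HasDerivAt (fun θ : ℝ => Complex.exp (-(a * (θ * Complex.I))))
        (Complex.exp (-(a * (θ * Complex.I))) * -(a * Complex.I)) θ :=
      ((h0.const_mul (a : ℂ)).neg).cexp
    exact (h2.mul h3).congr_deriv (by ring)
  have hftc := intervalIntegral.integral_eq_sub_of_hasDerivAt (a := 0) (b := 2 * Real.pi)
    (fun θ _ => hder θ) (by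
      refine Continuous.intervalIntegrable (continuous_const.mul
        (((hexp.mul hc1).sub (continuous_const.mul hc2)).mul ?_)) _ _
      fun_prop)
  rw [intervalIntegral.integral_of_le (by positivity), integral_const_mul] at hftc
  have hend : S (Complex.exp (((2 * Real.pi : ℝ) : ℂ) * Complex.I)) *
      Complex.exp (-(a * (((2 * Real.pi : ℝ) : ℂ) * Complex.I))) -
      S (Complex.exp (((0 : ℝ) : ℂ) * Complex.I)) * Complex.exp (-(a * (((0 : ℝ) : ℂ) * Complex.I)))
      = 0 := by
    rw [Complex.exp_neg, Complex.exp_nat_mul, Complex.exp_neg, Complex.exp_nat_mul]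
    push_cast
    rw [Complex.exp_two_pi_mul_I]
    simp
  rw [hend] at hftc
  exact (mul_eq_zero.1 hftc).resolve_left Complex.I_ne_zero

end Euler

/-! ### Rotation operators in the monomial basis -/

section RotationOperator

variable {m : ℕ} {k : Fin m → ℕ} {lam : ℝ}

/-- Averaging over rotations of block `j` reduces the claim to a vanishing integral on each orbit, a
compact subset of the ball. No integration by parts near the boundary is needed. -/
theorem fourierCoefficient_of_eulerDeriv (hlam : -1 < lam) {j : Fin m}
    {f g : bergman (Coord k) lam} {F : (Coord k → ℂ) → ℂ} (hF : IsHolRep lam f.1 F)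
    (hg : g.1 =ᵐ[bergmanMeasure (Coord k) lam] eulerDeriv k j F) (α : Coord k → ℕ) :
    fourierCoefficient lam g α = (groupDegree α j : ℂ) * fourierCoefficient lam f α := by
  have := isProbabilityMeasure_bergmanMeasure (ι := Coord k) hlam
  set a := groupDegree α j with ha
  set G : (Coord k → ℂ) → ℂ := fun z =>
    (eulerDeriv k j F z - a * F z) * (starRingEnd ℂ) (basisFun lam α z) with hG
  have hGe : (fun z => g.1 z * (starRingEnd ℂ) (basisFun lam α z) -
      a * (f.1 z * (starRingEnd ℂ) (basisFun lam α z))) =ᵐ[bergmanMeasure (Coord k) lam] G := by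
    filter_upwards [hF.2, hg] with z h1 h2
    rw [h1, h2, hG]
    ring
  have hig := integrable_mul_conj_basisFun hlam α g.1
  have hif := (integrable_mul_conj_basisFun hlam α f.1).const_mul (a : ℂ)
  have hGi : Integrable G (bergmanMeasure (Coord k) lam) := (hig.sub hif).congr hGe
  have havg := integral_average (bergmanMeasure (Coord k) lam)
    (volume.restrict (Set.Ioc (0 : ℝ) (2 * Real.pi)))
    (continuous_uncurry_rot (continuous_blockCircle j)).measurable
    (fun θ => measurePreserving_rot lam (blockCircle j θ)) hGi
  have h0 : ∀ᵐ z ∂(bergmanMeasure (Coord k) lam),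
      ∫ θ in Set.Ioc 0 (2 * Real.pi), G (rot (blockCircle j θ) z) = 0 := by
    filter_upwards [ae_mem_unitBall (Coord k) lam] with z hz
    have h1 : ∀ θ : ℝ, G (rot (blockCircle j θ) z) = (starRingEnd ℂ) (basisFun lam α z) *
        ((eulerDeriv k j F (rot (blockCircle j θ) z) - a * F (rot (blockCircle j θ) z)) *
          Complex.exp (-(a * (θ * Complex.I)))) := by
      intro θ
      have h2 : (starRingEnd ℂ) (basisFun lam α (rot (blockCircle j θ) z)) =
          Complex.exp (-(a * (θ * Complex.I))) * (starRingEnd ℂ) (basisFun lam α z) := by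
        rw [rot_blockCircle, basisFun_blockScale, map_mul, ← Complex.exp_nat_mul,
          ← Complex.exp_conj]
        simp [ha]
      rw [hG]
      simp only
      rw [h2]
      ring
    simp only [h1]
    rw [integral_const_mul, integral_eulerDeriv_sub hF.1 hz, mul_zero]
  rw [integral_congr_ae h0, integral_zero] at havg
  have h2 : (volume.restrict (Set.Ioc (0 : ℝ) (2 * Real.pi))).real Set.univ ≠ 0 := by
    simp [Measure.real, Real.pi_pos.le, Real.pi_ne_zero]
  have h3 := (smul_eq_zero.1 havg.symm).resolve_left h2
  rw [← integral_congr_ae hGe, integral_sub hig hif, integral_const_mul] at h3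
  exact sub_eq_zero.1 h3

theorem isHolRep_finset_sum (hlam : -1 < lam) (c : (Coord k → ℕ) → ℂ)
    (s : Finset (Coord k → ℕ)) : IsHolRep lam (∑ α ∈ s, c α • basisVec hlam α : bergman (Coord k) lam).1
      (∑ α ∈ s, c α • basisFun lam α) := by
  classical
  induction s using Finset.induction_on with
  | empty => exact IsHolRep.zero lam
  | insert α s hα ih =>
    rw [Finset.sum_insert hα, Finset.sum_insert hα]
    exact ((isHolRep_basisVec hlam α).smul (c α)).add ih

theorem eulerDeriv_finset_sum (j : Fin m) (c : (Coord k → ℕ) → ℂ) (s : Finset (Coord k → ℕ))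
    (z : Coord k → ℂ) : eulerDeriv k j (∑ α ∈ s, c α • basisFun lam α) z =
      (∑ α ∈ s, ((groupDegree α j : ℂ) * c α) • basisFun lam α) z := by
  have hd : ∀ α, DifferentiableAt ℂ (basisFun lam α) z := fun α => differentiable_basisFun lam α z
  rw [eulerDeriv_eq, fderiv_sum fun α _ => (hd α).const_smul (c α), Finset.sum_apply,
    _root_.sum_apply]
  refine Finset.sum_congr rfl fun α _ => ?_
  rw [fderiv_const_smul (hd α), _root_.smul_apply, ← eulerDeriv_eq,
    eulerDeriv_basisFun, Pi.smul_apply, smul_eq_mul, smul_eq_mul]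
  ring

open Filter Topology in
-- The Euler derivative of each partial sum of `f` is the partial sum of `g`. Norm convergence gives
-- pointwise convergence of derivatives for `f` and of values for `g`, so the identity passes to the
-- limit at every point of the ball.
theorem mem_rotationGraph_of_coefficients (hlam : -1 < lam) {j : Fin m}
    {f g : bergman (Coord k) lam}
    (h : ∀ α, fourierCoefficient lam g α = (groupDegree α j : ℂ) * fourierCoefficient lam f α) :
    (f, g) ∈ rotationGraph k lam j := by
  have := completeSpace_bergman (ι := Coord k) hlam
  obtain ⟨F, hF⟩ := f.2
  obtain ⟨G, hG⟩ := g.2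
  refine ⟨F, hF, hG.2.trans ?_⟩
  have hsum : ∀ f : bergman (Coord k) lam,
      Tendsto (fun s : Finset (Coord k → ℕ) =>
        (∑ α ∈ s, fourierCoefficient lam f α • basisVec hlam α : bergman (Coord k) lam).1)
        atTop (𝓝 f.1) := by
    intro f
    have h1 := (bergmanBasis hlam).hasSum_repr f
    simp only [bergmanBasis_repr, coe_bergmanBasis] at h1
    exact (continuous_subtype_val.tendsto f).comp h1
  filter_upwards [ae_mem_unitBall (Coord k) lam] with z hz
  have h1 := (tendsto_fderiv_of_isHolRep hlam
    (fun s => isHolRep_finset_sum hlam (fourierCoefficient lam f) s) hF (hsum f) hz).2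
  have h2 := (tendsto_fderiv_of_isHolRep hlam
    (fun s => isHolRep_finset_sum hlam (fourierCoefficient lam g) s) hG (hsum g) hz).1
  have h3 := ((ContinuousLinearMap.apply ℂ ℂ (blockPart j z)).continuous.tendsto _).comp h1
  refine tendsto_nhds_unique h2 (Tendsto.congr (fun s => ?_) (h3.trans_eq ?_))
  · have h4 := eulerDeriv_finset_sum (lam := lam) j (fourierCoefficient lam f) s z
    simp only [← h] at h4
    rw [← h4, eulerDeriv_eq]
    rfl
  · rw [eulerDeriv_eq]
    rfl

theorem rotationOp_graph (hlam : -1 < lam) (j : Fin m) :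
    (rotationOp k lam j).graph = rotationGraph k lam j :=
  Submodule.toLinearPMap_graph_eq _ (rotationGraph_single_valued k lam hlam j)

/-- The coefficients of `V_(j) f` are square summable by Parseval. Conversely, square summability of
the multiplied sequence produces the candidate for `V_(j) f`. -/
theorem mem_domain_rotationOp_iff (hlam : -1 < lam) (j : Fin m) (f : bergman (Coord k) lam) :
    f ∈ (rotationOp k lam j).domain ↔ Summable (fun α : Coord k → ℕ =>
      (groupDegree α j : ℝ) ^ 2 * ‖fourierCoefficient lam f α‖ ^ 2) := by
  have := completeSpace_bergman (ι := Coord k) hlam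
  have hnorm : ∀ (c : ℂ) (n : ℕ), ‖(n : ℂ) * c‖ ^ 2 = (n : ℝ) ^ 2 * ‖c‖ ^ 2 := by
    intro c n
    rw [norm_mul, mul_pow, Complex.norm_natCast]
  rw [LinearPMap.mem_domain_iff, rotationOp_graph hlam]
  constructor
  · rintro ⟨g, F, hF, hg⟩
    have h1 := ((bergmanBasis hlam).hasSum_norm_sq g).summable
    simp only [coe_bergmanBasis, inner_basisVec, fourierCoefficient_of_eulerDeriv hlam hF hg,
      hnorm] at h1
    exact h1
  · intro h
    simp only [← hnorm] at h
    obtain ⟨g, hg⟩ := (bergmanBasis hlam).exists_of_summable h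
    refine ⟨g, mem_rotationGraph_of_coefficients hlam fun α => ?_⟩
    rw [← hg α, coe_bergmanBasis, inner_basisVec]

theorem fourierCoefficient_rotationOp (hlam : -1 < lam) (j : Fin m)
    (f : (rotationOp k lam j).domain) (α : Coord k → ℕ) :
    fourierCoefficient lam (rotationOp k lam j f) α =
      (groupDegree α j : ℂ) * fourierCoefficient lam (f : bergman (Coord k) lam) α := by
  have h := LinearPMap.mem_graph (rotationOp k lam j) f
  rw [rotationOp_graph hlam] at h
  obtain ⟨F, hF, hg⟩ := h
  exact fourierCoefficient_of_eulerDeriv hlam hF hg α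

theorem bergman.inner_smul_right {ι : Type*} [Fintype ι] (f g : bergman ι lam) (c : ℂ) :
    ⟪f, c • g⟫_ℂ = c * ⟪f, g⟫_ℂ :=
  _root_.inner_smul_right (𝕜 := ℂ) (E := bergman ι lam) f g c

theorem basisVec_mem_domain_rotationOp (hlam : -1 < lam) (j : Fin m) (α : Coord k → ℕ) :
    basisVec hlam α ∈ (rotationOp k lam j).domain := by
  rw [mem_domain_rotationOp_iff hlam]
  refine summable_of_ne_finset_zero (s := {α}) fun β hβ => ?_
  have hβ : β ≠ α := by simpa using hβ
  rw [← inner_basisVec hlam, (orthonormal_basisVec hlam).2 hβ]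
  simp

theorem rotationOp_basisVec (hlam : -1 < lam) (j : Fin m) (α : Coord k → ℕ) :
    rotationOp k lam j ⟨basisVec hlam α, basisVec_mem_domain_rotationOp hlam j α⟩ =
      (groupDegree α j : ℂ) • basisVec hlam α := by
  classical
  have := completeSpace_bergman (ι := Coord k) hlam
  refine (bergmanBasis hlam).ext_inner fun β => ?_
  rw [bergman.inner_smul_right]
  rw [coe_bergmanBasis, inner_basisVec, fourierCoefficient_rotationOp hlam, ← inner_basisVec hlam]
  by_cases hβ : β = α
  · rw [hβ]
  · rw [(orthonormal_basisVec hlam).2 hβ, mul_zero, mul_zero]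

/-- The point of `ℝᵐ` formed by the group degrees of a multi-index. -/
def degreePt (α : Coord k → ℕ) : Fin m → ℝ := latticePt (groupDegree α)

/-- The joint spectral measure of the rotation operators. -/
def rotationSpectralMeasure [CompleteSpace (bergman (Coord k) lam)] (hlam : -1 < lam) :
    SpectralMeasure (Fin m → ℝ) (bergman (Coord k) lam) :=
  diagSpectralMeasure (bergmanBasis hlam) degreePt

theorem isJointSpectralMeasure_rotationOp [CompleteSpace (bergman (Coord k) lam)]
    (hlam : -1 < lam) :
    IsJointSpectralMeasure (rotationOp k lam) (rotationSpectralMeasure hlam) := by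
  intro j
  refine diagSpectralMeasure_isIntegral (fun f => ?_) fun f α => ?_
  · rw [mem_domain_rotationOp_iff hlam]
    simp only [degreePt, latticePt, coe_bergmanBasis, inner_basisVec, Complex.ofReal_natCast,
      Complex.norm_natCast]
  · rw [coe_bergmanBasis, inner_basisVec, inner_basisVec, fourierCoefficient_rotationOp hlam]
    simp [degreePt, latticePt]

theorem eq_rotationSpectralMeasure [CompleteSpace (bergman (Coord k) lam)] (hlam : -1 < lam)
    {E : SpectralMeasure (Fin m → ℝ) (bergman (Coord k) lam)}
    (hE : IsJointSpectralMeasure (rotationOp k lam) E) : E = rotationSpectralMeasure hlam := by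
  refine hE.eq_diagSpectralMeasure (hdom := fun j α => ?_) (fun j α => ?_)
  · rw [coe_bergmanBasis]
    exact basisVec_mem_domain_rotationOp hlam j α
  · simp only [coe_bergmanBasis]
    rw [rotationOp_basisVec]
    simp [degreePt, latticePt]

end RotationOperator

/-! ### The unitary representation on the Bergman space -/

section Representation

variable {ι : Type*} [Fintype ι] [DecidableEq ι] {lam : ℝ}

theorem coeFn_bergmanRep (U : Matrix.unitaryGroup ι ℂ) (f : bergman ι lam) :
    (bergmanRep lam U f).1 =ᵐ[bergmanMeasure ι lam]
      f.1 ∘ Matrix.mulVec ((U⁻¹ : Matrix.unitaryGroup ι ℂ) : Matrix ι ι ℂ) :=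
  Lp.coeFn_compMeasurePreserving f.1 (unitary_measurePreserving lam U⁻¹)

omit [DecidableEq ι] in
theorem bergman_ext {f g : bergman ι lam} (h : f.1 =ᵐ[bergmanMeasure ι lam] g.1) : f = g :=
  Subtype.ext (Lp.ext h)

theorem bergmanRep_mul (U V : Matrix.unitaryGroup ι ℂ) :
    bergmanRep lam U ∘L bergmanRep lam V = bergmanRep lam (U * V) := by
  refine ContinuousLinearMap.ext fun f => bergman_ext ?_
  refine (coeFn_bergmanRep U _).trans (((unitary_measurePreserving lam
    U⁻¹).quasiMeasurePreserving.ae_eq_comp (coeFn_bergmanRep V f)).trans ?_)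
  refine Filter.EventuallyEq.trans (Filter.Eventually.of_forall fun z => ?_)
    (coeFn_bergmanRep (U * V) f).symm
  simp only [Function.comp_apply, Matrix.mulVec_mulVec, mul_inv_rev, Matrix.UnitaryGroup.mul_val]

theorem bergmanRep_one : bergmanRep lam (1 : Matrix.unitaryGroup ι ℂ) =
    ContinuousLinearMap.id ℂ (bergman ι lam) := by
  refine ContinuousLinearMap.ext fun f => bergman_ext ?_
  refine (coeFn_bergmanRep 1 _).trans (Filter.Eventually.of_forall fun z => ?_)
  simp

theorem inner_bergmanRep (U : Matrix.unitaryGroup ι ℂ) (f g : bergman ι lam) :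
    ⟪bergmanRep lam U f, bergmanRep lam U g⟫_ℂ = ⟪f, g⟫_ℂ :=
  (Lp.compMeasurePreservingₗᵢ ℂ _ (unitary_measurePreserving lam U⁻¹)).inner_map_map f.1 g.1

theorem inner_bergmanRep_right (U : Matrix.unitaryGroup ι ℂ) (f g : bergman ι lam) :
    ⟪f, bergmanRep lam U g⟫_ℂ = ⟪bergmanRep lam U⁻¹ f, g⟫_ℂ := by
  have h : bergmanRep lam U (bergmanRep lam U⁻¹ f) = f := by
    have := congrArg (fun T => T f) (bergmanRep_mul (lam := lam) U U⁻¹)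
    rwa [mul_inv_cancel, bergmanRep_one] at this
  rw [← inner_bergmanRep U (bergmanRep lam U⁻¹ f), h]

theorem star_bergmanRep [CompleteSpace (bergman ι lam)] (U : Matrix.unitaryGroup ι ℂ) :
    star (bergmanRep lam U) = bergmanRep lam U⁻¹ := by
  rw [ContinuousLinearMap.star_eq_adjoint]
  symm
  rw [ContinuousLinearMap.eq_adjoint_iff]
  intro f g
  exact (inner_bergmanRep_right U f g).symm

/-- The basis vectors are weight vectors of the diagonal torus; the inverse appears because the
action is `f ∘ U⁻¹`. -/
theorem bergmanRep_diagUnitary (hlam : -1 < lam) (u : ι → Circle) (α : ι → ℕ) :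
    bergmanRep lam (diagUnitary u) (basisVec hlam α) =
      ((∏ i, u⁻¹ i ^ α i : Circle) : ℂ) • basisVec hlam α := by
  refine bergman_ext ((coeFn_bergmanRep _ _).trans ?_)
  refine ((unitary_measurePreserving lam _).quasiMeasurePreserving.ae_eq_comp
    (coeFn_basisVec hlam α)).trans ?_
  refine Filter.EventuallyEq.trans ?_ (Lp.coeFn_smul _ (basisVec hlam α).1).symm
  filter_upwards [coeFn_basisVec hlam α] with z hz
  rw [Function.comp_apply, diagUnitary_inv, mulVec_diagUnitary, basisFun_rot, Pi.smul_apply, hz,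
    smul_eq_mul]

/-- Operators that commute with a diagonal unitary respect its eigenspaces. -/
theorem inner_basisVec_eq_zero_of_commute (hlam : -1 < lam) {T : bergman ι lam →L[ℂ] bergman ι lam}
    {u : ι → Circle} (hT : T ∘L bergmanRep lam (diagUnitary u) = bergmanRep lam (diagUnitary u) ∘L T)
    {α β : ι → ℕ} (h : ∏ i, u i ^ α i ≠ ∏ i, u i ^ β i) :
    ⟪basisVec hlam β, T (basisVec hlam α)⟫_ℂ = 0 := by
  have h1 := congrArg (fun S : bergman ι lam →L[ℂ] bergman ι lam =>
    ⟪basisVec hlam β, S (basisVec hlam α)⟫_ℂ) hT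
  simp only [ContinuousLinearMap.comp_apply] at h1
  rw [inner_bergmanRep_right, diagUnitary_inv, bergmanRep_diagUnitary, bergmanRep_diagUnitary,
    map_smul, bergman.inner_smul_right,
    inner_smul_left (𝕜 := ℂ) (E := bergman ι lam) (basisVec hlam β), inv_inv] at h1
  have h2 : ∀ γ : ι → ℕ, (∏ i, u⁻¹ i ^ γ i : Circle) = (∏ i, u i ^ γ i)⁻¹ := by
    intro γ
    simp [Finset.prod_inv_distrib]
  rw [h2, ← Circle.coe_inv_eq_conj] at h1
  by_contra hne
  exact h (inv_injective (Circle.ext (mul_right_cancel₀ hne h1)))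

end Representation

/-! ### Block diagonal unitaries and monomials -/

section BlockUnitary

variable {m : ℕ} {k : Fin m → ℕ} {lam : ℝ}

/-- The block diagonal unitary matrix with the given blocks. -/
def blockUnitary (u : ∀ j, Matrix.unitaryGroup (Fin (k j)) ℂ) : Matrix.unitaryGroup (Coord k) ℂ :=
  ⟨Matrix.blockDiagonal' fun j => (u j : Matrix (Fin (k j)) (Fin (k j)) ℂ), by
    rw [Matrix.mem_unitaryGroup_iff', Matrix.star_eq_conjTranspose,
      Matrix.blockDiagonal'_conjTranspose, ← Matrix.blockDiagonal'_mul, ← Matrix.blockDiagonal'_one]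
    congr 1
    funext j
    exact Matrix.mem_unitaryGroup_iff'.1 (u j).2⟩

theorem blockUnitary_mem (u : ∀ j, Matrix.unitaryGroup (Fin (k j)) ℂ) :
    blockUnitary u ∈ blockUnitaryGroup k :=
  ⟨u, rfl⟩

theorem exists_blockUnitary {U : Matrix.unitaryGroup (Coord k) ℂ} (hU : U ∈ blockUnitaryGroup k) :
    ∃ u, U = blockUnitary u := by
  obtain ⟨u, hu⟩ := hU
  exact ⟨u, Subtype.ext hu⟩

theorem blockUnitary_mul (u v : ∀ j, Matrix.unitaryGroup (Fin (k j)) ℂ) :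
    blockUnitary u * blockUnitary v = blockUnitary fun j => u j * v j :=
  Subtype.ext (Matrix.blockDiagonal'_mul _ _).symm

theorem blockUnitary_one : blockUnitary (fun j : Fin m => (1 : Matrix.unitaryGroup (Fin (k j)) ℂ)) = 1 :=
  Subtype.ext Matrix.blockDiagonal'_one

theorem blockUnitary_inv (u : ∀ j, Matrix.unitaryGroup (Fin (k j)) ℂ) :
    (blockUnitary u)⁻¹ = blockUnitary fun j => (u j)⁻¹ := by
  refine inv_eq_of_mul_eq_one_right ?_
  rw [blockUnitary_mul, ← blockUnitary_one]
  simp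

theorem diagUnitary_eq_blockUnitary (u : Coord k → Circle) :
    diagUnitary u = blockUnitary fun j => diagUnitary fun l => u ⟨j, l⟩ :=
  Subtype.ext (Matrix.blockDiagonal'_diagonal fun (j : Fin m) (l : Fin (k j)) => (u ⟨j, l⟩ : ℂ)).symm

theorem diagUnitary_mem (u : Coord k → Circle) : diagUnitary u ∈ blockUnitaryGroup k := by
  rw [diagUnitary_eq_blockUnitary]
  exact blockUnitary_mem _

theorem mulVec_blockUnitary (u : ∀ j, Matrix.unitaryGroup (Fin (k j)) ℂ) (z : Coord k → ℂ)
    (j : Fin m) (l : Fin (k j)) :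
    Matrix.mulVec (blockUnitary u : Matrix (Coord k) (Coord k) ℂ) z ⟨j, l⟩ =
      ∑ l', (u j : Matrix (Fin (k j)) (Fin (k j)) ℂ) l l' * z ⟨j, l'⟩ := by
  simp only [Matrix.mulVec, dotProduct, blockUnitary]
  rw [Fintype.sum_sigma, Finset.sum_eq_single j]
  · simp [Matrix.blockDiagonal'_apply_eq]
  · intro i _ hi
    refine Finset.sum_eq_zero fun l' _ => ?_
    rw [Matrix.blockDiagonal'_apply_ne _ _ _ (Ne.symm hi), zero_mul]
  · simp

/-- Block unitaries preserve the degree in every group of variables. -/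
theorem inner_basisVec_blockUnitary (hlam : -1 < lam) {U : Matrix.unitaryGroup (Coord k) ℂ}
    (hU : U ∈ blockUnitaryGroup k) {α β : Coord k → ℕ} (h : groupDegree α ≠ groupDegree β) :
    ⟪basisVec hlam β, bergmanRep lam U (basisVec hlam α)⟫_ℂ = 0 := by
  obtain ⟨u, rfl⟩ := exists_blockUnitary hU
  obtain ⟨j, hj⟩ := Function.ne_iff.1 h
  obtain ⟨w, hw⟩ := exists_circle_pow_ne hj
  set c : Fin m → Circle := Pi.mulSingle j w with hc
  -- A diagonal matrix that is scalar on each block commutes with all block unitaries, and its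
  -- weight on `e_γ` sees only the group degrees of `γ`.
  refine inner_basisVec_eq_zero_of_commute (u := fun i => c i.1) hlam ?_ ?_
  · rw [bergmanRep_mul, bergmanRep_mul, diagUnitary_eq_blockUnitary, blockUnitary_mul,
      blockUnitary_mul]
    congr 2
    funext i
    refine Subtype.ext ?_
    change _ * Matrix.diagonal _ = Matrix.diagonal _ * _
    ext a b
    rw [Matrix.mul_diagonal, Matrix.diagonal_mul, mul_comm]
  · have hprod : ∀ γ : Coord k → ℕ, ∏ i, c i.1 ^ γ i = w ^ groupDegree γ j := by
      intro γ
      rw [Fintype.prod_sigma, Finset.prod_eq_single j]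
      · simp [hc, groupDegree, Finset.prod_pow_eq_pow_sum]
      · intro i _ hi
        simp [hc, Pi.mulSingle_eq_of_ne hi]
      · simp
    rwa [hprod, hprod]

/-- The diagonal torus lies in `𝐔(k)`, and rotating a single coordinate already distinguishes two
different multi-indices. -/
theorem equivariantOps_diagonal (hlam : -1 < lam)
    {T : bergman (Coord k) lam →L[ℂ] bergman (Coord k) lam} (hT : T ∈ equivariantOps k lam)
    {α β : Coord k → ℕ} (h : β ≠ α) : ⟪basisVec hlam β, T (basisVec hlam α)⟫_ℂ = 0 := by
  obtain ⟨i, hi⟩ := Function.ne_iff.1 h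
  obtain ⟨w, hw⟩ := exists_circle_pow_ne hi
  refine inner_basisVec_eq_zero_of_commute (u := Pi.mulSingle i w) hlam (hT _ (diagUnitary_mem _)) ?_
  have hprod : ∀ γ : Coord k → ℕ, ∏ i', (Pi.mulSingle i w : Coord k → Circle) i' ^ γ i' = w ^ γ i := by
    intro γ
    rw [Finset.prod_eq_single i]
    · simp
    · intro j _ hj
      simp [Pi.mulSingle_eq_of_ne hj]
    · simp
  rw [hprod, hprod]
  exact hw.symm

/-- The reflection-like unitary matrix `1 + (i - 1) P` with `P` the projection to the constant
vectors: all its entries are nonzero. -/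
theorem exists_unitary_entries_ne_zero (n : ℕ) :
    ∃ u : Matrix.unitaryGroup (Fin n) ℂ, ∀ a b, (u : Matrix (Fin n) (Fin n) ℂ) a b ≠ 0 := by
  set P : Matrix (Fin n) (Fin n) ℂ := Matrix.of fun _ _ => ((n : ℝ)⁻¹ : ℂ) with hP
  have hPs : star P = P := by
    ext a b
    simp [hP, Matrix.star_apply]
  have hPP : P * P = P := by
    ext a b
    have hn : (n : ℂ) ≠ 0 := by
      have := a.pos
      exact_mod_cast this.ne'
    simp [hP, Matrix.mul_apply, hn]
  refine ⟨⟨1 + (Complex.I - 1) • P, ?_⟩, fun a b h => ?_⟩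
  · rw [Matrix.mem_unitaryGroup_iff', star_add, star_one, star_smul, hPs]
    have : (star (Complex.I - 1) : ℂ) = -Complex.I - 1 := by simp
    rw [this, mul_add, mul_one, add_mul, one_mul, smul_mul_smul_comm, hPP, add_assoc, add_eq_left,
      ← add_smul, ← add_smul]
    have h2 : (-Complex.I - 1) + (Complex.I - 1 + (-Complex.I - 1) * (Complex.I - 1)) = 0 := by
      linear_combination -Complex.I_mul_I
    rw [h2, zero_smul]
  -- Every entry, on or off the diagonal, has imaginary part `1 / n`.
  · have h1 := congrArg Complex.im h
    have hn : (n : ℝ) ≠ 0 := by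
      have := a.pos
      exact_mod_cast this.ne'
    by_cases hab : a = b <;>
      simp [hP, hab] at h1
    · exact hn (by exact_mod_cast h1)
    · exact hn (by exact_mod_cast h1)

/-- The multi-index with group degrees `s` that is supported on the first variable of each group. -/
def leadingIndex (hk : ∀ j, 0 < k j) (s : Fin m → ℕ) : Coord k → ℕ :=
  fun i => if i.2 = ⟨0, hk i.1⟩ then s i.1 else 0

theorem groupDegree_leadingIndex (hk : ∀ j, 0 < k j) (s : Fin m → ℕ) :
    groupDegree (leadingIndex hk s) = s := by
  funext j
  rw [groupDegree, Finset.sum_eq_single ⟨0, hk j⟩]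
  · simp [leadingIndex]
  · intro l _ hl
    simp [leadingIndex, hl]
  · simp

theorem prod_leadingIndex (hk : ∀ j, 0 < k j) (s : Fin m → ℕ) (z : Coord k → ℂ) :
    ∏ i, z i ^ leadingIndex hk s i = ∏ j, z ⟨j, ⟨0, hk j⟩⟩ ^ s j := by
  rw [Fintype.prod_sigma]
  refine Finset.prod_congr rfl fun j _ => ?_
  rw [Finset.prod_eq_single ⟨0, hk j⟩]
  · simp [leadingIndex]
  · intro l _ hl
    simp [leadingIndex, hl]
  · simp

/-- The multi-index with the given parts. -/
def joinIndex (p : ∀ j, Fin (k j) → ℕ) : Coord k → ℕ := fun i => p i.1 i.2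

/-- The multinomial theorem in every block, multiplied out: `p` runs over all multi-indices with
group degrees `s`. -/
theorem prod_pow_sum (s : Fin m → ℕ) (c : Coord k → ℂ) (z : Coord k → ℂ) :
    ∏ j, (∑ l, c ⟨j, l⟩ * z ⟨j, l⟩) ^ s j =
      ∑ p ∈ Fintype.piFinset fun j => Finset.piAntidiag (Finset.univ : Finset (Fin (k j))) (s j),
        ((∏ j, (Nat.multinomial Finset.univ (p j) : ℂ)) * ∏ i, c i ^ joinIndex p i) *
          ∏ i, z i ^ joinIndex p i := by
  simp only [Finset.sum_pow_eq_sum_piAntidiag, Finset.prod_univ_sum]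
  refine Finset.sum_congr rfl fun p _ => ?_
  rw [Fintype.prod_sigma, Fintype.prod_sigma, ← Finset.prod_mul_distrib, ← Finset.prod_mul_distrib]
  refine Finset.prod_congr rfl fun j _ => ?_
  simp only [joinIndex, mul_pow, Finset.prod_mul_distrib]
  ring

/-- Some block unitary maps a single basis vector to a combination in which every basis vector of
the same group degrees occurs. -/
theorem exists_blockUnitary_inner_ne_zero (hlam : -1 < lam) (hk : ∀ j, 0 < k j) :
    ∃ U ∈ blockUnitaryGroup k, ∀ β : Coord k → ℕ,
      ⟪basisVec hlam β, bergmanRep lam U (basisVec hlam (leadingIndex hk (groupDegree β)))⟫_ℂ ≠ 0 := by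
  choose u hu using fun j => exists_unitary_entries_ne_zero (k j)
  -- The inverse is taken so that the action is composition with `blockUnitary u` itself.
  refine ⟨(blockUnitary u)⁻¹, by rw [blockUnitary_inv]; exact blockUnitary_mem _, fun β => ?_⟩
  set s := groupDegree β with hs
  -- Only the first row of each block enters, since the leading monomial involves only the first
  -- variable of each group.
  set c : Coord k → ℂ := fun i => (u i.1 : Matrix (Fin (k i.1)) (Fin (k i.1)) ℂ) ⟨0, hk i.1⟩ i.2
    with hc
  set A := Fintype.piFinset fun j => Finset.piAntidiag (Finset.univ : Finset (Fin (k j))) (s j)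
  set d : (∀ j, Fin (k j) → ℕ) → ℂ := fun p =>
    (basisConst lam (leadingIndex hk s) : ℂ) / (basisConst lam (joinIndex p) : ℂ) *
      ((∏ j, (Nat.multinomial Finset.univ (p j) : ℂ)) * ∏ i, c i ^ joinIndex p i) with hd
  have hconst : ∀ α : Coord k → ℕ, (basisConst lam α : ℂ) ≠ 0 := fun α =>
    Complex.ofReal_ne_zero.2 (basisConst_pos hlam α).ne'
  have hfun : ∀ z, basisFun lam (leadingIndex hk s)
      (Matrix.mulVec (blockUnitary u : Matrix (Coord k) (Coord k) ℂ) z) =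
      (∑ p ∈ A, d p • basisFun lam (joinIndex p)) z := by
    intro z
    rw [basisFun_eq, prod_leadingIndex]
    simp only [mulVec_blockUnitary]
    have h := prod_pow_sum s c z
    simp only [hc] at h
    rw [h, Finset.mul_sum, Finset.sum_apply]
    refine Finset.sum_congr rfl fun p _ => ?_
    rw [Pi.smul_apply, basisFun_eq, smul_eq_mul]
    simp only [hd, hc]
    have := hconst (joinIndex p)
    field_simp
  have hvec : bergmanRep lam (blockUnitary u)⁻¹ (basisVec hlam (leadingIndex hk s)) =
      ∑ p ∈ A, d p • basisVec hlam (joinIndex p) := by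
    have hrep : IsHolRep lam (∑ p ∈ A, d p • basisVec hlam (joinIndex p) : bergman (Coord k) lam).1
        (∑ p ∈ A, d p • basisFun lam (joinIndex p)) := by
      induction A using Finset.induction_on with
      | empty => exact IsHolRep.zero lam
      | insert p A hp ih =>
        rw [Finset.sum_insert hp, Finset.sum_insert hp]
        exact ((isHolRep_basisVec hlam _).smul (d p)).add ih
    refine bergman_ext ((coeFn_bergmanRep _ _).trans ?_)
    refine ((unitary_measurePreserving lam _).quasiMeasurePreserving.ae_eq_comp
      (coeFn_basisVec hlam _)).trans (Filter.EventuallyEq.trans ?_ hrep.2.symm)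
    refine Filter.Eventually.of_forall fun z => ?_
    rw [Function.comp_apply, inv_inv, hfun]
  set q : ∀ j, Fin (k j) → ℕ := fun j l => β ⟨j, l⟩ with hq
  have hqβ : joinIndex q = β := rfl
  have hqA : q ∈ A := by
    refine Fintype.mem_piFinset.2 fun j => ?_
    rw [Finset.mem_piAntidiag]
    exact ⟨rfl, fun _ _ => Finset.mem_univ _⟩
  have hinner : ⟪basisVec hlam β, ∑ p ∈ A, d p • basisVec hlam (joinIndex p)⟫_ℂ = d q := by
    refine (inner_sum (𝕜 := ℂ) (E := bergman (Coord k) lam) A _ _).trans ?_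
    rw [Finset.sum_eq_single_of_mem q hqA]
    · rw [bergman.inner_smul_right, hqβ,
        inner_self_eq_one_of_norm_eq_one ((orthonormal_basisVec hlam).1 β), mul_one]
    · intro p _ hp
      rw [bergman.inner_smul_right, (orthonormal_basisVec hlam).2, mul_zero]
      intro h
      refine hp (funext fun j => funext fun l => ?_)
      exact (congrFun h ⟨j, l⟩).symm
  -- The coefficient of `e_β` is a product of normalizing constants, multinomial coefficients and
  -- powers of matrix entries, all nonzero.
  rw [hvec, hinner, hd]
  refine mul_ne_zero (div_ne_zero (hconst _) (hconst _)) (mul_ne_zero ?_ ?_)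
  · refine Finset.prod_ne_zero_iff.2 fun j _ => ?_
    exact Nat.cast_ne_zero.2 (Nat.multinomial_pos _ _).ne'
  · exact Finset.prod_ne_zero_iff.2 fun i _ => pow_ne_zero _ (hu i.1 _ _)

end BlockUnitary

/-! ### The commutant of the block unitary group -/

section Commutant

variable {m : ℕ} {k : Fin m → ℕ} {lam : ℝ}

/-- An equivariant operator acts on each basis vector by a scalar, which depends only on the group
degrees. -/
theorem exists_eigenvalues_of_equivariant (hlam : -1 < lam) (hk : ∀ j, 0 < k j)
    {T : bergman (Coord k) lam →L[ℂ] bergman (Coord k) lam} (hT : T ∈ equivariantOps k lam) :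
    ∃ c : (Fin m → ℕ) → ℂ, (∀ s, ‖c s‖ ≤ ‖T‖) ∧
      ∀ α, T (basisVec hlam α) = c (groupDegree α) • basisVec hlam α := by
  have := completeSpace_bergman (ι := Coord k) hlam
  set t : (Coord k → ℕ) → ℂ := fun α => ⟪basisVec hlam α, T (basisVec hlam α)⟫_ℂ with ht
  have hn : ∀ α : Coord k → ℕ, ‖basisVec hlam α‖ = 1 := (orthonormal_basisVec hlam).1
  have hbd : ∀ α, ‖t α‖ ≤ ‖T‖ := by
    intro α
    refine (norm_inner_le_norm (𝕜 := ℂ) (E := bergman (Coord k) lam) _ _).trans ?_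
    rw [hn, one_mul]
    refine (T.le_opNorm _).trans ?_
    rw [hn, mul_one]
  have hdiag : ∀ α, T (basisVec hlam α) = t α • basisVec hlam α := by
    intro α
    refine (bergmanBasis hlam).ext_inner fun β => ?_
    rw [coe_bergmanBasis, bergman.inner_smul_right]
    by_cases hβ : β = α
    · rw [hβ, inner_self_eq_one_of_norm_eq_one (hn α), mul_one]
    · rw [equivariantOps_diagonal hlam hT hβ, (orthonormal_basisVec hlam).2 hβ, mul_zero]
  have hb : ∃ C, ∀ α, ‖t α‖ ≤ C := ⟨‖T‖, hbd⟩
  have hTd : T = diagOp (bergmanBasis hlam) t hb :=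
    (eq_diagOp_iff hb).2 fun α => by rw [coe_bergmanBasis, hdiag]
  have hinner : ∀ α f, ⟪basisVec hlam α, T f⟫_ℂ = t α * ⟪basisVec hlam α, f⟫_ℂ := by
    intro α f
    have h := inner_diagOp (b := bergmanBasis hlam) hb f α
    rwa [← hTd, coe_bergmanBasis] at h
  obtain ⟨U, hU, hne⟩ := exists_blockUnitary_inner_ne_zero hlam hk
  -- Taking the matrix entry of `T π(U) = π(U) T` between the leading index and `β` gives two
  -- eigenvalues times the same nonzero number.
  have heq : ∀ β, t β = t (leadingIndex hk (groupDegree β)) := by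
    intro β
    have h := congrArg (fun S : bergman (Coord k) lam →L[ℂ] bergman (Coord k) lam =>
      ⟪basisVec hlam β, S (basisVec hlam (leadingIndex hk (groupDegree β)))⟫_ℂ) (hT U hU)
    simp only [ContinuousLinearMap.comp_apply] at h
    rw [hinner, hdiag, map_smul, bergman.inner_smul_right] at h
    exact mul_right_cancel₀ (hne β) h
  exact ⟨fun s => t (leadingIndex hk s), fun s => hbd _, fun α => by rw [hdiag, heq]⟩

/-- Matrix entries of a block unitary between different group degrees vanish, and between equal
degrees the two eigenvalues agree. -/
theorem diagOp_mem_equivariantOps [CompleteSpace (bergman (Coord k) lam)] (hlam : -1 < lam)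
    {c : (Fin m → ℕ) → ℂ} (hc : ∃ C, ∀ α : Coord k → ℕ, ‖c (groupDegree α)‖ ≤ C) :
    diagOp (bergmanBasis hlam) (fun α => c (groupDegree α)) hc ∈ equivariantOps k lam := by
  intro U hU
  set T := diagOp (bergmanBasis hlam) (fun α => c (groupDegree α)) hc with hT
  have hfg : ∀ f : bergman (Coord k) lam, HasSum (fun α =>
      fourierCoefficient lam f α • basisVec hlam α) f := by
    intro f
    have h1 := (bergmanBasis hlam).hasSum_repr f
    simpa only [bergmanBasis_repr, coe_bergmanBasis] using h1
  have hbasis : ∀ α, (T ∘L bergmanRep lam U) (basisVec hlam α) =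
      (bergmanRep lam U ∘L T) (basisVec hlam α) := by
    intro α
    refine (bergmanBasis hlam).ext_inner fun β => ?_
    have h1 : T (basisVec hlam α) = c (groupDegree α) • basisVec hlam α := by
      have := diagOp_basis (b := bergmanBasis hlam) hc α
      rwa [coe_bergmanBasis] at this
    rw [ContinuousLinearMap.comp_apply, ContinuousLinearMap.comp_apply, h1, map_smul,
      bergman.inner_smul_right, hT, inner_diagOp, coe_bergmanBasis]
    by_cases h : groupDegree α = groupDegree β
    · rw [h]
    · rw [inner_basisVec_blockUnitary hlam hU h, mul_zero, mul_zero]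
  refine ContinuousLinearMap.ext fun f => ?_
  have h1 := (hfg f).mapL (T ∘L bergmanRep lam U)
  have h2 := (hfg f).mapL (bergmanRep lam U ∘L T)
  simp only [map_smul, hbasis] at h1 h2
  exact h1.unique h2

/-- The equivariant operators form a von Neumann algebra. -/
def equivariantAlgebra [CompleteSpace (bergman (Coord k) lam)] :
    VonNeumannAlgebra (bergman (Coord k) lam) where
  toStarSubalgebra := StarSubalgebra.centralizer ℂ (bergmanRep lam '' blockUnitaryGroup k)
  -- A commutant equals its own double commutant, since the triple commutant of any set is its
  -- commutant.
  centralizer_centralizer' := by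
    exact Set.centralizer_centralizer_centralizer _

/-- The star centralizer also asks for commutation with adjoints. This is automatic: the adjoint of
`π(U)` is `π(U⁻¹)`, and `𝐔(k)` is closed under inverses. -/
theorem coe_equivariantAlgebra [CompleteSpace (bergman (Coord k) lam)] :
    ((equivariantAlgebra : VonNeumannAlgebra (bergman (Coord k) lam)) :
      Set (bergman (Coord k) lam →L[ℂ] bergman (Coord k) lam)) = equivariantOps k lam := by
  ext T
  have h1 : T ∈ (equivariantAlgebra : VonNeumannAlgebra (bergman (Coord k) lam)) ↔
      T ∈ StarSubalgebra.centralizer ℂ (bergmanRep lam '' blockUnitaryGroup k) := Iff.rfl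
  rw [SetLike.mem_coe, h1, StarSubalgebra.mem_centralizer_iff]
  constructor
  · exact fun h U hU => (h _ ⟨U, hU, rfl⟩).1.symm
  · rintro h _ ⟨U, hU, rfl⟩
    refine ⟨(h U hU).symm, ?_⟩
    rw [star_bergmanRep]
    obtain ⟨u, rfl⟩ := exists_blockUnitary hU
    rw [blockUnitary_inv]
    exact (h _ (blockUnitary_mem _)).symm

theorem finite_setOf_groupDegree (s : Fin m → ℕ) :
    {α : Coord k → ℕ | ∀ j, groupDegree α j = s j}.Finite := by
  refine (Set.finite_Iic (fun i : Coord k => s i.1)).subset fun α hα i => ?_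
  refine le_of_le_of_eq ?_ (hα i.1)
  exact Finset.single_le_sum (f := fun l => α ⟨i.1, l⟩) (fun _ _ => Nat.zero_le _)
    (Finset.mem_univ i.2)

theorem homogeneousPart_eq (hlam : -1 < lam) (s : Fin m → ℕ) : homogeneousPart k lam s =
    Submodule.span ℂ (basisVec hlam '' {α : Coord k → ℕ | ∀ j, groupDegree α j = s j}) := by
  unfold homogeneousPart
  congr 1
  ext e
  constructor
  · rintro ⟨α, hα, he⟩
    exact ⟨α, hα, bergman_ext ((coeFn_basisVec hlam α).trans he.symm)⟩
  · rintro ⟨α, hα, rfl⟩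
    exact ⟨α, hα, coeFn_basisVec hlam α⟩

theorem finiteDimensional_homogeneousPart (hlam : -1 < lam) (s : Fin m → ℕ) :
    FiniteDimensional ℂ (homogeneousPart k lam s) := by
  rw [homogeneousPart_eq hlam]
  exact FiniteDimensional.span_of_finite ℂ ((finite_setOf_groupDegree s).image _)

/-- Since no group of variables is empty, every tuple of degrees is attained by a monomial, so
division by the dimension is meaningful. -/
theorem finrank_homogeneousPart_ne_zero (hlam : -1 < lam) (hk : ∀ j, 0 < k j) (s : Fin m → ℕ) :
    Module.finrank ℂ (homogeneousPart k lam s) ≠ 0 := by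
  have := finiteDimensional_homogeneousPart (k := k) hlam s
  have hmem : basisVec hlam (leadingIndex hk s) ∈ homogeneousPart k lam s := by
    rw [homogeneousPart_eq hlam]
    exact Submodule.subset_span ⟨_, fun j => by rw [groupDegree_leadingIndex], rfl⟩
  have : Nontrivial (homogeneousPart k lam s) := by
    refine ⟨⟨⟨_, hmem⟩, 0, fun h => ?_⟩⟩
    have h1 := (orthonormal_basisVec hlam).1 (leadingIndex hk s)
    have h2 : basisVec hlam (leadingIndex hk s) = 0 := congrArg Subtype.val h
    rw [h2, norm_zero] at h1
    exact zero_ne_one h1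
  exact Module.finrank_pos.ne'

theorem apply_homogeneousPart (hlam : -1 < lam)
    {T : bergman (Coord k) lam →L[ℂ] bergman (Coord k) lam} {c : (Fin m → ℕ) → ℂ}
    (hT : ∀ α, T (basisVec hlam α) = c (groupDegree α) • basisVec hlam α) (s : Fin m → ℕ)
    {f : bergman (Coord k) lam} (hf : f ∈ homogeneousPart k lam s) : T f = c s • f := by
  rw [homogeneousPart_eq hlam] at hf
  induction hf using Submodule.span_induction with
  | mem f hf =>
    obtain ⟨α, hα, rfl⟩ := hf
    rw [hT, show groupDegree α = s from funext hα]
  | zero => simp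
  | add f g _ _ hf hg => rw [map_add, hf, hg, smul_add]
  | smul a f _ hf => rw [map_smul, hf, smul_comm]

theorem trace_restrict_homogeneousPart (hlam : -1 < lam) (hk : ∀ j, 0 < k j)
    {T : bergman (Coord k) lam →L[ℂ] bergman (Coord k) lam} {c : (Fin m → ℕ) → ℂ}
    (hT : ∀ α, T (basisVec hlam α) = c (groupDegree α) • basisVec hlam α) (s : Fin m → ℕ)
    (h : ∀ f ∈ homogeneousPart k lam s,
      (T : bergman (Coord k) lam →ₗ[ℂ] bergman (Coord k) lam) f ∈ homogeneousPart k lam s) :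
    LinearMap.trace ℂ (homogeneousPart k lam s)
      ((T : bergman (Coord k) lam →ₗ[ℂ] bergman (Coord k) lam).restrict h) /
        (Module.finrank ℂ (homogeneousPart k lam s) : ℂ) = c s := by
  have := finiteDimensional_homogeneousPart (k := k) hlam s
  have h1 : (T : bergman (Coord k) lam →ₗ[ℂ] bergman (Coord k) lam).restrict h =
      c s • LinearMap.id := by
    refine LinearMap.ext fun f => Subtype.ext ?_
    exact apply_homogeneousPart hlam hT s f.2
  rw [h1, map_smul, LinearMap.trace_id, smul_eq_mul, mul_div_cancel_right₀]
  exact Nat.cast_ne_zero.2 (finrank_homogeneousPart_ne_zero hlam hk s)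

end Commutant

/-! ### Functions of the rotation operators -/

section Calculus

variable {m : ℕ} {k : Fin m → ℕ} {lam : ℝ} [CompleteSpace (bergman (Coord k) lam)]

theorem boundedOnLattice_iff {ψ : (Fin m → ℝ) → ℂ} :
    BoundedOnLattice ψ ↔ ∃ C, ∀ s : Fin m → ℕ, ‖ψ (latticePt s)‖ ≤ C := by
  rw [BoundedOnLattice, memℓp_infty_iff]
  constructor
  · rintro ⟨C, hC⟩
    exact ⟨C, fun s => hC ⟨s, rfl⟩⟩
  · rintro ⟨C, hC⟩
    refine ⟨C, ?_⟩
    rintro _ ⟨s, rfl⟩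
    exact hC s

theorem existsUnique_rotationIntegral (hlam : -1 < lam) {ψ : (Fin m → ℝ) → ℂ}
    (hψ : (rotationSpectralMeasure (k := k) hlam).EssBounded ψ) :
    ∃! T : bergman (Coord k) lam →L[ℂ] bergman (Coord k) lam,
      (rotationSpectralMeasure hlam).IsIntegral ψ (boundedOp T) := by
  have h := diagSpectralMeasure_essBounded_iff.1 hψ
  exact ⟨_, (diagSpectralMeasure_isIntegral_iff h).2 rfl,
    fun T hT => (diagSpectralMeasure_isIntegral_iff h).1 hT⟩

/-- If an operator acts on the basis vectors by scalars that depend on the group degrees through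
`ψ`, then it is the integral of `ψ`. -/
theorem isIntegral_of_apply_basisVec (hlam : -1 < lam)
    {T : bergman (Coord k) lam →L[ℂ] bergman (Coord k) lam} {ψ : (Fin m → ℝ) → ℂ} {C : ℝ}
    (hC : ∀ s : Fin m → ℕ, ‖ψ (latticePt s)‖ ≤ C)
    (hT : ∀ α, T (basisVec hlam α) = ψ (latticePt (groupDegree α)) • basisVec hlam α) :
    (rotationSpectralMeasure (k := k) hlam).EMeasurable ψ ∧
      (rotationSpectralMeasure (k := k) hlam).EssBounded ψ ∧ BoundedOnLattice ψ ∧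
      (rotationSpectralMeasure hlam).IsIntegral ψ (boundedOp T) := by
  have hb : ∃ C, ∀ α : Coord k → ℕ, ‖ψ (degreePt α)‖ ≤ C := ⟨C, fun α => hC _⟩
  refine ⟨diagSpectralMeasure_eMeasurable ψ, diagSpectralMeasure_essBounded_iff.2 hb,
    boundedOnLattice_iff.2 ⟨C, hC⟩, (diagSpectralMeasure_isIntegral_iff hb).2 ?_⟩
  rw [eq_diagOp_iff hb]
  intro α
  rw [coe_bergmanBasis, hT]
  rfl

theorem latticePt_injective : Function.Injective (latticePt : (Fin m → ℕ) → Fin m → ℝ) := by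
  intro s t h
  funext j
  exact Nat.cast_injective (R := ℝ) (congrFun h j)

theorem functionsOf_rotationSpectralMeasure (hlam : -1 < lam) (hk : ∀ j, 0 < k j) :
    functionsOf (rotationSpectralMeasure (k := k) hlam) = equivariantOps k lam := by
  ext T
  constructor
  · rintro ⟨ψ, -, hψ, -, hT⟩
    have h := diagSpectralMeasure_essBounded_iff.1 hψ
    rw [(diagSpectralMeasure_isIntegral_iff h).1 hT]
    exact diagOp_mem_equivariantOps (c := fun s => ψ (latticePt s)) hlam h
  · intro hT
    obtain ⟨c, hc, hTc⟩ := exists_eigenvalues_of_equivariant hlam hk hT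
    -- The value `0` off the lattice is arbitrary, because the spectral measure is carried by
    -- lattice points.
    refine ⟨Function.extend latticePt c 0, ?_⟩
    have hval : ∀ s, Function.extend latticePt c 0 (latticePt s) = c s :=
      fun s => latticePt_injective.extend_apply _ _ _
    refine isIntegral_of_apply_basisVec hlam (C := ‖T‖) (fun s => ?_) fun α => ?_
    · rw [hval]
      exact hc s
    · rw [hval, hTc]

end Calculus

theorem mainTheorem3 {m : ℕ} (k : Fin m → ℕ) (hk : ∀ j, 0 < k j) (lam : ℝ) (hlam : -1 < lam) :
    -- the domain of `V_(j)`
    (∀ (j : Fin m) (f : bergman (Coord k) lam), f ∈ (rotationOp k lam j).domain ↔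
      Summable (fun α : Coord k → ℕ =>
        (groupDegree α j : ℝ) ^ 2 * ‖fourierCoefficient lam f α‖ ^ 2)) ∧
    -- the tuple `V` has a joint spectral measure `E`, and only one
    ∃ E : SpectralMeasure (Fin m → ℝ) (bergman (Coord k) lam),
      IsJointSpectralMeasure (rotationOp k lam) E ∧
      (∀ E', IsJointSpectralMeasure (rotationOp k lam) E' → E' = E) ∧
      -- `ψ(V)` is a well-defined bounded operator
      (∀ ψ : (Fin m → ℝ) → ℂ, E.EMeasurable ψ → E.EssBounded ψ →
        ∃! T : bergman (Coord k) lam →L[ℂ] bergman (Coord k) lam, E.IsIntegral ψ (boundedOp T)) ∧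
      -- the algebra of functions of `V` is the von Neumann algebra of equivariant operators
      (∃ (_ : CompleteSpace (bergman (Coord k) lam)) (M : VonNeumannAlgebra (bergman (Coord k) lam)),
        (M : Set (bergman (Coord k) lam →L[ℂ] bergman (Coord k) lam)) = equivariantOps k lam ∧
        functionsOf E = (M : Set (bergman (Coord k) lam →L[ℂ] bergman (Coord k) lam))) ∧
      -- every equivariant operator is `ψ(V)` with `ψ(s) = tr(T|_{H_s}) / dim H_s`
      ∀ T ∈ equivariantOps k lam,
        ∃ hT : ∀ s, ∀ f ∈ homogeneousPart k lam s,
            (T : bergman (Coord k) lam →ₗ[ℂ] bergman (Coord k) lam) f ∈ homogeneousPart k lam s,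
          ∀ ψ : (Fin m → ℝ) → ℂ,
            (∀ s : Fin m → ℕ, ψ (latticePt s) =
              LinearMap.trace ℂ (homogeneousPart k lam s)
                ((T : bergman (Coord k) lam →ₗ[ℂ] bergman (Coord k) lam).restrict (hT s)) /
              (Module.finrank ℂ (homogeneousPart k lam s) : ℂ)) →
            E.EMeasurable ψ ∧ E.EssBounded ψ ∧ BoundedOnLattice ψ ∧
              E.IsIntegral ψ (boundedOp T) := by
  have := completeSpace_bergman (ι := Coord k) hlam
  refine ⟨mem_domain_rotationOp_iff hlam, rotationSpectralMeasure hlam,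
    isJointSpectralMeasure_rotationOp hlam, fun E' hE' => eq_rotationSpectralMeasure hlam hE',
    fun ψ _ hψ => existsUnique_rotationIntegral hlam hψ,
    ⟨inferInstance, equivariantAlgebra, coe_equivariantAlgebra, ?_⟩, fun T hT => ?_⟩
  · rw [coe_equivariantAlgebra, functionsOf_rotationSpectralMeasure hlam hk]
  · obtain ⟨c, hc, hTc⟩ := exists_eigenvalues_of_equivariant hlam hk hT
    have hmem : ∀ s, ∀ f ∈ homogeneousPart k lam s,
        (T : bergman (Coord k) lam →ₗ[ℂ] bergman (Coord k) lam) f ∈ homogeneousPart k lam s := by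
      intro s f hf
      have h : T f = c s • f := apply_homogeneousPart hlam hTc s hf
      change T f ∈ _
      rw [h]
      exact Submodule.smul_mem _ _ hf
    refine ⟨hmem, fun ψ hψ => ?_⟩
    -- The hypothesis on `ψ` becomes `ψ(s) = c s`, with `c s` the scalar by which `T` acts on `H_s`.
    simp only [trace_restrict_homogeneousPart hlam hk hTc] at hψ
    refine isIntegral_of_apply_basisVec hlam (C := ‖T‖) (fun s => ?_) fun α => ?_
    · rw [hψ]
      exact hc s
    · rw [hψ, hTc]

end
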